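/- For $\alpha\in(0,1)$ and an integer $d\ge 2$ let $\mathbb T_d^\alpha$ be the rooted $(d+1)$-regular tree (every vertex, including the root, has degree $d+1$) in which every edge between a vertex of generation $n$ and a vertex of generation $n+1$ has weight $\lambda=\alpha^n$, $n\ge 0$, with killing measure $\kappa\equiv 0$ if $\alpha>1/d$, and $\kappa=1$ at the root and $\kappa=0$ elsewhere if $\alpha\le 1/d$. Its cable system $\tilde{\mathbb T}_d^\alpha$ is obtained by glueing, through their endpoints, an interval of length $1/(2\lambda_{x,y})$ for each edge $\{x,y\}$, and by attaching to each vertex $x$ a half-open interval of length $1/(2\kappa_x)$ (of infinite length if $\kappa_x=0$). Let $m$ be the Lebesgue measure on $\tilde{\mathbb T}_d^\alpha$, and let $g$ be the Green function, with respect to $m$, of the diffusion on $\tilde{\mathbb T}_d^\alpha$ associated with the Dirichlet form $\mathcal E(f,f')=\frac12(\nabla f,\nabla f')_m$, where $\nabla$ is the derivative along the cables. Let $(\varphi_x)_{x\in\tilde{\mathbb T}_d^\alpha}$ be the Gaussian free field, that is, the centered Gaussian process with (almost surely) continuous sample paths and covariance $\mathbb E[\varphi_x\varphi_y]=g(x,y)$,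 and set $E^{\ge h}=\{x\in\tilde{\mathbb T}_d^\alpha:\varphi_x\ge h\}$ for $h\in\mathbb R$. A connected subset of $\tilde{\mathbb T}_d^\alpha$ is called unbounded if it contains infinitely many vertices, and $$\tilde h_*=\inf\{h\in\mathbb R:\ \mathbb P(E^{\ge h}\text{ contains an unbounded connected component})=0\}\qquad(\inf\varnothing=\infty).$$ **Proposition.** There is an absolute constant $\overline C<\infty$ such that, for all $\alpha\in(0,1)$ and all integers $d\ge2$ with $$d\Big(1-\exp\Big(-\frac{\sqrt\alpha}{d\alpha+1}\Big)\Big)>\overline C,$$ almost surely, for every $h\in\mathbb R$, the set $E^{\ge h}$ contains an unbounded connected component. Hence $\tilde h_*=\infty$. -/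

import Mathlib

open MeasureTheory ProbabilityTheory Filter Topology

/-- A massive weighted graph `(G, λ, κ)`: a connected, locally finite simple graph with vertex set
`V`, positive edge weights and a finite killing measure. Every undirected edge is listed exactly
once in `E`; the orientation `src e → tgt e` is only used to parametrize its cable. -/
structure MassiveGraph (V E : Type*) where
  src : E → V
  tgt : E → V
  src_ne_tgt : ∀ e, src e ≠ tgt e
  edge_injective : Function.Injective fun e => s(src e, tgt e)
  connected : (SimpleGraph.fromRel fun x y => ∃ e, src e = x ∧ tgt e = y).Connected
  locallyFinite : ∀ x, {e | src e = x ∨ tgt e = x}.Finite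
  weight : E → ℝ
  weight_pos : ∀ e, 0 < weight e
  killing : V → ℝ
  killing_nonneg : ∀ x, 0 ≤ killing x

namespace MassiveGraph

variable {V E : Type*} (G : MassiveGraph V E)

/-- The interval `(0, ρ_e)` with `ρ_e = 1 / (2 λ_e)`, parametrizing the open cable `I_e`. -/
def edgeInterval (e : E) : Set ℝ := Set.Ioo 0 (1 / (2 * G.weight e))

/-- The interval `(0, ρ_x)` with `ρ_x = 1 / (2 κ_x)`, and `ρ_x = ∞` if `κ_x = 0`, parametrizing the
cable `I_x` attached to the vertex `x` (without `x` itself). -/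
def spurInterval (x : V) : Set ℝ := {t | 0 < t ∧ 2 * G.killing x * t < 1}

/-- The points of the cable system: the vertices, the inner points of the cables `I_e`, and the
points other than `x` of the half-open cables `I_x`. -/
inductive Cable : Type _
  | vertex (x : V) : Cable
  | onEdge (e : E) (t : G.edgeInterval e) : Cable
  | onSpur (x : V) (t : G.spurInterval x) : Cable

open Classical in
/-- The point of the closed cable of `e` at distance `t` from `src e`, for `0 ≤ t ≤ ρ_e`
(the parameter is clamped to `[0, ρ_e]`). -/
noncomputable def edgePoint (e : E) (t : ℝ) : G.Cable :=
  if h : t ∈ G.edgeInterval e then .onEdge e ⟨t, h⟩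
  else if t ≤ 0 then .vertex (G.src e) else .vertex (G.tgt e)

open Classical in
/-- The point of the cable `I_x` at distance `t` from `x`, for `0 ≤ t < ρ_x`. -/
noncomputable def spurPoint (x : V) (t : ℝ) : G.Cable :=
  if h : t ∈ G.spurInterval x then .onSpur x ⟨t, h⟩ else .vertex x

/-- The topology obtained by glueing the closed segments `[0, ρ_e]` and the half-open segments
`[0, ρ_x)` through their endpoints: a set is open iff its trace on each segment is open. Since the
graph is locally finite, this is the topology of the graph distance in which every cable has
length one. -/
noncomputable instance : TopologicalSpace G.Cable :=
  (⨆ e : E, TopologicalSpace.coinduced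
    (fun t : Set.Icc (0 : ℝ) (1 / (2 * G.weight e)) => G.edgePoint e t) inferInstance) ⊔
  (⨆ x : V, TopologicalSpace.coinduced
    (fun t : {t : ℝ | 0 ≤ t ∧ 2 * G.killing x * t < 1} => G.spurPoint x t) inferInstance)

/-- Functions in the Sobolev space `W^{1,2}(I)` on an open interval `I` of the real line, represented
by their absolutely continuous version: `f` and its (almost everywhere defined) derivative are
square integrable on `I`, and `f` is the integral of its derivative. -/
def IsW12 (I : Set ℝ) (f : ℝ → ℝ) : Prop :=
  MemLp f 2 (volume.restrict I) ∧ MemLp (deriv f) 2 (volume.restrict I) ∧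
    ∀ s ∈ I, ∀ t ∈ I, f t - f s = ∫ r in s..t, deriv f r

/-- The squared `W^{1,2}(I)` norm. -/
noncomputable def w12NormSq (I : Set ℝ) (f : ℝ → ℝ) : ℝ :=
  (∫ t in I, f t ^ 2) + ∫ t in I, deriv f t ^ 2

/-- The domain `D` of the Dirichlet form: the functions in `C_0` of the cable system whose
restriction to each cable is in `W^{1,2}`, with summable squared norms. -/
structure IsDirichlet (f : G.Cable → ℝ) : Prop where
  continuous : Continuous f
  zero_at_infty : Tendsto f (cocompact G.Cable) (𝓝 0)
  edge : ∀ e, IsW12 (G.edgeInterval e) fun t => f (G.edgePoint e t)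
  spur : ∀ x, IsW12 (G.spurInterval x) fun t => f (G.spurPoint x t)
  summable_edge : Summable fun e => w12NormSq (G.edgeInterval e) fun t => f (G.edgePoint e t)
  summable_spur : Summable fun x => w12NormSq (G.spurInterval x) fun t => f (G.spurPoint x t)

/-- The Dirichlet form `½ (f', g')_m`, where `m` is the Lebesgue measure on the cable system. -/
noncomputable def energy (f g : G.Cable → ℝ) : ℝ :=
  1 / 2 * ((∑' e, ∫ t in G.edgeInterval e,
      deriv (fun r => f (G.edgePoint e r)) t * deriv (fun r => g (G.edgePoint e r)) t) +
    ∑' x, ∫ t in G.spurInterval x,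
      deriv (fun r => f (G.spurPoint x r)) t * deriv (fun r => g (G.spurPoint x r)) t)

/-- The extended Dirichlet space: pointwise limits of sequences in the domain that are Cauchy for
the energy. -/
def IsExtendedDirichlet (f : G.Cable → ℝ) : Prop :=
  ∃ u : ℕ → G.Cable → ℝ, (∀ n, G.IsDirichlet (u n)) ∧
    Tendsto (fun p : ℕ × ℕ => G.energy (u p.1 - u p.2) (u p.1 - u p.2)) atTop (𝓝 0) ∧
    ∀ x, Tendsto (fun n => u n x) atTop (𝓝 (f x))

/-- `k` is the Green function `g(x, ·)` with pole `x` of the diffusion associated with the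
Dirichlet form, that is its `0`-potential density with respect to `m`: it lies in the extended
Dirichlet space and represents the evaluation at `x` for the Dirichlet form. -/
def IsGreenAt (x : G.Cable) (k : G.Cable → ℝ) : Prop :=
  G.IsExtendedDirichlet k ∧ ∀ f, G.IsDirichlet f → G.energy k f = f x

open Classical in
/-- The Green function of the canonical diffusion on the cable system. It exists if the graph is
transient; otherwise the value is the default `0`. -/
noncomputable def green (x y : G.Cable) : ℝ :=
  if h : ∃ k, G.IsGreenAt x k then h.choose y else 0

/-- `φ` is a Gaussian free field on the cable system under `P`: a centered Gaussian process, with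
almost surely continuous sample paths, whose covariance is the Green function. -/
structure IsGaussianFreeField {Ω : Type*} [MeasurableSpace Ω] (P : Measure Ω)
    (φ : G.Cable → Ω → ℝ) : Prop where
  isGaussianProcess : IsGaussianProcess φ P
  centered : ∀ x, ∫ ω, φ x ω ∂P = 0
  covariance : ∀ x y, ∫ ω, φ x ω * φ y ω ∂P = G.green x y
  continuous : ∀ᵐ ω ∂P, Continuous fun x => φ x ω

variable {G} in
/-- The level set `E^{≥ h}` of a function on the cable system. -/
def levelSet (f : G.Cable → ℝ) (h : ℝ) : Set G.Cable := {x | h ≤ f x}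

variable {G} in
/-- `A` contains an unbounded connected component, that is, a connected component which contains
infinitely many vertices. -/
def HasUnboundedComponent (A : Set G.Cable) : Prop :=
  ∃ x ∈ A, {v : V | Cable.vertex v ∈ connectedComponentIn A x}.Infinite

variable {G} in
/-- The critical parameter: the infimum of the levels `h` for which the level set of the field
almost surely has no unbounded connected component; it is `⊤` if there is no such `h`. -/
noncomputable def criticalParameter {Ω : Type*} [MeasurableSpace Ω] (P : Measure Ω)
    (φ : G.Cable → Ω → ℝ) : EReal :=
  sInf ((fun h : ℝ => (h : EReal)) ''
    {h : ℝ | P {ω | HasUnboundedComponent (levelSet (fun x => φ x ω) h)} = 0})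

end MassiveGraph

/-- The vertices of the rooted `(d+1)`-regular tree: `none` is the root, which has `d + 1` children
`some (i, [])`; the vertex `some (i, l)` has the `d` children `some (i, a :: l)`. -/
abbrev TreeVertex (d : ℕ) : Type := Option (Fin (d + 1) × List (Fin d))

/-- The parent of a vertex other than the root. -/
def treeParent {d : ℕ} : Fin (d + 1) × List (Fin d) → TreeVertex d
  | (_, []) => none
  | (i, _ :: l) => some (i, l)

/-- The generation of a vertex, i.e. its distance to the root. -/
def treeGeneration {d : ℕ} : TreeVertex d → ℕ
  | none => 0
  | some (_, l) => l.length + 1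

theorem treeGeneration_parent {d : ℕ} (e : Fin (d + 1) × List (Fin d)) :
    treeGeneration (some e) = treeGeneration (treeParent e) + 1 := by
  rcases e with ⟨i, _ | ⟨a, l⟩⟩ <;> rfl

open Classical in
/-- The `(d+1)`-regular tree whose edges between generations `n` and `n + 1` have weight `α ^ n`,
with zero killing measure if `α > 1 / d`, and unit killing at the root otherwise. The edges are
listed by their endpoint `some e` in the higher generation. -/
noncomputable def weightedTree (d : ℕ) (α : ℝ) (hα : 0 < α) :
    MassiveGraph (TreeVertex d) (Fin (d + 1) × List (Fin d)) where
  src e := treeParent e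
  tgt e := some e
  src_ne_tgt e h := by
    have := treeGeneration_parent e
    rw [h] at this
    omega
  edge_injective e e' h := by
    rcases Sym2.eq_iff.1 h with ⟨_, h2⟩ | ⟨h1, h2⟩
    · exact Option.some_injective _ h2
    · have := treeGeneration_parent e
      have h' := treeGeneration_parent e'
      rw [h1] at this
      rw [← h2] at h'
      omega
  connected := by
    have key : ∀ (l : List (Fin d)) (i : Fin (d + 1)),
        (SimpleGraph.fromRel fun x y : TreeVertex d =>
          ∃ e, treeParent e = x ∧ some e = y).Reachable none (some (i, l)) := by
      intro l i
      induction l with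
      | nil =>
        refine SimpleGraph.Adj.reachable ?_
        rw [SimpleGraph.fromRel_adj]
        exact ⟨by simp, Or.inl ⟨(i, []), rfl, rfl⟩⟩
      | cons a l ih =>
        refine ih.trans (SimpleGraph.Adj.reachable ?_)
        rw [SimpleGraph.fromRel_adj]
        exact ⟨by simp, Or.inl ⟨(i, a :: l), rfl, rfl⟩⟩
    have key' : ∀ x : TreeVertex d,
        (SimpleGraph.fromRel fun x y : TreeVertex d =>
          ∃ e, treeParent e = x ∧ some e = y).Reachable none x := by
      rintro (_ | ⟨i, l⟩)
      · exact SimpleGraph.Reachable.refl _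
      · exact key l i
    exact { preconnected := fun x y => (key' x).symm.trans (key' y) }
  locallyFinite x := by
    rcases x with _ | ⟨i, l⟩
    · refine (Set.finite_range fun i : Fin (d + 1) => (i, ([] : List (Fin d)))).subset ?_
      rintro ⟨i, _ | ⟨a, l⟩⟩ h
      · exact ⟨i, rfl⟩
      · simp [treeParent] at h
    · refine ((Set.finite_range fun a : Fin d => (i, a :: l)).union
        (Set.finite_singleton (i, l))).subset ?_
      rintro ⟨j, _ | ⟨a, m⟩⟩ h
      · right
        simpa [treeParent] using h
      · rcases h with h | h
        · left
          simp only [treeParent, Option.some.injEq, Prod.mk.injEq] at h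
          exact ⟨a, by rw [h.1, h.2]⟩
        · right
          simpa using h
  weight e := α ^ treeGeneration (treeParent e)
  weight_pos e := pow_pos hα _
  killing x := if x = none ∧ α ≤ 1 / d then 1 else 0
  killing_nonneg x := by split_ifs <;> norm_num

/-! Write `p = returnRatio d α = 1 / max 1 (d α)`. On the tree the free field is a Markov chain
indexed by the vertices: a vertex of generation `n + 1` has value `p` times that of its parent plus
an independent centred Gaussian innovation of variance `p / α ^ n`, and along each cable the field
is the linear interpolation of its end values plus an independent Brownian bridge (variance 2 per
unit length). Since `α < 1`, the innovations grow with the generation, and they carry the field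
above every level.

This decomposition (`exists_treeNoise`) needs no formula for the Green function. A finite linear
functional of the field has a potential, the function that represents it for the Dirichlet form
(`Represents`), and its covariance with another functional is the value of that functional on the
potential (`Represents.duality`, `integral_linearCombination_mul`). The potential of an innovation
is a multiple of the hitting function `p ^ depth` of a subtree (`represents_subtreeFun`); that of
the displacement at the midpoint of a dyadic interval is a tent (`represents_tent`). Distinct
functionals of these two kinds are orthogonal, hence independent.

For the bridges, `1 - exp (-a b / ℓ)` is preserved by averaging over the midpoint
(`integral_bridgePositivity`), and is therefore a lower bound for the probability that all dyadic
values of a bridge from `a` to `b` are positive (`le_measure_bridgeValue_pos`).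

Let `t n = threshold d α n`, where `t (n + 1)` is the standard deviation of an innovation in
generation `n + 1`. An edge from generation `n` to `n + 1` is good if the innovation at its far end
is at least `t (n + 1)` and its bridge, run from `t n / 2` to `t (n + 1) / 2`, stays positive. By
scaling this has probability at least `q = c / 2 * (1 - exp (-√α / (d α + 1)))` for every `n`, where
`c` is the probability that a standard Gaussian exceeds 1. A good edge below a vertex with value at
least `t n` leads to a child with value at least `t (n + 1)`, along a cable on which the field is at
least `t n / 2`. Good edges are independent, so a vertex has good paths to arbitrarily late
generations with probability at least `1 / 2` as soon as `d q ≥ 2`; this is the assumption, with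
constant `4 / c`.

To obtain probability one and all levels at once, consider the branches leaving a fixed ray at its
`i`-th vertex. Along the `i`-th branch one descends `m i + 1` steps, with `m i` so large that, by
the first Borel–Cantelli lemma, the field on the ray is at least `-t (m i)` for all large `i`. The
events that the innovations of the branch compensate this deficit and that its end survives
(`startEvent`) are independent in `i` with probability bounded below, so infinitely many occur. As
`t i → ∞`, some of them beat any given level. -/

/-! ### Measure theory on disjoint unions and absolutely continuous functions -/

theorem measurable_sigma_iff {ι : Type*} {β : ι → Type*} [∀ i, MeasurableSpace (β i)] {γ : Type*}
    [MeasurableSpace γ] {f : (Σ i, β i) → γ} :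
    Measurable f ↔ ∀ i, Measurable fun x => f ⟨i, x⟩ := by
  constructor
  · intro h i s hs
    exact (MeasurableSpace.measurableSet_iInf.1 (h hs)) i
  · intro h s hs
    exact MeasurableSpace.measurableSet_iInf.2 fun i => h i hs

theorem measurableEmbedding_sigmaMk {ι : Type*} {β : ι → Type*} [∀ i, MeasurableSpace (β i)]
    (i : ι) : MeasurableEmbedding (Sigma.mk i : β i → Σ i, β i) where
  injective := sigma_mk_injective
  measurable := measurable_sigma_iff.1 measurable_id i
  measurableSet_image' := by
    intro s hs
    refine MeasurableSpace.measurableSet_iInf.2 fun j => ?_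
    change MeasurableSet (Sigma.mk j ⁻¹' (Sigma.mk i '' s))
    by_cases h : j = i
    · subst h
      rwa [Set.preimage_image_eq _ sigma_mk_injective]
    · convert MeasurableSet.empty
      ext x
      simp only [Set.mem_preimage, Set.mem_image, Set.mem_empty_iff_false, iff_false, not_exists,
        not_and]
      intro y _ hy
      exact h (congrArg Sigma.fst hy).symm

/-- If the increments of `k` on an open order-connected set are the integrals of `v ∈ L²`, then `k`
has derivative `v` almost everywhere. -/
theorem ae_hasDerivAt_of_sub_eq_integral {S : Set ℝ} (hS : IsOpen S) (hc : S.OrdConnected)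
    {k v : ℝ → ℝ} (hv : MemLp v 2 (volume.restrict S))
    (h : ∀ s ∈ S, ∀ t ∈ S, k t - k s = ∫ r in s..t, v r) :
    ∀ᵐ t ∂(volume.restrict S), HasDerivAt k (v t) t := by
  have hint : ∀ a ∈ S, ∀ b ∈ S, IntervalIntegrable v volume a b := by
    intro a ha b hb
    have hsub : Set.uIoc a b ⊆ S := Set.uIoc_subset_uIcc.trans (hc.uIcc_subset ha hb)
    rw [intervalIntegrable_iff]
    have := hv.mono_measure (Measure.restrict_mono hsub le_rfl)
    have hfin : IsFiniteMeasure (volume.restrict (Set.uIoc a b)) :=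
      ⟨by simp [Set.uIoc]⟩
    exact this.integrable one_le_two
  -- The Lebesgue differentiation theorem applies on each interval with rational endpoints in `S`.
  -- Countably many null sets are discarded, and every point of the open set `S` lies inside one of
  -- these intervals.
  have key : ∀ q : ℚ × ℚ, ∀ᵐ t : ℝ, (q.1 : ℝ) ∈ S → (q.2 : ℝ) ∈ S → t ∈ Set.Ioo (q.1 : ℝ) q.2 →
      HasDerivAt k (v t) t := by
    intro q
    by_cases h1 : (q.1 : ℝ) ∈ S
    swap; · exact Eventually.of_forall fun _ h => absurd h h1
    by_cases h2 : (q.2 : ℝ) ∈ S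
    swap; · exact Eventually.of_forall fun _ _ h => absurd h h2
    filter_upwards [(hint _ h1 _ h2).ae_hasDerivAt_integral] with t ht _ _ hmem
    have hle : (q.1 : ℝ) ≤ q.2 := (hmem.1.trans hmem.2).le
    have hd := ht (by rw [Set.uIcc_of_le hle]; exact ⟨hmem.1.le, hmem.2.le⟩) q.1 (by simp)
    have hd' := hd.const_add (k q.1)
    refine hd'.congr_of_eventuallyEq ?_
    filter_upwards [Ioo_mem_nhds hmem.1 hmem.2] with x hx
    have := h _ h1 x (hc.out h1 h2 ⟨hx.1.le, hx.2.le⟩)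
    linarith
  rw [ae_restrict_iff' hS.measurableSet]
  filter_upwards [ae_all_iff.2 key] with t ht htS
  obtain ⟨a, b, hab, hsub⟩ := mem_nhds_iff_exists_Ioo_subset.1 (hS.mem_nhds htS)
  obtain ⟨q1, hq1, hq1'⟩ := exists_rat_btwn hab.1
  obtain ⟨q2, hq2, hq2'⟩ := exists_rat_btwn hab.2
  exact ht (q1, q2) (hsub ⟨hq1, hq1'.trans hab.2⟩) (hsub ⟨hab.1.trans hq2, hq2'⟩) ⟨hq1', hq2⟩

theorem MeasureTheory.MemLp.intervalIntegrable_of_uIoc_subset {S : Set ℝ} {v : ℝ → ℝ}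
    (hv : MemLp v 2 (volume.restrict S)) {a b : ℝ} (hsub : Set.uIoc a b ⊆ S) :
    IntervalIntegrable v volume a b := by
  rw [intervalIntegrable_iff]
  have := hv.mono_measure (Measure.restrict_mono hsub le_rfl)
  have hfin : IsFiniteMeasure (volume.restrict (Set.uIoc a b)) := ⟨by simp [Set.uIoc]⟩
  exact this.integrable one_le_two

/-! ### The Dirichlet form as an `L²` pairing of gradients along the cables -/

namespace MassiveGraph

variable {V E : Type*}

theorem IsW12.ae_hasDerivAt {I : Set ℝ} (hI : IsOpen I) (hc : I.OrdConnected) {f : ℝ → ℝ}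
    (hf : IsW12 I f) : ∀ᵐ t ∂(volume.restrict I), HasDerivAt f (deriv f t) t :=
  ae_hasDerivAt_of_sub_eq_integral hI hc hf.2.1 hf.2.2

/-- `deriv` is additive where both functions are differentiable and takes the default value 0 at
points of non-differentiability, so equality can only be expected almost everywhere. -/
theorem IsW12.deriv_add {I : Set ℝ} (hI : IsOpen I) (hc : I.OrdConnected) {f g : ℝ → ℝ}
    (hf : IsW12 I f) (hg : IsW12 I g) :
    deriv (f + g) =ᵐ[volume.restrict I] deriv f + deriv g := by
  filter_upwards [hf.ae_hasDerivAt hI hc, hg.ae_hasDerivAt hI hc] with t h1 h2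
  exact (h1.add h2).deriv

theorem IsW12.add {I : Set ℝ} (hI : IsOpen I) (hc : I.OrdConnected) {f g : ℝ → ℝ}
    (hf : IsW12 I f) (hg : IsW12 I g) : IsW12 I (f + g) := by
  have hd := hf.deriv_add hI hc hg
  refine ⟨hf.1.add hg.1, (hf.2.1.add hg.2.1).ae_eq hd.symm, fun s hs t ht => ?_⟩
  have hsub : Set.uIoc s t ⊆ I := Set.uIoc_subset_uIcc.trans (hc.uIcc_subset hs ht)
  have e : ∫ r in s..t, deriv (f + g) r = ∫ r in s..t, (deriv f r + deriv g r) := by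
    refine intervalIntegral.integral_congr_ae_restrict ?_
    exact ae_restrict_of_ae_restrict_of_subset hsub hd
  rw [e, intervalIntegral.integral_add (hf.2.1.intervalIntegrable_of_uIoc_subset hsub)
    (hg.2.1.intervalIntegrable_of_uIoc_subset hsub), ← hf.2.2 s hs t ht, ← hg.2.2 s hs t ht]
  simp only [Pi.add_apply]
  ring

theorem IsW12.const_smul {I : Set ℝ} {f : ℝ → ℝ} (c : ℝ) (hf : IsW12 I f) : IsW12 I (c • f) := by
  have hd : deriv (c • f) = c • deriv f := by
    ext t
    exact deriv_const_smul_field c f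
  refine ⟨hf.1.const_smul c, by rw [hd]; exact hf.2.1.const_smul c, fun s hs t ht => ?_⟩
  rw [hd]
  simp only [Pi.smul_apply, smul_eq_mul, intervalIntegral.integral_const_mul]
  rw [← hf.2.2 s hs t ht]
  ring

variable (G : MassiveGraph V E)

/-- The open interval parametrizing the interior of the cable of an edge or of a vertex. -/
def cableInterval : E ⊕ V → Set ℝ := Sum.elim G.edgeInterval G.spurInterval

/-- The parametrization of the cable of an edge or of a vertex. -/
noncomputable def cablePoint : E ⊕ V → ℝ → G.Cable := Sum.elim G.edgePoint G.spurPoint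

/-- The derivative along the cables. -/
noncomputable def grad (f : G.Cable → ℝ) (p : Σ _ : E ⊕ V, ℝ) : ℝ :=
  deriv (fun r => f (G.cablePoint p.1 r)) p.2

/-- The Lebesgue measure on the disjoint union of the open cables. -/
noncomputable def cableMeasure : Measure (Σ _ : E ⊕ V, ℝ) :=
  Measure.sum fun i => (volume.restrict (G.cableInterval i)).map (Sigma.mk i)

theorem isOpen_cableInterval (i : E ⊕ V) : IsOpen (G.cableInterval i) := by
  rcases i with e | x
  · exact isOpen_Ioo
  · exact (isOpen_lt continuous_const continuous_id).inter
      (isOpen_lt (continuous_const.mul continuous_id) continuous_const)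

theorem ordConnected_cableInterval (i : E ⊕ V) : (G.cableInterval i).OrdConnected := by
  rcases i with e | x
  · exact Set.ordConnected_Ioo
  · refine ⟨fun a ha b hb t ht => ⟨ha.1.trans_le ht.1, lt_of_le_of_lt ?_ hb.2⟩⟩
    exact mul_le_mul_of_nonneg_left ht.2 (by have := G.killing_nonneg x; positivity)

theorem measurable_grad (f : G.Cable → ℝ) : Measurable (G.grad f) :=
  measurable_sigma_iff.2 fun i => measurable_deriv fun r => f (G.cablePoint i r)

theorem integral_map_sigmaMk (i : E ⊕ V) (μ : Measure ℝ) (g : (Σ _ : E ⊕ V, ℝ) → ℝ) :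
    ∫ p, g p ∂(μ.map (Sigma.mk i)) = ∫ t, g ⟨i, t⟩ ∂μ :=
  (measurableEmbedding_sigmaMk (β := fun _ : E ⊕ V => ℝ) i).integral_map g

theorem integrable_map_sigmaMk (i : E ⊕ V) (μ : Measure ℝ) (g : (Σ _ : E ⊕ V, ℝ) → ℝ) :
    Integrable g (μ.map (Sigma.mk i)) ↔ Integrable (fun t => g ⟨i, t⟩) μ :=
  (measurableEmbedding_sigmaMk (β := fun _ : E ⊕ V => ℝ) i).integrable_map_iff

theorem ae_map_sigmaMk (i : E ⊕ V) (μ : Measure ℝ) (q : (Σ _ : E ⊕ V, ℝ) → Prop) :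
    (∀ᵐ p ∂(μ.map (Sigma.mk i)), q p) ↔ ∀ᵐ t ∂μ, q ⟨i, t⟩ :=
  (measurableEmbedding_sigmaMk (β := fun _ : E ⊕ V => ℝ) i).ae_map_iff

variable {G}

theorem hasSum_integral_cableMeasure {g : (Σ _ : E ⊕ V, ℝ) → ℝ} (hg : Integrable g G.cableMeasure) :
    HasSum (fun i => ∫ t in G.cableInterval i, g ⟨i, t⟩) (∫ p, g p ∂G.cableMeasure) := by
  have := hasSum_integral_measure hg
  simp only [integral_map_sigmaMk] at this
  exact this

theorem MemLp_two_cable {g : (Σ _ : E ⊕ V, ℝ) → ℝ} (hg : MemLp g 2 G.cableMeasure) (i : E ⊕ V) :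
    MemLp (fun t => g ⟨i, t⟩) 2 (volume.restrict (G.cableInterval i)) :=
  (measurableEmbedding_sigmaMk (β := fun _ : E ⊕ V => ℝ) i).memLp_map_measure_iff.1
    (hg.mono_measure (Measure.le_sum _ i))

/-- Square integrability of both gradients makes the two series in `energy` genuinely summable, not
`tsum` defaults, so they combine into one integral over the disjoint union of the cables. From here
on the form is an `L²` inner product. -/
theorem energy_eq_integral {f g : G.Cable → ℝ} (hf : MemLp (G.grad f) 2 G.cableMeasure)
    (hg : MemLp (G.grad g) 2 G.cableMeasure) :
    G.energy f g = 1 / 2 * ∫ p, G.grad f p * G.grad g p ∂G.cableMeasure := by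
  have h := hasSum_integral_cableMeasure (hf.integrable_mul hg)
  have hs := h.summable
  rw [energy]
  congr 1
  have := h.tsum_eq
  have e := Summable.tsum_sum (f := fun i => ∫ t in G.cableInterval i, (G.grad f * G.grad g) ⟨i, t⟩)
    (hs.comp_injective Sum.inl_injective) (hs.comp_injective Sum.inr_injective)
  exact e.symm.trans this

theorem memLp_grad_iff [Countable V] [Countable E] {f : G.Cable → ℝ} :
    MemLp (G.grad f) 2 G.cableMeasure ↔
      (∀ i, MemLp (deriv fun t => f (G.cablePoint i t)) 2 (volume.restrict (G.cableInterval i))) ∧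
      Summable fun i => ∫ t in G.cableInterval i, (deriv fun t => f (G.cablePoint i t)) t ^ 2 := by
  rw [memLp_two_iff_integrable_sq (G.measurable_grad f).aestronglyMeasurable, cableMeasure,
    integrable_sum_measure_iff]
  simp only [integrable_map_sigmaMk, integral_map_sigmaMk, Real.norm_eq_abs, abs_pow, sq_abs]
  refine and_congr (forall_congr' fun i => ?_) Iff.rfl
  rw [memLp_two_iff_integrable_sq (measurable_deriv _).aestronglyMeasurable]
  rfl

theorem IsDirichlet.isW12 {f : G.Cable → ℝ} (hf : G.IsDirichlet f) (i : E ⊕ V) :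
    IsW12 (G.cableInterval i) fun t => f (G.cablePoint i t) := by
  rcases i with e | x
  · exact hf.edge e
  · exact hf.spur x

theorem w12NormSq_nonneg (I : Set ℝ) (f : ℝ → ℝ) : 0 ≤ w12NormSq I f :=
  add_nonneg (integral_nonneg fun _ => sq_nonneg _) (integral_nonneg fun _ => sq_nonneg _)

theorem IsDirichlet.summable {f : G.Cable → ℝ} (hf : G.IsDirichlet f) :
    Summable fun i => w12NormSq (G.cableInterval i) fun t => f (G.cablePoint i t) :=
  have h1 : Summable ((fun i : E ⊕ V => w12NormSq (G.cableInterval i)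
    fun t => f (G.cablePoint i t)) ∘ Sum.inl) := hf.summable_edge
  have h2 : Summable ((fun i : E ⊕ V => w12NormSq (G.cableInterval i)
    fun t => f (G.cablePoint i t)) ∘ Sum.inr) := hf.summable_spur
  (h1.hasSum.sum h2.hasSum).summable

theorem IsDirichlet.memLp_grad [Countable V] [Countable E] {f : G.Cable → ℝ}
    (hf : G.IsDirichlet f) : MemLp (G.grad f) 2 G.cableMeasure := by
  refine memLp_grad_iff.2 ⟨fun i => (hf.isW12 i).2.1, ?_⟩
  refine hf.summable.of_nonneg_of_le (fun i => integral_nonneg fun _ => sq_nonneg _) fun i => ?_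
  exact le_add_of_nonneg_left (integral_nonneg fun _ => sq_nonneg _)

theorem ae_cableMeasure_iff [Countable V] [Countable E] {q : (Σ _ : E ⊕ V, ℝ) → Prop} :
    (∀ᵐ p ∂G.cableMeasure, q p) ↔ ∀ i, ∀ᵐ t ∂(volume.restrict (G.cableInterval i)), q ⟨i, t⟩ := by
  rw [cableMeasure, Measure.ae_sum_iff]
  simp only [ae_map_sigmaMk]

theorem IsDirichlet.grad_add [Countable V] [Countable E] {f g : G.Cable → ℝ}
    (hf : G.IsDirichlet f) (hg : G.IsDirichlet g) :
    G.grad (f + g) =ᵐ[G.cableMeasure] G.grad f + G.grad g :=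
  ae_cableMeasure_iff.2 fun i => (hf.isW12 i).deriv_add (G.isOpen_cableInterval i)
    (G.ordConnected_cableInterval i) (hg.isW12 i)

theorem grad_smul (c : ℝ) (f : G.Cable → ℝ) : G.grad (c • f) = c • G.grad f := by
  ext p
  exact deriv_const_mul_field c

theorem w12NormSq_add_le {I : Set ℝ} (hI : IsOpen I) (hc : I.OrdConnected) {f g : ℝ → ℝ}
    (hf : IsW12 I f) (hg : IsW12 I g) :
    w12NormSq I (f + g) ≤ 2 * w12NormSq I f + 2 * w12NormSq I g := by
  have aux : ∀ {u v w : ℝ → ℝ}, MemLp u 2 (volume.restrict I) → MemLp v 2 (volume.restrict I) →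
      w =ᵐ[volume.restrict I] u + v →
      ∫ t in I, w t ^ 2 ≤ 2 * (∫ t in I, u t ^ 2) + 2 * ∫ t in I, v t ^ 2 := by
    intro u v w hu hv hw
    rw [← integral_const_mul, ← integral_const_mul, ← integral_add (hu.integrable_sq.const_mul 2)
      (hv.integrable_sq.const_mul 2)]
    refine integral_mono_of_nonneg (ae_of_all _ fun _ => sq_nonneg _)
      ((hu.integrable_sq.const_mul 2).add (hv.integrable_sq.const_mul 2)) ?_
    filter_upwards [hw] with t ht
    simp only [ht, Pi.add_apply]
    nlinarith [sq_nonneg (u t - v t)]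
  have h1 := aux hf.1 hg.1 (ae_eq_refl _)
  have h2 := aux hf.2.1 hg.2.1 (hf.deriv_add hI hc hg)
  unfold w12NormSq
  linarith

theorem w12NormSq_smul {I : Set ℝ} (c : ℝ) (f : ℝ → ℝ) :
    w12NormSq I (c • f) = c ^ 2 * w12NormSq I f := by
  have hd : deriv (c • f) = c • deriv f := by
    ext t
    exact deriv_const_smul_field c f
  simp only [w12NormSq, hd, Pi.smul_apply, smul_eq_mul, mul_pow, integral_const_mul, mul_add]

theorem IsDirichlet.add {f g : G.Cable → ℝ} (hf : G.IsDirichlet f) (hg : G.IsDirichlet g) :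
    G.IsDirichlet (f + g) where
  continuous := hf.continuous.add hg.continuous
  zero_at_infty := by
    have := hf.zero_at_infty.add hg.zero_at_infty
    rwa [add_zero] at this
  edge e := (hf.edge e).add (G.isOpen_cableInterval (.inl e)) (G.ordConnected_cableInterval (.inl e))
    (hg.edge e)
  spur x := (hf.spur x).add (G.isOpen_cableInterval (.inr x)) (G.ordConnected_cableInterval (.inr x))
    (hg.spur x)
  summable_edge := ((hf.summable_edge.mul_left 2).add (hg.summable_edge.mul_left 2)).of_nonneg_of_le
    (fun _ => w12NormSq_nonneg _ _) fun e => w12NormSq_add_le (G.isOpen_cableInterval (.inl e))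
      (G.ordConnected_cableInterval (.inl e)) (hf.edge e) (hg.edge e)
  summable_spur := ((hf.summable_spur.mul_left 2).add (hg.summable_spur.mul_left 2)).of_nonneg_of_le
    (fun _ => w12NormSq_nonneg _ _) fun x => w12NormSq_add_le (G.isOpen_cableInterval (.inr x))
      (G.ordConnected_cableInterval (.inr x)) (hf.spur x) (hg.spur x)

theorem IsDirichlet.const_smul {f : G.Cable → ℝ} (c : ℝ) (hf : G.IsDirichlet f) :
    G.IsDirichlet (c • f) where
  continuous := hf.continuous.const_smul c
  zero_at_infty := by
    have := hf.zero_at_infty.const_smul c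
    rwa [smul_zero] at this
  edge e := (hf.edge e).const_smul c
  spur x := (hf.spur x).const_smul c
  summable_edge := by
    refine (hf.summable_edge.mul_left (c ^ 2)).congr fun e => ?_
    exact (w12NormSq_smul c _).symm
  summable_spur := by
    refine (hf.summable_spur.mul_left (c ^ 2)).congr fun e => ?_
    exact (w12NormSq_smul c _).symm

theorem IsDirichlet.sub {f g : G.Cable → ℝ} (hf : G.IsDirichlet f) (hg : G.IsDirichlet g) :
    G.IsDirichlet (f - g) := by
  have := hf.add (hg.const_smul (-1))
  rwa [neg_one_smul, ← sub_eq_add_neg] at this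

theorem IsDirichlet.grad_sub [Countable V] [Countable E] {f g : G.Cable → ℝ}
    (hf : G.IsDirichlet f) (hg : G.IsDirichlet g) :
    G.grad (f - g) =ᵐ[G.cableMeasure] G.grad f - G.grad g := by
  have := hf.grad_add (hg.const_smul (-1))
  rwa [grad_smul, neg_one_smul, neg_one_smul, ← sub_eq_add_neg, ← sub_eq_add_neg] at this

end MassiveGraph

/-! ### Increments along cables, the extended Dirichlet space and potentials -/

namespace MassiveGraph

variable {V E : Type*} (G : MassiveGraph V E)

/-- The parameters of all points of a cable, including its endpoints. -/
def closedInterval : E ⊕ V → Set ℝ :=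
  Sum.elim (fun e => Set.Icc 0 (1 / (2 * G.weight e)))
    fun x => {t | 0 ≤ t ∧ 2 * G.killing x * t < 1}

theorem ordConnected_closedInterval (i : E ⊕ V) : (G.closedInterval i).OrdConnected := by
  rcases i with e | x
  · exact Set.ordConnected_Icc
  · refine ⟨fun a ha b hb t ht => ⟨ha.1.trans ht.1, lt_of_le_of_lt ?_ hb.2⟩⟩
    exact mul_le_mul_of_nonneg_left ht.2 (by have := G.killing_nonneg x; positivity)

theorem Ioo_subset_cableInterval {i : E ⊕ V} {s t : ℝ} (hs : s ∈ G.closedInterval i)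
    (ht : t ∈ G.closedInterval i) : Set.Ioo s t ⊆ G.cableInterval i := by
  rcases i with e | x
  · exact Set.Ioo_subset_Ioo hs.1 ht.2
  · rintro r ⟨h1, h2⟩
    refine ⟨hs.1.trans_lt h1, lt_of_le_of_lt ?_ ht.2⟩
    exact mul_le_mul_of_nonneg_left h2.le (by have := G.killing_nonneg x; positivity)

theorem continuous_cablePoint (i : E ⊕ V) :
    Continuous fun t : G.closedInterval i => G.cablePoint i t := by
  rcases i with e | x
  · exact continuous_iff_coinduced_le.2 (le_trans (le_iSup (fun e : E =>
      TopologicalSpace.coinduced (fun t : Set.Icc (0 : ℝ) (1 / (2 * G.weight e)) =>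
        G.edgePoint e t) inferInstance) e) le_sup_left)
  · exact continuous_iff_coinduced_le.2 (le_trans (le_iSup (fun x : V =>
      TopologicalSpace.coinduced (fun t : {t : ℝ | 0 ≤ t ∧ 2 * G.killing x * t < 1} =>
        G.spurPoint x t) inferInstance) x) le_sup_right)

variable {G}

theorem continuous_cable_iff {Y : Type*} [TopologicalSpace Y] {f : G.Cable → Y} :
    Continuous f ↔ ∀ i, ContinuousOn (fun t => f (G.cablePoint i t)) (G.closedInterval i) := by
  constructor
  · intro h i
    exact continuousOn_iff_continuous_domRestrict.2 (h.comp (G.continuous_cablePoint i))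
  · intro h
    refine continuous_sup_dom.2 ⟨continuous_iSup_dom.2 fun e => continuous_coinduced_dom.2 ?_,
      continuous_iSup_dom.2 fun x => continuous_coinduced_dom.2 ?_⟩
    · exact continuousOn_iff_continuous_domRestrict.1 (h (.inl e))
    · exact continuousOn_iff_continuous_domRestrict.1 (h (.inr x))

theorem intervalIntegrable_of_memLp {g : (Σ _ : E ⊕ V, ℝ) → ℝ} (hg : MemLp g 2 G.cableMeasure)
    {i : E ⊕ V} {s t : ℝ} (hs : s ∈ G.closedInterval i) (ht : t ∈ G.closedInterval i) :
    IntervalIntegrable (fun r => g ⟨i, r⟩) volume s t := by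
  wlog hst : s ≤ t
  · exact (this hg ht hs (le_of_not_ge hst)).symm
  have h := (MemLp_two_cable hg i).mono_measure
    (Measure.restrict_mono (G.Ioo_subset_cableInterval hs ht) le_rfl)
  rw [intervalIntegrable_iff_integrableOn_Ioo_of_le hst]
  have : IsFiniteMeasure (volume.restrict (Set.Ioo s t)) := ⟨by simp⟩
  exact h.integrable one_le_two

/-- Increments along a cable are controlled by the `L²` norm of the gradient; this is what links
pointwise convergence with convergence in energy. -/
theorem norm_intervalIntegral_le {g : (Σ _ : E ⊕ V, ℝ) → ℝ} (hg : MemLp g 2 G.cableMeasure)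
    {i : E ⊕ V} {s t : ℝ} (hs : s ∈ G.closedInterval i) (ht : t ∈ G.closedInterval i) :
    (∫ r in s..t, g ⟨i, r⟩) ^ 2 ≤ |t - s| * ∫ p, g p ^ 2 ∂G.cableMeasure := by
  wlog hst : s ≤ t
  · have := this hg ht hs (le_of_not_ge hst)
    rwa [intervalIntegral.integral_symm, neg_sq, abs_sub_comm]
  have h := (MemLp_two_cable hg i).mono_measure
    (Measure.restrict_mono (G.Ioo_subset_cableInterval hs ht) le_rfl)
  have hfin : IsFiniteMeasure (volume.restrict (Set.Ioo s t)) := ⟨by simp⟩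
  rw [intervalIntegral.integral_of_le hst, integral_Ioc_eq_integral_Ioo, abs_of_nonneg
    (sub_nonneg.2 hst)]
  have hle : ∫ r in Set.Ioo s t, g ⟨i, r⟩ ^ 2 ≤ ∫ p, g p ^ 2 ∂G.cableMeasure := by
    have h1 := hasSum_integral_cableMeasure hg.integrable_sq
    have h2 : ∫ r in G.cableInterval i, g ⟨i, r⟩ ^ 2 ≤ ∫ p, g p ^ 2 ∂G.cableMeasure :=
      le_hasSum h1 i fun j _ => integral_nonneg fun _ => sq_nonneg _
    refine le_trans ?_ h2
    exact setIntegral_mono_set (MemLp_two_cable hg i).integrable_sq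
      (ae_of_all _ fun _ => sq_nonneg _) (G.Ioo_subset_cableInterval hs ht).eventuallyLE
  refine le_trans ?_ (mul_le_mul_of_nonneg_left hle (sub_nonneg.2 hst))
  rcases hst.eq_or_lt with rfl | hlt
  · simp
  -- Cauchy-Schwarz on a bounded interval
  set m := ∫ r in Set.Ioo s t, g ⟨i, r⟩ with hm
  have hi := h.integrable one_le_two
  have key : 0 ≤ ∫ r in Set.Ioo s t, ((t - s) * g ⟨i, r⟩ - m) ^ 2 := integral_nonneg fun _ => sq_nonneg _
  have e : ∫ r in Set.Ioo s t, ((t - s) * g ⟨i, r⟩ - m) ^ 2 =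
      (t - s) ^ 2 * (∫ r in Set.Ioo s t, g ⟨i, r⟩ ^ 2) - (t - s) * m ^ 2 := by
    have : ∀ r, ((t - s) * g ⟨i, r⟩ - m) ^ 2 =
        (t - s) ^ 2 * g ⟨i, r⟩ ^ 2 - 2 * (t - s) * m * g ⟨i, r⟩ + m ^ 2 := fun r => by ring
    simp only [this]
    have h1 := h.integrable_sq.const_mul ((t - s) ^ 2)
    have h2 := hi.const_mul (2 * (t - s) * m)
    have h3 : ∫ r in Set.Ioo s t, m ^ 2 = (t - s) * m ^ 2 := by
      rw [setIntegral_const]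
      simp [Measure.real, hst]
    calc _ = (∫ r in Set.Ioo s t, ((t - s) ^ 2 * g ⟨i, r⟩ ^ 2 - 2 * (t - s) * m * g ⟨i, r⟩)) +
          ∫ r in Set.Ioo s t, m ^ 2 := integral_add (h1.sub h2) (integrable_const _)
      _ = _ := by
        rw [integral_sub h1 h2, integral_const_mul, integral_const_mul, ← hm, h3]
        ring
  rw [e] at key
  have hpos : 0 < t - s := sub_pos.2 hlt
  nlinarith

/-- The increments of `f` along a cable are the integrals of its derivative, up to the endpoints. -/
theorem sub_eq_integral_of_continuousOn {f : G.Cable → ℝ} {g : (Σ _ : E ⊕ V, ℝ) → ℝ}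
    (hg : MemLp g 2 G.cableMeasure) {i : E ⊕ V}
    (hf : ContinuousOn (fun t => f (G.cablePoint i t)) (G.closedInterval i))
    (h : ∀ s ∈ G.cableInterval i, ∀ t ∈ G.cableInterval i,
      f (G.cablePoint i t) - f (G.cablePoint i s) = ∫ r in s..t, g ⟨i, r⟩)
    {s t : ℝ} (hs : s ∈ G.closedInterval i) (ht : t ∈ G.closedInterval i) :
    f (G.cablePoint i t) - f (G.cablePoint i s) = ∫ r in s..t, g ⟨i, r⟩ := by
  wlog hst : s ≤ t
  · have := this hg hf h ht hs (le_of_not_ge hst)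
    rw [intervalIntegral.integral_symm]
    linarith
  rcases hst.eq_or_lt with rfl | hlt
  · simp
  have hsub : Set.Icc s t ⊆ G.closedInterval i := (G.ordConnected_closedInterval i).out hs ht
  have hII := intervalIntegrable_of_memLp hg hs ht
  obtain ⟨c, hc⟩ := exists_between hlt
  have hci : c ∈ G.cableInterval i := G.Ioo_subset_cableInterval hs ht hc
  have hcont : ContinuousOn (fun r => f (G.cablePoint i r) - ∫ q in c..r, g ⟨i, q⟩) (Set.Icc s t) := by
    refine (hf.mono hsub).sub ?_
    have := intervalIntegral.continuousOn_primitive_interval' (μ := volume) hII (a := c)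
      (by rw [Set.uIcc_of_le hst]; exact ⟨hc.1.le, hc.2.le⟩)
    rwa [Set.uIcc_of_le hst] at this
  -- By `h` the function minus its primitive is constant on the open interval; continuity extends
  -- this to the closure.
  have hconst : ∀ r ∈ Set.Icc s t,
      f (G.cablePoint i r) - ∫ q in c..r, g ⟨i, q⟩ = f (G.cablePoint i c) := by
    have hcl : Set.Icc s t = closure (Set.Ioo s t) := (closure_Ioo hlt.ne).symm
    intro r hr
    have hmem : r ∈ closure (Set.Ioo s t) := hcl ▸ hr
    have hne : (𝓝[Set.Ioo s t] r).NeBot := mem_closure_iff_nhdsWithin_neBot.1 hmem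
    have h1 : Tendsto (fun r => f (G.cablePoint i r) - ∫ q in c..r, g ⟨i, q⟩) (𝓝[Set.Ioo s t] r)
        (𝓝 (f (G.cablePoint i r) - ∫ q in c..r, g ⟨i, q⟩)) :=
      (hcont r hr).mono_left (nhdsWithin_mono _ Set.Ioo_subset_Icc_self)
    refine tendsto_nhds_unique h1 (Tendsto.congr' ?_ tendsto_const_nhds)
    filter_upwards [self_mem_nhdsWithin] with q hq
    have := h c hci q (G.Ioo_subset_cableInterval hs ht hq)
    linarith
  have h1 := hconst s ⟨le_rfl, hst⟩
  have h2 := hconst t ⟨hst, le_rfl⟩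
  have hadd : (∫ q in s..c, g ⟨i, q⟩) + ∫ q in c..t, g ⟨i, q⟩ = ∫ q in s..t, g ⟨i, q⟩ :=
    intervalIntegral.integral_add_adjacent_intervals
      (hII.mono_set (by rw [Set.uIcc_of_le hst, Set.uIcc_of_le hc.1.le]
                        exact Set.Icc_subset_Icc_right hc.2.le))
      (hII.mono_set (by rw [Set.uIcc_of_le hst, Set.uIcc_of_le hc.2.le]
                        exact Set.Icc_subset_Icc_left hc.1.le))
  rw [intervalIntegral.integral_symm] at h1
  linarith

theorem IsDirichlet.sub_eq_integral [Countable V] [Countable E] {f : G.Cable → ℝ}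
    (hf : G.IsDirichlet f) {i : E ⊕ V} {s t : ℝ} (hs : s ∈ G.closedInterval i)
    (ht : t ∈ G.closedInterval i) :
    f (G.cablePoint i t) - f (G.cablePoint i s) = ∫ r in s..t, G.grad f ⟨i, r⟩ :=
  sub_eq_integral_of_continuousOn hf.memLp_grad (continuous_cable_iff.1 hf.continuous i)
    (hf.isW12 i).2.2 hs ht

theorem tendsto_integral_mul {α : Type*} [MeasurableSpace α] {μ : Measure α} {u : ℕ → α → ℝ}
    {v w : α → ℝ} (hu : ∀ n, MemLp (u n) 2 μ) (hv : MemLp v 2 μ) (hw : MemLp w 2 μ)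
    (h : Tendsto (fun n => ∫ x, (u n x - v x) ^ 2 ∂μ) atTop (𝓝 0)) :
    Tendsto (fun n => ∫ x, u n x * w x ∂μ) atTop (𝓝 (∫ x, v x * w x ∂μ)) := by
  rw [tendsto_iff_norm_sub_tendsto_zero]
  have hb : ∀ n, ‖(∫ x, u n x * w x ∂μ) - ∫ x, v x * w x ∂μ‖ ≤
      √(∫ x, (u n x - v x) ^ 2 ∂μ) * √(∫ x, w x ^ 2 ∂μ) := by
    intro n
    have hd := (hu n).sub hv
    have e : (∫ x, u n x * w x ∂μ) - ∫ x, v x * w x ∂μ = ∫ x, (u n - v) x * w x ∂μ := by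
      refine (integral_sub ((hu n).integrable_mul hw) (hv.integrable_mul hw)).symm.trans ?_
      simp [sub_mul]
    rw [e]
    have := integral_mul_norm_le_Lp_mul_Lq (μ := μ) (f := u n - v) (g := w)
      Real.HolderConjugate.two_two (by simpa using hd) (by simpa using hw)
    refine (norm_integral_le_integral_norm _).trans ?_
    simp only [norm_mul]
    refine this.trans_eq ?_
    rw [Real.sqrt_eq_rpow, Real.sqrt_eq_rpow]
    simp
  refine squeeze_zero (fun _ => norm_nonneg _) hb ?_
  have h2 := (Real.continuous_sqrt.tendsto 0).comp h
  rw [Real.sqrt_zero] at h2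
  simpa using h2.mul_const (√(∫ x, w x ^ 2 ∂μ))

theorem exists_L2_limit {α : Type*} [MeasurableSpace α] {μ : Measure α} {u : ℕ → α → ℝ}
    (hu : ∀ n, MemLp (u n) 2 μ)
    (h : Tendsto (fun p : ℕ × ℕ => ∫ x, (u p.1 x - u p.2 x) ^ 2 ∂μ) atTop (𝓝 0)) :
    ∃ v, MemLp v 2 μ ∧ Tendsto (fun n => ∫ x, (u n x - v x) ^ 2 ∂μ) atTop (𝓝 0) := by
  have hdist : ∀ f g : Lp ℝ 2 μ, dist f g ^ 2 = ∫ x, (f x - g x) ^ 2 ∂μ := by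
    intro f g
    rw [dist_eq_norm, ← real_inner_self_eq_norm_sq, L2.inner_def]
    refine integral_congr_ae ?_
    filter_upwards [Lp.coeFn_sub f g] with x hx
    rw [hx]
    simp [sq]
  set U : ℕ → Lp ℝ 2 μ := fun n => (hu n).toLp (u n) with hU
  have hd : ∀ n m, dist (U n) (U m) = √(∫ x, (u n x - u m x) ^ 2 ∂μ) := by
    intro n m
    rw [eq_comm, Real.sqrt_eq_iff_eq_sq (integral_nonneg fun _ => sq_nonneg _) dist_nonneg, hdist]
    refine integral_congr_ae ?_
    filter_upwards [(hu n).coeFn_toLp, (hu m).coeFn_toLp] with x h1 h2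
    rw [h1, h2]
  have hC : CauchySeq U := by
    rw [cauchySeq_iff_tendsto_dist_atTop_0]
    simp only [hd]
    have h2 := (Real.continuous_sqrt.tendsto 0).comp h
    rwa [Real.sqrt_zero] at h2
  obtain ⟨v, hv⟩ := cauchySeq_tendsto_of_complete hC
  refine ⟨v, Lp.memLp v, ?_⟩
  have h3 := ((tendsto_iff_dist_tendsto_zero.1 hv).pow 2)
  rw [zero_pow two_ne_zero] at h3
  refine h3.congr fun n => ?_
  rw [hdist]
  refine integral_congr_ae ?_
  filter_upwards [(hu n).coeFn_toLp] with x h1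
  rw [h1]

/-- A function in the extended Dirichlet space has a square integrable derivative, which is the
limit of the derivatives of any approximating sequence. -/
theorem grad_of_approximation [Countable V] [Countable E] {k : G.Cable → ℝ}
    {u : ℕ → G.Cable → ℝ} (hu : ∀ n, G.IsDirichlet (u n))
    (hE : Tendsto (fun p : ℕ × ℕ => G.energy (u p.1 - u p.2) (u p.1 - u p.2)) atTop (𝓝 0))
    (hk : ∀ x, Tendsto (fun n => u n x) atTop (𝓝 (k x))) :
    MemLp (G.grad k) 2 G.cableMeasure ∧
      Tendsto (fun n => ∫ p, (G.grad (u n) p - G.grad k p) ^ 2 ∂G.cableMeasure) atTop (𝓝 0) ∧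
      ∀ i, ∀ᵐ t ∂(volume.restrict (G.cableInterval i)),
        HasDerivAt (fun r => k (G.cablePoint i r)) (G.grad k ⟨i, t⟩) t := by
  have hE' : Tendsto (fun p : ℕ × ℕ => ∫ x, (G.grad (u p.1) x - G.grad (u p.2) x) ^ 2
      ∂G.cableMeasure) atTop (𝓝 0) := by
    have := hE.const_mul 2
    rw [mul_zero] at this
    refine this.congr fun p => ?_
    have hD := (hu p.1).sub (hu p.2)
    rw [energy_eq_integral hD.memLp_grad hD.memLp_grad]
    rw [← mul_assoc, mul_one_div_cancel two_ne_zero, one_mul]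
    refine integral_congr_ae ?_
    filter_upwards [(hu p.1).grad_sub (hu p.2)] with x hx
    simp only [hx, Pi.sub_apply, sq]
  obtain ⟨v, hv, hlim⟩ := exists_L2_limit (fun n => (hu n).memLp_grad) hE'
  -- The increments of `u n` converge to those of `k` by pointwise convergence, and to the integrals
  -- of the `L²` limit `v` by Cauchy–Schwarz. So `v` is the gradient of `k`.
  have hinc : ∀ i, ∀ s ∈ G.cableInterval i, ∀ t ∈ G.cableInterval i,
      k (G.cablePoint i t) - k (G.cablePoint i s) = ∫ r in s..t, v ⟨i, r⟩ := by
    intro i s hs t ht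
    have hsub : G.cableInterval i ⊆ G.closedInterval i := by
      rcases i with e | x
      · exact Set.Ioo_subset_Icc_self
      · exact fun r hr => ⟨hr.1.le, hr.2⟩
    have h1 := ((hk (G.cablePoint i t)).sub (hk (G.cablePoint i s)))
    refine tendsto_nhds_unique h1 ?_
    rw [tendsto_iff_norm_sub_tendsto_zero]
    have hb : ∀ n, ‖u n (G.cablePoint i t) - u n (G.cablePoint i s) - ∫ r in s..t, v ⟨i, r⟩‖ ≤
        √(|t - s| * ∫ p, (G.grad (u n) p - v p) ^ 2 ∂G.cableMeasure) := by
      intro n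
      rw [(hu n).sub_eq_integral (hsub hs) (hsub ht), ← intervalIntegral.integral_sub
        (intervalIntegrable_of_memLp (hu n).memLp_grad (hsub hs) (hsub ht))
        (intervalIntegrable_of_memLp hv (hsub hs) (hsub ht))]
      refine Real.abs_le_sqrt ?_
      exact norm_intervalIntegral_le ((hu n).memLp_grad.sub hv) (hsub hs) (hsub ht)
    refine squeeze_zero (fun _ => norm_nonneg _) hb ?_
    have h2 := (Real.continuous_sqrt.tendsto 0).comp (by simpa using hlim.const_mul |t - s|)
    rwa [Real.sqrt_zero] at h2
  have hd := fun i => ae_hasDerivAt_of_sub_eq_integral (G.isOpen_cableInterval i)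
    (G.ordConnected_cableInterval i) (MemLp_two_cable hv i) (hinc i)
  have hae : G.grad k =ᵐ[G.cableMeasure] v := by
    refine ae_cableMeasure_iff.2 fun i => ?_
    filter_upwards [hd i] with t ht
    exact ht.deriv
  refine ⟨hv.ae_eq hae.symm, hlim.congr fun n => integral_congr_ae ?_, fun i => ?_⟩
  swap
  · filter_upwards [hd i] with t ht
    have := ht.deriv
    change HasDerivAt _ (deriv (fun r => k (G.cablePoint i r)) t) t
    rwa [this]
  filter_upwards [hae] with p hp
  rw [hp]

/-- `U` represents the linear functional `f ↦ ∑ L(x) f(x)` for the Dirichlet form. -/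
def Represents (G : MassiveGraph V E) (U : G.Cable → ℝ) (L : G.Cable →₀ ℝ) : Prop :=
  G.IsExtendedDirichlet U ∧
    ∀ f, G.IsDirichlet f → G.energy U f = Finsupp.linearCombination ℝ f L

theorem isGreenAt_iff_represents {x : G.Cable} {k : G.Cable → ℝ} :
    G.IsGreenAt x k ↔ G.Represents k (Finsupp.single x 1) := by
  simp [IsGreenAt, Represents]

theorem IsExtendedDirichlet.memLp_grad [Countable V] [Countable E] {k : G.Cable → ℝ}
    (hk : G.IsExtendedDirichlet k) : MemLp (G.grad k) 2 G.cableMeasure := by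
  obtain ⟨u, hu, hE, hlim⟩ := hk
  exact (grad_of_approximation hu hE hlim).1

theorem IsExtendedDirichlet.ae_hasDerivAt [Countable V] [Countable E] {k : G.Cable → ℝ}
    (hk : G.IsExtendedDirichlet k) (i : E ⊕ V) :
    ∀ᵐ t ∂(volume.restrict (G.cableInterval i)),
      HasDerivAt (fun r => k (G.cablePoint i r)) (G.grad k ⟨i, t⟩) t := by
  obtain ⟨u, hu, hE, hlim⟩ := hk
  exact (grad_of_approximation hu hE hlim).2.2 i

theorem IsDirichlet.isExtendedDirichlet {f : G.Cable → ℝ} (hf : G.IsDirichlet f) :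
    G.IsExtendedDirichlet f := by
  refine ⟨fun _ => f, fun _ => hf, ?_, fun _ => tendsto_const_nhds⟩
  have : G.energy (f - f) (f - f) = 0 := by simp [energy]
  simp only [this]
  exact tendsto_const_nhds

theorem tendsto_linearCombination {u : ℕ → G.Cable → ℝ} {k : G.Cable → ℝ}
    (hk : ∀ x, Tendsto (fun n => u n x) atTop (𝓝 (k x))) (L : G.Cable →₀ ℝ) :
    Tendsto (fun n => Finsupp.linearCombination ℝ (u n) L) atTop
      (𝓝 (Finsupp.linearCombination ℝ k L)) := by
  simp only [Finsupp.linearCombination_apply, Finsupp.sum]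
  exact tendsto_finsetSum _ fun x _ => (hk x).const_smul (L x)

/-- The representation property is tested only on the domain; it passes to an extended Dirichlet
function `W` along an approximating sequence, whose gradients converge in `L²` and whose values
converge pointwise. The energy of two potentials thus becomes available. -/
theorem Represents.half_integral_eq [Countable V] [Countable E] {U W : G.Cable → ℝ}
    {L : G.Cable →₀ ℝ} (hU : G.Represents U L) (hW : G.IsExtendedDirichlet W) :
    1 / 2 * ∫ p, G.grad W p * G.grad U p ∂G.cableMeasure = Finsupp.linearCombination ℝ W L := by
  have hWm := hW.memLp_grad
  obtain ⟨w, hw, hE, hlim⟩ := hW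
  have h1 := (tendsto_integral_mul (fun n => (hw n).memLp_grad) hWm hU.1.memLp_grad
    (grad_of_approximation hw hE hlim).2.1).const_mul (1 / 2)
  refine tendsto_nhds_unique h1 ((tendsto_linearCombination hlim L).congr fun n => ?_)
  rw [← hU.2 _ (hw n), energy_eq_integral hU.1.memLp_grad (hw n).memLp_grad]
  simp only [mul_comm]

/-- Two representatives evaluate each other symmetrically. -/
theorem Represents.duality [Countable V] [Countable E] {U W : G.Cable → ℝ} {L M : G.Cable →₀ ℝ}
    (hU : G.Represents U L) (hW : G.Represents W M) :
    Finsupp.linearCombination ℝ W L = Finsupp.linearCombination ℝ U M := by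
  rw [← hU.half_integral_eq hW.1, ← hW.half_integral_eq hU.1]
  simp only [mul_comm]

theorem IsDirichlet.energy_nonneg [Countable V] [Countable E] {f : G.Cable → ℝ}
    (hf : G.IsDirichlet f) : 0 ≤ G.energy f f := by
  rw [energy_eq_integral hf.memLp_grad hf.memLp_grad]
  exact mul_nonneg (by norm_num) (integral_nonneg fun _ => mul_self_nonneg _)

theorem IsDirichlet.energy_add_le [Countable V] [Countable E] {f g : G.Cable → ℝ}
    (hf : G.IsDirichlet f) (hg : G.IsDirichlet g) :
    G.energy (f + g) (f + g) ≤ 2 * G.energy f f + 2 * G.energy g g := by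
  rw [energy_eq_integral hf.memLp_grad hf.memLp_grad, energy_eq_integral hg.memLp_grad hg.memLp_grad,
    energy_eq_integral (hf.add hg).memLp_grad (hf.add hg).memLp_grad]
  have h1 : Integrable (fun p => 2 * (G.grad f p * G.grad f p)) G.cableMeasure :=
    (hf.memLp_grad.integrable_mul hf.memLp_grad).const_mul 2
  have h2 : Integrable (fun p => 2 * (G.grad g p * G.grad g p)) G.cableMeasure :=
    (hg.memLp_grad.integrable_mul hg.memLp_grad).const_mul 2
  have : ∫ p, G.grad (f + g) p * G.grad (f + g) p ∂G.cableMeasure ≤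
      ∫ p, (2 * (G.grad f p * G.grad f p) + 2 * (G.grad g p * G.grad g p)) ∂G.cableMeasure := by
    refine integral_mono_of_nonneg (ae_of_all _ fun _ => mul_self_nonneg _) (h1.add h2) ?_
    filter_upwards [hf.grad_add hg] with p hp
    rw [hp]
    simp only [Pi.add_apply]
    nlinarith [sq_nonneg (G.grad f p - G.grad g p)]
  rw [integral_add h1 h2, integral_const_mul, integral_const_mul] at this
  linarith

theorem IsDirichlet.energy_smul [Countable V] [Countable E] {f : G.Cable → ℝ} (c : ℝ)
    (hf : G.IsDirichlet f) : G.energy (c • f) (c • f) = c ^ 2 * G.energy f f := by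
  rw [energy_eq_integral hf.memLp_grad hf.memLp_grad,
    energy_eq_integral (hf.const_smul c).memLp_grad (hf.const_smul c).memLp_grad, grad_smul,
    ← integral_const_mul, ← integral_const_mul, ← integral_const_mul]
  congr 1
  ext p
  simp only [Pi.smul_apply, smul_eq_mul]
  ring

theorem IsExtendedDirichlet.add [Countable V] [Countable E] {f g : G.Cable → ℝ}
    (hf : G.IsExtendedDirichlet f) (hg : G.IsExtendedDirichlet g) :
    G.IsExtendedDirichlet (f + g) := by
  obtain ⟨u, hu, hEu, hlu⟩ := hf
  obtain ⟨w, hw, hEw, hlw⟩ := hg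
  refine ⟨fun n => u n + w n, fun n => (hu n).add (hw n), ?_, fun x => (hlu x).add (hlw x)⟩
  have hb := (hEu.const_mul 2).add (hEw.const_mul 2)
  rw [mul_zero, add_zero] at hb
  have e : ∀ p : ℕ × ℕ, u p.1 + w p.1 - (u p.2 + w p.2) = (u p.1 - u p.2) + (w p.1 - w p.2) :=
    fun p => by abel
  simp only [e]
  exact squeeze_zero
    (fun p => (((hu p.1).sub (hu p.2)).add ((hw p.1).sub (hw p.2))).energy_nonneg)
    (fun p => ((hu p.1).sub (hu p.2)).energy_add_le ((hw p.1).sub (hw p.2))) hb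

theorem IsExtendedDirichlet.const_smul [Countable V] [Countable E] {f : G.Cable → ℝ} (c : ℝ)
    (hf : G.IsExtendedDirichlet f) : G.IsExtendedDirichlet (c • f) := by
  obtain ⟨u, hu, hE, hl⟩ := hf
  refine ⟨fun n => c • u n, fun n => (hu n).const_smul c, ?_, fun x => (hl x).const_smul c⟩
  have hb := hE.const_mul (c ^ 2)
  rw [mul_zero] at hb
  refine hb.congr fun p => ?_
  rw [← smul_sub, ((hu p.1).sub (hu p.2)).energy_smul]

theorem IsExtendedDirichlet.grad_add [Countable V] [Countable E] {f g : G.Cable → ℝ}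
    (hf : G.IsExtendedDirichlet f) (hg : G.IsExtendedDirichlet g) :
    G.grad (f + g) =ᵐ[G.cableMeasure] G.grad f + G.grad g :=
  ae_cableMeasure_iff.2 fun i => by
    filter_upwards [hf.ae_hasDerivAt i, hg.ae_hasDerivAt i] with t h1 h2
    exact (h1.add h2).deriv

/-- Potentials depend linearly on the functional, so new Green functions can be assembled from
explicit potentials. -/
theorem Represents.add [Countable V] [Countable E] {U W : G.Cable → ℝ} {L M : G.Cable →₀ ℝ}
    (hU : G.Represents U L) (hW : G.Represents W M) : G.Represents (U + W) (L + M) := by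
  refine ⟨hU.1.add hW.1, fun f hf => ?_⟩
  have h := energy_eq_integral (hU.1.add hW.1).memLp_grad hf.memLp_grad
  rw [map_add, ← hU.2 f hf, ← hW.2 f hf, h, energy_eq_integral hU.1.memLp_grad hf.memLp_grad,
    energy_eq_integral hW.1.memLp_grad hf.memLp_grad, ← mul_add]
  congr 1
  refine Eq.trans ?_ (integral_add (hU.1.memLp_grad.integrable_mul hf.memLp_grad)
    (hW.1.memLp_grad.integrable_mul hf.memLp_grad))
  refine integral_congr_ae ?_
  filter_upwards [hU.1.grad_add hW.1] with p hp
  rw [hp]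
  simp [add_mul]

theorem Represents.const_smul [Countable V] [Countable E] {U : G.Cable → ℝ} {L : G.Cable →₀ ℝ}
    (c : ℝ) (hU : G.Represents U L) : G.Represents (c • U) (c • L) := by
  refine ⟨hU.1.const_smul c, fun f hf => ?_⟩
  rw [map_smul, ← hU.2 f hf, energy_eq_integral hU.1.memLp_grad hf.memLp_grad,
    energy_eq_integral (hU.1.const_smul c).memLp_grad hf.memLp_grad, grad_smul]
  simp only [Pi.smul_apply, smul_eq_mul, mul_assoc, integral_const_mul]
  ring

theorem Represents.sum [Countable V] [Countable E] {ι : Type*} (s : Finset ι)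
    {U : ι → G.Cable → ℝ} {L : ι → G.Cable →₀ ℝ} (h0 : G.Represents 0 0)
    (h : ∀ i ∈ s, G.Represents (U i) (L i)) : G.Represents (∑ i ∈ s, U i) (∑ i ∈ s, L i) := by
  classical
  induction s using Finset.induction_on with
  | empty => simpa using h0
  | insert a s ha ih =>
    rw [Finset.sum_insert ha, Finset.sum_insert ha]
    exact (h a (Finset.mem_insert_self a s)).add
      (ih fun i hi => h i (Finset.mem_insert_of_mem hi))

end MassiveGraph

/-! ### Explicit functions in the Dirichlet domain -/

namespace MassiveGraph

variable {V E : Type*}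

/-- Lipschitz functions are absolutely continuous. The bound `B` beyond which `g` vanishes gives
square integrability even when `I` is the infinite cable of an unkilled vertex. -/
theorem isW12_of_lipschitzWith {I : Set ℝ} (hI : IsOpen I) (hc : I.OrdConnected)
    (hpos : I ⊆ Set.Ioi 0) {B : ℝ} {K : NNReal} {f g : ℝ → ℝ} (hg : LipschitzWith K g)
    (hB : ∀ t ∈ I, B < t → g t = 0) (hfg : Set.EqOn f g I) : IsW12 I f := by
  have hfd : Set.EqOn (deriv f) (deriv g) I := fun t ht =>
    Filter.EventuallyEq.deriv_eq (Filter.eventuallyEq_of_mem (hI.mem_nhds ht) hfg)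
  have hmem : ∀ {u v : ℝ → ℝ} (C : ℝ), Measurable v → (∀ t ∈ Set.Ioc 0 B, ‖v t‖ ≤ C) →
      (∀ t ∈ I, B < t → v t = 0) → Set.EqOn u v I → MemLp u 2 (volume.restrict I) := by
    intro u v C hv hC h0 huv
    have h1 : MemLp ((Set.Ioc 0 B).indicator v) 2 volume := by
      rw [memLp_indicator_iff_restrict measurableSet_Ioc]
      have : IsFiniteMeasure (volume.restrict (Set.Ioc 0 B)) := ⟨by simp⟩
      exact MemLp.of_bound hv.aestronglyMeasurable C
        ((ae_restrict_iff' measurableSet_Ioc).2 (ae_of_all _ hC))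
    refine (h1.restrict I).ae_eq ?_
    refine (ae_restrict_iff' hI.measurableSet).2 (ae_of_all _ fun t ht => ?_)
    by_cases htB : t ∈ Set.Ioc 0 B
    · rw [Set.indicator_of_mem htB, huv ht]
    · have : B < t := by
        by_contra h
        exact htB ⟨hpos ht, not_lt.1 h⟩
      rw [Set.indicator_of_notMem htB, huv ht, h0 t ht this]
  have hd0 : ∀ t ∈ I, B < t → deriv g t = 0 := by
    intro t ht hBt
    have : g =ᶠ[𝓝 t] fun _ => 0 :=
      Filter.eventuallyEq_of_mem ((hI.inter isOpen_Ioi).mem_nhds ⟨ht, hBt⟩)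
        fun s hs => hB s hs.1 hs.2
    rw [this.deriv_eq, deriv_const]
  refine ⟨?_, ?_, fun s hs t ht => ?_⟩
  · obtain ⟨C, hC⟩ := (isCompact_Icc (a := (0 : ℝ)) (b := B)).exists_bound_of_continuousOn
      hg.continuous.continuousOn
    exact hmem C hg.continuous.measurable (fun t ht => hC t ⟨ht.1.le, ht.2⟩) hB hfg
  · exact hmem K (measurable_deriv g) (fun t _ => norm_deriv_le_of_lipschitz hg) hd0 hfd
  · have hsub : Set.uIcc s t ⊆ I := hc.uIcc_subset hs ht
    rw [intervalIntegral.integral_congr (hfd.mono hsub), hfg hs, hfg ht,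
      (hg.lipschitzOnWith (s := Set.uIcc s t)).absolutelyContinuousOnInterval.integral_deriv_eq_sub]

variable {G : MassiveGraph V E}

theorem cableInterval_subset_closedInterval (i : E ⊕ V) :
    G.cableInterval i ⊆ G.closedInterval i := by
  rcases i with e | x
  · exact Set.Ioo_subset_Icc_self
  · exact fun r hr => ⟨hr.1.le, hr.2⟩

theorem cableInterval_subset_Ioi (i : E ⊕ V) : G.cableInterval i ⊆ Set.Ioi 0 := by
  rcases i with e | x
  · exact fun t ht => ht.1
  · exact fun t ht => ht.1

theorem zero_mem_closedInterval (i : E ⊕ V) : (0 : ℝ) ∈ G.closedInterval i := by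
  rcases i with e | x
  · have := G.weight_pos e
    exact ⟨le_rfl, by positivity⟩
  · exact ⟨le_rfl, by simp⟩

theorem edgePoint_zero (e : E) : G.edgePoint e 0 = .vertex (G.src e) := by
  simp [edgePoint, edgeInterval]

theorem edgeLength_pos (G : MassiveGraph V E) (e : E) : 0 < 1 / (2 * G.weight e) := by
  have := G.weight_pos e
  positivity

theorem edgePoint_of_ge {e : E} {t : ℝ} (ht : 1 / (2 * G.weight e) ≤ t) :
    G.edgePoint e t = .vertex (G.tgt e) := by
  have h := G.edgeLength_pos e
  rw [edgePoint, dif_neg (fun h' => absurd h'.2 (not_lt.2 ht)), if_neg (not_le.2 (h.trans_le ht))]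

theorem edgePoint_length (e : E) : G.edgePoint e (1 / (2 * G.weight e)) = .vertex (G.tgt e) :=
  edgePoint_of_ge le_rfl

theorem edgePoint_of_mem {e : E} {t : ℝ} (h : t ∈ G.edgeInterval e) :
    G.edgePoint e t = .onEdge e ⟨t, h⟩ := dif_pos h

theorem spurPoint_of_mem {x : V} {t : ℝ} (h : t ∈ G.spurInterval x) :
    G.spurPoint x t = .onSpur x ⟨t, h⟩ := dif_pos h

theorem spurPoint_zero (x : V) : G.spurPoint x 0 = .vertex x := by
  simp [spurPoint, spurInterval]

theorem exists_cablePoint_eq (z : G.Cable) :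
    ∃ i, ∃ t ∈ G.closedInterval i, G.cablePoint i t = z := by
  cases z with
  | vertex x => exact ⟨.inr x, 0, zero_mem_closedInterval _, spurPoint_zero x⟩
  | onEdge e t => exact ⟨.inl e, t, cableInterval_subset_closedInterval (.inl e) t.2,
      edgePoint_of_mem t.2⟩
  | onSpur x t => exact ⟨.inr x, t, cableInterval_subset_closedInterval (.inr x) t.2,
      spurPoint_of_mem t.2⟩

/-- Outside the compact union of finitely many segments `[0, B]`, the function is either zero or
smaller than `ε`. The inclusion of these segments in the cables matters, because a killed cable
lacks its far end. -/
theorem tendsto_cocompact_zero {f : G.Cable → ℝ} {F : Set (E ⊕ V)} (hF : F.Finite)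
    (h0 : ∀ i ∉ F, ∀ t ∈ G.closedInterval i, f (G.cablePoint i t) = 0)
    (h : ∀ i ∈ F, ∀ ε > 0, ∃ B, Set.Icc 0 B ⊆ G.closedInterval i ∧
      ∀ t ∈ G.closedInterval i, B < t → |f (G.cablePoint i t)| < ε) :
    Tendsto f (cocompact G.Cable) (𝓝 0) := by
  rw [Metric.tendsto_nhds]
  intro ε hε
  choose! B hB hB' using fun i hi => h i hi ε hε
  refine mem_cocompact.2 ⟨⋃ i ∈ F, G.cablePoint i '' Set.Icc 0 (B i), ?_, ?_⟩
  · refine hF.isCompact_biUnion fun i hi => isCompact_Icc.image_of_continuousOn ?_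
    exact (continuousOn_iff_continuous_domRestrict.2 (G.continuous_cablePoint i)).mono (hB i hi)
  · intro z hz
    obtain ⟨i, t, ht, rfl⟩ := exists_cablePoint_eq z
    simp only [Set.mem_ofPred_eq, dist_zero_right, Real.norm_eq_abs]
    by_cases hi : i ∈ F
    · by_cases htB : t ≤ B i
      · have ht0 : 0 ≤ t := by
          rcases i with e | x
          · exact ht.1
          · exact ht.1
        exact (hz (Set.mem_biUnion (x := i) hi ⟨t, ⟨ht0, htB⟩, rfl⟩)).elim
      · exact hB' i hi t ht (not_le.1 htB)
    · rw [h0 i hi t ht, abs_zero]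
      exact hε

theorem w12NormSq_eq_zero {f : ℝ → ℝ} {I : Set ℝ} (hI : IsOpen I) (h : ∀ t ∈ I, f t = 0) :
    w12NormSq I f = 0 := by
  have hd : ∀ t ∈ I, deriv f t = 0 := by
    intro t ht
    rw [Filter.EventuallyEq.deriv_eq (f := fun _ => 0)
      (Filter.eventuallyEq_of_mem (hI.mem_nhds ht) h), deriv_const]
  have hm := hI.measurableSet
  have i1 := setIntegral_congr_fun (μ := volume) hm (f := fun t => f t ^ 2)
    (g := fun _ => 0) fun t ht => by simpa using h t ht
  have i2 := setIntegral_congr_fun (μ := volume) hm (f := fun t => deriv f t ^ 2)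
    (g := fun _ => 0) fun t ht => by simpa using hd t ht
  rw [w12NormSq, i1, i2]
  simp

theorem isDirichlet_of_finite {f : G.Cable → ℝ} {F : Set (E ⊕ V)} (hF : F.Finite)
    (hc : Continuous f)
    (h0 : ∀ i ∉ F, ∀ t ∈ G.closedInterval i, f (G.cablePoint i t) = 0)
    (h : ∀ i ∈ F, ∀ ε > 0, ∃ B, Set.Icc 0 B ⊆ G.closedInterval i ∧
      ∀ t ∈ G.closedInterval i, B < t → |f (G.cablePoint i t)| < ε)
    (hw : ∀ i, IsW12 (G.cableInterval i) fun t => f (G.cablePoint i t)) : G.IsDirichlet f := by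
  have hz : ∀ i ∉ F, w12NormSq (G.cableInterval i) (fun t => f (G.cablePoint i t)) = 0 :=
    fun i hi => w12NormSq_eq_zero (G.isOpen_cableInterval i)
      fun t ht => h0 i hi t (cableInterval_subset_closedInterval i ht)
  have hs : Summable fun i => w12NormSq (G.cableInterval i) fun t => f (G.cablePoint i t) :=
    summable_of_ne_finset_zero (s := hF.toFinset) fun i hi => hz i fun h => hi (hF.mem_toFinset.2 h)
  have h1 := hs.comp_injective Sum.inl_injective
  have h2 := hs.comp_injective Sum.inr_injective
  exact ⟨hc, tendsto_cocompact_zero hF h0 h, fun e => hw (.inl e), fun x => hw (.inr x), h1, h2⟩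

/-- A continuous function on the cable system that diverges along a family of points forces a
function vanishing at infinity to tend to zero along it. -/
theorem IsDirichlet.tendsto_zero {f : G.Cable → ℝ} (hf : G.IsDirichlet f) {r : G.Cable → ℝ}
    (hr : Continuous r) {β : Type*} {l : Filter β} {z : β → G.Cable}
    (hz : Tendsto (fun b => r (z b)) l atTop) : Tendsto (fun b => f (z b)) l (𝓝 0) := by
  refine hf.zero_at_infty.comp fun s hs => ?_
  change ∀ᶠ b in l, z b ∈ s
  obtain ⟨K, hK, hKs⟩ := mem_cocompact.1 hs
  obtain ⟨C, hC⟩ := (hK.image hr).bddAbove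
  filter_upwards [hz.eventually_gt_atTop C] with b hb
  refine hKs fun hbK => ?_
  exact absurd (hC ⟨_, hbK, rfl⟩) (not_le.2 hb)

open Classical in
/-- The function equal to `g` on the cable of `e` and to zero elsewhere. -/
noncomputable def edgeBump (G : MassiveGraph V E) (e : E) (g : ℝ → ℝ) : G.Cable → ℝ
  | .onEdge e' t => if e' = e then g t else 0
  | _ => 0

theorem edgeBump_edgePoint {e : E} {g : ℝ → ℝ} (h0 : ∀ t ≤ 0, g t = 0)
    (h1 : ∀ t, 1 / (2 * G.weight e) ≤ t → g t = 0) (t : ℝ) :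
    G.edgeBump e g (G.edgePoint e t) = g t := by
  unfold edgePoint
  split_ifs with h h'
  · simp [edgeBump]
  · simp [edgeBump, h0 t h']
  · rw [h1 t]
    · rfl
    · by_contra hlt
      exact h ⟨not_le.1 h', not_le.1 hlt⟩

theorem edgeBump_of_ne {e : E} {g : ℝ → ℝ} {i : E ⊕ V} (hi : i ≠ .inl e) (t : ℝ) :
    G.edgeBump e g (G.cablePoint i t) = 0 := by
  rcases i with e' | x
  · have : e' ≠ e := fun h => hi (by rw [h])
    change G.edgeBump e g (G.edgePoint e' t) = 0
    unfold edgePoint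
    split_ifs <;> simp [edgeBump, this]
  · change G.edgeBump e g (G.spurPoint x t) = 0
    unfold spurPoint
    split_ifs <;> simp [edgeBump]

theorem isDirichlet_edgeBump {e : E} {g : ℝ → ℝ} {K : NNReal} (hg : LipschitzWith K g)
    (h0 : ∀ t ≤ 0, g t = 0) (h1 : ∀ t, 1 / (2 * G.weight e) ≤ t → g t = 0) :
    G.IsDirichlet (G.edgeBump e g) := by
  have he : (fun t => G.edgeBump e g (G.cablePoint (.inl e) t)) = g :=
    funext (edgeBump_edgePoint h0 h1)
  have hne : ∀ i : E ⊕ V, i ≠ .inl e → (fun t => G.edgeBump e g (G.cablePoint i t)) = fun _ => 0 :=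
    fun i hi => funext (edgeBump_of_ne hi)
  refine isDirichlet_of_finite (Set.finite_singleton (Sum.inl e)) ?_ ?_ ?_ ?_
  · refine continuous_cable_iff.2 fun i => ?_
    by_cases hi : i = .inl e
    · subst hi
      rw [he]
      exact hg.continuous.continuousOn
    · rw [hne i hi]
      exact continuousOn_const
  · intro i hi t _
    exact edgeBump_of_ne hi t
  · rintro i rfl ε hε
    refine ⟨1 / (2 * G.weight e), subset_rfl, fun t ht ht' => absurd ht.2 (not_le.2 ht')⟩
  · intro i
    by_cases hi : i = .inl e
    · subst hi
      refine isW12_of_lipschitzWith (G.isOpen_cableInterval _) (G.ordConnected_cableInterval _)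
        (cableInterval_subset_Ioi _) hg (B := 1 / (2 * G.weight e)) (fun t _ ht => h1 t ht.le) ?_
      rw [he]
      exact fun _ _ => rfl
    · refine isW12_of_lipschitzWith (G.isOpen_cableInterval _) (G.ordConnected_cableInterval _)
        (cableInterval_subset_Ioi _) (LipschitzWith.const (0 : ℝ)) (B := 0) (fun t _ ht => rfl) ?_
      rw [hne i hi]
      exact fun _ _ => rfl

theorem energy_edgeBump [Countable V] [Countable E] {e : E} {g : ℝ → ℝ} {K : NNReal}
    (hg : LipschitzWith K g) (h0 : ∀ t ≤ 0, g t = 0)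
    (h1 : ∀ t, 1 / (2 * G.weight e) ≤ t → g t = 0) {u : G.Cable → ℝ} (hu : G.IsDirichlet u) :
    G.energy (G.edgeBump e g) u =
      1 / 2 * ∫ t in G.edgeInterval e, deriv g t * G.grad u ⟨.inl e, t⟩ := by
  have hD := isDirichlet_edgeBump hg h0 h1
  rw [energy_eq_integral hD.memLp_grad hu.memLp_grad]
  have hs := hasSum_integral_cableMeasure (hD.memLp_grad.integrable_mul hu.memLp_grad)
  have he : (fun t => G.edgeBump e g (G.cablePoint (.inl e) t)) = g :=
    funext (edgeBump_edgePoint h0 h1)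
  congr 1
  refine (hs.unique (hasSum_single (Sum.inl e) fun i hi => ?_)).trans ?_
  · have : (fun t => G.edgeBump e g (G.cablePoint i t)) = fun _ => 0 :=
      funext (edgeBump_of_ne hi)
    simp [grad, this]
  · simp only [Pi.mul_apply, grad, he]
    rfl

end MassiveGraph

/-! ### Piecewise linear extensions of functions on the vertices -/

namespace MassiveGraph

variable {V E : Type*} {G : MassiveGraph V E}

/-- The extension of a function on the vertices that is linear on the cables of the edges, and
decreases linearly to zero with relative slope `σ x` on the cable of the vertex `x`. -/
noncomputable def linExt (G : MassiveGraph V E) (a σ : V → ℝ) : G.Cable → ℝ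
  | .vertex x => a x
  | .onEdge e t => a (G.src e) + (a (G.tgt e) - a (G.src e)) * (2 * G.weight e * t)
  | .onSpur x t => a x * max 0 (1 - σ x * t)

theorem linExt_edgePoint (a σ : V → ℝ) {e : E} {t : ℝ} (ht : t ∈ G.closedInterval (.inl e)) :
    G.linExt a σ (G.cablePoint (.inl e) t) =
      a (G.src e) + (a (G.tgt e) - a (G.src e)) * (2 * G.weight e * t) := by
  have hw := G.weight_pos e
  have ht0 : 0 ≤ t := ht.1
  have ht1 : t ≤ 1 / (2 * G.weight e) := ht.2
  change G.linExt a σ (G.edgePoint e t) = _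
  rcases ht0.eq_or_lt with rfl | h0
  · rw [edgePoint_zero]
    simp [linExt]
  rcases ht1.eq_or_lt with rfl | h1
  · rw [edgePoint_length]
    simp only [linExt]
    field_simp
    ring
  · rw [edgePoint_of_mem (show t ∈ G.edgeInterval e from ⟨h0, h1⟩)]
    rfl

theorem linExt_spurPoint (a σ : V → ℝ) {x : V} {t : ℝ} (ht : t ∈ G.closedInterval (.inr x)) :
    G.linExt a σ (G.cablePoint (.inr x) t) = a x * max 0 (1 - σ x * t) := by
  have ht0 : 0 ≤ t := ht.1
  change G.linExt a σ (G.spurPoint x t) = _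
  rcases ht0.eq_or_lt with rfl | h0
  · rw [spurPoint_zero]
    simp [linExt]
  · rw [spurPoint_of_mem (show t ∈ G.spurInterval x from ⟨h0, ht.2⟩)]
    rfl

theorem continuous_linExt (a σ : V → ℝ) : Continuous (G.linExt a σ) := by
  refine continuous_cable_iff.2 fun i => ?_
  rcases i with e | x
  · refine ContinuousOn.congr (f := fun t : ℝ =>
      a (G.src e) + (a (G.tgt e) - a (G.src e)) * (2 * G.weight e * t)) ?_
      fun t ht => linExt_edgePoint a σ ht
    fun_prop
  · refine ContinuousOn.congr (f := fun t : ℝ => a x * max 0 (1 - σ x * t)) ?_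
      fun t ht => linExt_spurPoint a σ ht
    fun_prop

/-- A positive slope makes the function vanish from distance `1 / σ x` on, even along an infinite
cable, and `2 κ ≤ σ` makes it tend to zero before or at the open end of a killed cable. -/
theorem isDirichlet_linExt [DecidableEq V] {a σ : V → ℝ} (ha : (Function.support a).Finite)
    (hσ : ∀ x, 0 < σ x) (hκ : ∀ x, 2 * G.killing x ≤ σ x) : G.IsDirichlet (G.linExt a σ) := by
  have hF : (⋃ x ∈ Function.support a,
      (Sum.inl '' {e | G.src e = x ∨ G.tgt e = x} ∪ {Sum.inr x} : Set (E ⊕ V))).Finite :=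
    ha.biUnion fun x _ => ((G.locallyFinite x).image _).union (Set.finite_singleton _)
  refine isDirichlet_of_finite hF (continuous_linExt a σ) ?_ ?_ ?_
  · intro i hi t ht
    simp only [Set.mem_iUnion, not_exists] at hi
    rcases i with e | x
    · have h1 : a (G.src e) = 0 := by
        by_contra h
        exact hi _ h (Or.inl ⟨e, Or.inl rfl, rfl⟩)
      have h2 : a (G.tgt e) = 0 := by
        by_contra h
        exact hi _ h (Or.inl ⟨e, Or.inr rfl, rfl⟩)
      rw [linExt_edgePoint a σ ht, h1, h2]
      simp
    · have h1 : a x = 0 := by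
        by_contra h
        exact hi _ h (Or.inr rfl)
      rw [linExt_spurPoint a σ ht, h1, zero_mul]
  · intro i _ ε hε
    rcases i with e | x
    · exact ⟨1 / (2 * G.weight e), subset_rfl, fun t ht ht' => absurd ht.2 (not_le.2 ht')⟩
    · have hA : 0 < |a x| + 1 := by positivity
      -- The cable is cut where `1 - σ x * t = δ`: `δ > 0` keeps the cut strictly inside the
      -- half-open cable, and `|a x| * δ < ε` bounds the function beyond it.
      set δ := min (1 / 2) (ε / (|a x| + 1)) with hδ
      have hδ0 : 0 < δ := lt_min (by norm_num) (by positivity)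
      have hδ1 : δ < 1 := (min_le_left _ _).trans_lt (by norm_num)
      have hδe : |a x| * δ < ε := by
        have h2 : δ ≤ ε / (|a x| + 1) := min_le_right _ _
        calc |a x| * δ < (|a x| + 1) * δ := by nlinarith
          _ ≤ (|a x| + 1) * (ε / (|a x| + 1)) := by gcongr
          _ = ε := by field_simp
      refine ⟨(1 - δ) / σ x, fun t ht => ⟨ht.1, ?_⟩, fun t ht htB => ?_⟩
      · have h1 : σ x * t ≤ 1 - δ := by
          have := (le_div_iff₀ (hσ x)).1 ht.2
          linarith
        have h2 : 2 * G.killing x * t ≤ σ x * t := mul_le_mul_of_nonneg_right (hκ x) ht.1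
        linarith
      · rw [linExt_spurPoint a σ ht, abs_mul]
        have h1 : 1 - δ < σ x * t := by
          have := (div_lt_iff₀ (hσ x)).1 htB
          linarith
        have h2 : |max 0 (1 - σ x * t)| ≤ δ := by
          rw [abs_of_nonneg (le_max_left _ _)]
          exact max_le hδ0.le (by linarith)
        exact (mul_le_mul_of_nonneg_left h2 (abs_nonneg _)).trans_lt hδe
  · intro i
    rcases i with e | x
    · have hl : LipschitzWith (‖(a (G.tgt e) - a (G.src e)) * (2 * G.weight e)‖₊)
          fun t : ℝ => a (G.src e) + (a (G.tgt e) - a (G.src e)) * (2 * G.weight e * t) := by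
        refine LipschitzWith.of_dist_le_mul fun s t => ?_
        rw [Real.dist_eq, Real.dist_eq, coe_nnnorm, Real.norm_eq_abs, ← abs_mul]
        apply le_of_eq
        congr 1
        ring
      refine isW12_of_lipschitzWith (G.isOpen_cableInterval _) (G.ordConnected_cableInterval _)
        (cableInterval_subset_Ioi _) hl (B := 1 / (2 * G.weight e))
        (fun t ht h => absurd h (not_lt.2 (cableInterval_subset_closedInterval (.inl e) ht).2)) ?_
      exact fun t ht => linExt_edgePoint a σ (cableInterval_subset_closedInterval (.inl e) ht)
    · have hl : LipschitzWith (‖a x‖₊ * ‖σ x‖₊) fun t : ℝ => a x * max 0 (1 - σ x * t) := by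
        refine LipschitzWith.of_dist_le_mul fun s t => ?_
        rw [Real.dist_eq, Real.dist_eq, NNReal.coe_mul, coe_nnnorm, coe_nnnorm, ← mul_sub, abs_mul,
          mul_assoc]
        refine mul_le_mul_of_nonneg_left ?_ (abs_nonneg _)
        have := abs_max_sub_max_le_abs (1 - σ x * s) (1 - σ x * t) 0
        rw [max_comm, max_comm 0]
        refine this.trans (le_of_eq ?_)
        rw [Real.norm_eq_abs, ← abs_mul, ← abs_neg]
        congr 1
        ring
      refine isW12_of_lipschitzWith (G.isOpen_cableInterval _) (G.ordConnected_cableInterval _)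
        (cableInterval_subset_Ioi _) hl (B := 1 / σ x) (fun t ht h => ?_) ?_
      · have := (div_lt_iff₀ (hσ x)).1 h
        rw [max_eq_left (by linarith), mul_zero]
      · exact fun t ht => linExt_spurPoint a σ (cableInterval_subset_closedInterval (.inr x) ht)

/-- The derivative of `linExt a σ`. -/
noncomputable def linExtGrad (G : MassiveGraph V E) (a σ : V → ℝ) : (Σ _ : E ⊕ V, ℝ) → ℝ
  | ⟨.inl e, _⟩ => (a (G.tgt e) - a (G.src e)) * (2 * G.weight e)
  | ⟨.inr x, t⟩ => (Set.Iio (1 / σ x)).indicator (fun _ => -(a x * σ x)) t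

theorem measurable_linExtGrad (a σ : V → ℝ) : Measurable (G.linExtGrad a σ) := by
  refine measurable_sigma_iff.2 fun i => ?_
  rcases i with e | x
  · exact measurable_const
  · exact measurable_const.indicator measurableSet_Iio

theorem grad_linExt [Countable V] [Countable E] {a σ : V → ℝ} (hσ : ∀ x, 0 ≤ σ x) :
    G.grad (G.linExt a σ) =ᵐ[G.cableMeasure] G.linExtGrad a σ := by
  refine ae_cableMeasure_iff.2 fun i => ?_
  have hm := (G.isOpen_cableInterval i).measurableSet
  rcases i with e | x
  · refine (ae_restrict_iff' hm).2 (ae_of_all _ fun t ht => ?_)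
    have heq := Filter.EventuallyEq.deriv_eq
      (f := fun t : ℝ => a (G.src e) + (a (G.tgt e) - a (G.src e)) * (2 * G.weight e * t))
      (Filter.eventuallyEq_of_mem ((G.isOpen_cableInterval (.inl e)).mem_nhds ht) fun s hs =>
      linExt_edgePoint a σ (cableInterval_subset_closedInterval (.inl e) hs))
    refine heq.trans ?_
    have : HasDerivAt (fun t : ℝ => a (G.src e) + (a (G.tgt e) - a (G.src e)) * (2 * G.weight e * t))
        ((a (G.tgt e) - a (G.src e)) * (2 * G.weight e * 1)) t :=
      (((hasDerivAt_id t).const_mul _).const_mul _).const_add _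
    rw [this.deriv, mul_one]
    rfl
  · rcases (hσ x).eq_or_lt with h0 | hpos
    · refine (ae_restrict_iff' hm).2 (ae_of_all _ fun t ht => ?_)
      have heq := Filter.EventuallyEq.deriv_eq (f := fun t : ℝ => a x)
        (Filter.eventuallyEq_of_mem ((G.isOpen_cableInterval (.inr x)).mem_nhds ht) fun s hs =>
          (linExt_spurPoint a σ (cableInterval_subset_closedInterval (.inr x) hs)).trans
            (by rw [← h0]; simp))
      refine heq.trans ?_
      simp [linExtGrad, ← h0]
    · have hne : ∀ᵐ t : ℝ, t ≠ 1 / σ x := by simp [ae_iff, measure_singleton]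
      refine (ae_restrict_iff' hm).2 (hne.mono fun t hne ht => ?_)
      have heq := Filter.EventuallyEq.deriv_eq (f := fun t : ℝ => a x * max 0 (1 - σ x * t))
        (Filter.eventuallyEq_of_mem ((G.isOpen_cableInterval (.inr x)).mem_nhds ht) fun s hs =>
          linExt_spurPoint a σ (cableInterval_subset_closedInterval (.inr x) hs))
      refine heq.trans ?_
      rcases lt_or_gt_of_ne hne with hlt | hgt
      · have : (fun t : ℝ => a x * max 0 (1 - σ x * t)) =ᶠ[𝓝 t] fun t => a x * (1 - σ x * t) := by
          filter_upwards [Iio_mem_nhds hlt] with s hs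
          have := (lt_div_iff₀ hpos).1 hs
          rw [max_eq_right (by linarith)]
        rw [this.deriv_eq]
        have hd : HasDerivAt (fun t : ℝ => a x * (1 - σ x * t)) (a x * (-(σ x * 1))) t :=
          (((hasDerivAt_id t).const_mul _).const_sub _).const_mul _
        rw [hd.deriv, linExtGrad, Set.indicator_of_mem (show t ∈ Set.Iio (1 / σ x) from hlt)]
        ring
      · have : (fun t : ℝ => a x * max 0 (1 - σ x * t)) =ᶠ[𝓝 t] fun t => 0 := by
          filter_upwards [Ioi_mem_nhds hgt] with s hs
          have := (div_lt_iff₀ hpos).1 hs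
          rw [max_eq_left (by linarith), mul_zero]
        rw [this.deriv_eq]
        simp only [deriv_const, linExtGrad]
        rw [Set.indicator_of_notMem]
        exact fun h => absurd hgt (not_lt.2 (le_of_lt h))

theorem integrable_cableMeasure_iff [Countable V] [Countable E] {g : (Σ _ : E ⊕ V, ℝ) → ℝ}
    (h0 : ∀ p, 0 ≤ g p) : Integrable g G.cableMeasure ↔
      (∀ i, IntegrableOn (fun t => g ⟨i, t⟩) (G.cableInterval i)) ∧
        Summable fun i => ∫ t in G.cableInterval i, g ⟨i, t⟩ := by
  rw [cableMeasure, integrable_sum_measure_iff]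
  simp only [integrable_map_sigmaMk, integral_map_sigmaMk, Real.norm_eq_abs, abs_of_nonneg (h0 _)]
  rfl

theorem isExtendedDirichlet_of_tendsto [Countable V] [Countable E] {k : G.Cable → ℝ}
    {u : ℕ → G.Cable → ℝ} (hu : ∀ n, G.IsDirichlet (u n)) {w : (Σ _ : E ⊕ V, ℝ) → ℝ}
    (hw : MemLp w 2 G.cableMeasure)
    (h : Tendsto (fun n => ∫ p, (G.grad (u n) p - w p) ^ 2 ∂G.cableMeasure) atTop (𝓝 0))
    (hk : ∀ x, Tendsto (fun n => u n x) atTop (𝓝 (k x))) : G.IsExtendedDirichlet k := by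
  refine ⟨u, hu, ?_, hk⟩
  have hb : Tendsto (fun p : ℕ × ℕ => (∫ q, (G.grad (u p.1) q - w q) ^ 2 ∂G.cableMeasure) +
      ∫ q, (G.grad (u p.2) q - w q) ^ 2 ∂G.cableMeasure) atTop (𝓝 0) := by
    rw [← prod_atTop_atTop_eq]
    simpa using (h.comp tendsto_fst).add (h.comp tendsto_snd)
  refine squeeze_zero (fun p => ((hu p.1).sub (hu p.2)).energy_nonneg) (fun p => ?_) hb
  have hD := ((hu p.1).sub (hu p.2)).memLp_grad
  rw [energy_eq_integral hD hD, ← integral_const_mul]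
  refine le_of_le_of_eq ?_ (integral_add ((hu p.1).memLp_grad.sub hw).integrable_sq
    ((hu p.2).memLp_grad.sub hw).integrable_sq)
  refine integral_mono_of_nonneg (ae_of_all _ fun q => mul_nonneg (by norm_num) (mul_self_nonneg _))
    (((hu p.1).memLp_grad.sub hw).integrable_sq.add ((hu p.2).memLp_grad.sub hw).integrable_sq) ?_
  filter_upwards [(hu p.1).grad_sub (hu p.2)] with q hq
  simp only [hq, Pi.sub_apply]
  nlinarith [sq_nonneg ((G.grad (u p.1) q - w q) + (G.grad (u p.2) q - w q))]

/-- A function on the vertices that is approximated in energy by finitely supported functions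
extends to a function in the extended Dirichlet space. -/
theorem isExtendedDirichlet_linExt [Countable V] [Countable E] {a : V → ℝ} {b : ℕ → V → ℝ}
    (hfin : ∀ n, (Function.support (b n)).Finite) (hb : ∀ n x, |b n x| ≤ 1)
    (hκ : ∀ n x, G.killing x ≠ 0 → b n x = a x)
    (hlim : ∀ x, Tendsto (fun n => b n x) atTop (𝓝 (a x)))
    (hs : ∀ n, Summable fun e => G.weight e *
      ((b n (G.tgt e) - b n (G.src e)) - (a (G.tgt e) - a (G.src e))) ^ 2)
    (h0 : Tendsto (fun n => ∑' e, G.weight e *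
      ((b n (G.tgt e) - b n (G.src e)) - (a (G.tgt e) - a (G.src e))) ^ 2) atTop (𝓝 0)) :
    G.IsExtendedDirichlet (G.linExt a fun x => 2 * G.killing x) := by
  classical
  have := Encodable.ofCountable V
  -- A nonzero constant is not square integrable on the infinite cable of an unkilled vertex. The
  -- approximants decrease there with slope `ε x / (n + 1)`, at a cost of at most `ε x / (n + 1)`,
  -- which is summable over the vertices with sum tending to 0. On killed cables the slope is
  -- exactly `2 κ` and `b n = a`, so there is no error.
  obtain ⟨ε, hε, c, hc, -⟩ := posSumOfEncodable one_pos V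
  set σ : ℕ → V → ℝ := fun n x => if G.killing x = 0 then ε x / (n + 1) else 2 * G.killing x with hσ
  have hσpos : ∀ n x, 0 < σ n x := by
    intro n x
    simp only [hσ]
    split_ifs with h
    · have := hε x
      positivity
    · have := lt_of_le_of_ne (G.killing_nonneg x) (Ne.symm h)
      positivity
  have hσκ : ∀ n x, 2 * G.killing x ≤ σ n x := by
    intro n x
    by_cases h : G.killing x = 0
    · rw [h, mul_zero]
      exact (hσpos n x).le
    · simp [hσ, h]
  have hσ0 : ∀ x, (0 : ℝ) ≤ 2 * G.killing x := fun x => mul_nonneg zero_le_two (G.killing_nonneg x)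
  set u : ℕ → G.Cable → ℝ := fun n => G.linExt (b n) (σ n) with hu
  have huD : ∀ n, G.IsDirichlet (u n) := fun n => isDirichlet_linExt (hfin n) (hσpos n) (hσκ n)
  set w := G.linExtGrad a fun x => 2 * G.killing x with hw
  set v : ℕ → (Σ _ : E ⊕ V, ℝ) → ℝ := fun n p => (G.linExtGrad (b n) (σ n) p - w p) ^ 2 with hv
  have hvm : ∀ n, Measurable (v n) := fun n =>
    ((measurable_linExtGrad _ _).sub (measurable_linExtGrad _ _)).pow_const 2
  have hedge : ∀ n e, (fun t => v n ⟨.inl e, t⟩) = fun _ =>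
      ((b n (G.tgt e) - b n (G.src e)) - (a (G.tgt e) - a (G.src e))) ^ 2 * (2 * G.weight e) ^ 2 := by
    intro n e
    ext t
    simp only [hv, hw, linExtGrad]
    ring
  have hspur : ∀ n x, ∀ t ∈ G.cableInterval (.inr x), v n ⟨.inr x, t⟩ ≤
      (Set.Ioc 0 ((n + 1) / ε x)).indicator (fun _ => (ε x / (n + 1)) ^ 2) t := by
    intro n x t ht
    by_cases hx : G.killing x = 0
    · have ht0 : 0 < t := ht.1
      have hε' := hε x
      simp only [hv, hw, linExtGrad, hσ, hx, mul_zero, neg_zero, Set.indicator_zero, sub_zero,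
        if_true, one_div_div]
      by_cases hlt : t < (n + 1) / ε x
      · rw [Set.indicator_of_mem (show t ∈ Set.Iio ((n + 1) / ε x) from hlt),
          Set.indicator_of_mem (show t ∈ Set.Ioc 0 ((n + 1) / ε x) from ⟨ht0, hlt.le⟩), neg_sq, mul_pow]
        have h1 : b n x ^ 2 ≤ 1 := (sq_le_one_iff_abs_le_one _).2 (hb n x)
        exact mul_le_of_le_one_left (sq_nonneg _) h1
      · rw [Set.indicator_of_notMem (show t ∉ Set.Iio ((n + 1) / ε x) from hlt), zero_pow two_ne_zero]
        exact Set.indicator_nonneg (fun _ _ => sq_nonneg _) _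
    · simp only [hv, hw, linExtGrad, hσ, hx, hκ n x hx, if_false, sub_self]
      rw [zero_pow two_ne_zero]
      exact Set.indicator_nonneg (fun _ _ => sq_nonneg _) _
  have hind : ∀ n x, Integrable ((Set.Ioc 0 (((n : ℕ) + 1 : ℝ) / ε x)).indicator
      fun _ => (ε x / (n + 1)) ^ 2) volume := fun n x =>
    (integrable_indicator_iff measurableSet_Ioc).2 (integrableOn_const (by simp))
  have hspurI : ∀ n x, IntegrableOn (fun t => v n ⟨.inr x, t⟩) (G.cableInterval (.inr x)) := by
    intro n x
    refine Integrable.mono' (hind n x).integrableOn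
      (measurable_sigma_iff.1 (hvm n) (.inr x)).aestronglyMeasurable ?_
    refine (ae_restrict_iff' (G.isOpen_cableInterval _).measurableSet).2 (ae_of_all _ fun t ht => ?_)
    rw [Real.norm_eq_abs, abs_of_nonneg (sq_nonneg _)]
    exact hspur n x t ht
  have hspurB : ∀ n x, ∫ t in G.cableInterval (.inr x), v n ⟨.inr x, t⟩ ≤ ε x / (n + 1) := by
    intro n x
    have hε' := hε x
    calc ∫ t in G.cableInterval (.inr x), v n ⟨.inr x, t⟩
        ≤ ∫ t in G.cableInterval (.inr x), (Set.Ioc 0 (((n : ℕ) + 1 : ℝ) / ε x)).indicator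
          (fun _ => (ε x / (n + 1)) ^ 2) t := by
          refine setIntegral_mono_on (hspurI n x) (hind n x).integrableOn
            (G.isOpen_cableInterval _).measurableSet (hspur n x)
      _ ≤ ∫ t, (Set.Ioc 0 (((n : ℕ) + 1 : ℝ) / ε x)).indicator
          (fun _ => (ε x / (n + 1)) ^ 2) t :=
          setIntegral_le_integral (hind n x)
            (ae_of_all _ fun t => Set.indicator_nonneg (fun _ _ => sq_nonneg _) _)
      _ = ε x / (n + 1) := by
          rw [integral_indicator measurableSet_Ioc, setIntegral_const]
          have : (0 : ℝ) ≤ (n + 1) / ε x := by positivity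
          simp only [Measure.real, Real.volume_Ioc, sub_zero, ENNReal.toReal_ofReal this, smul_eq_mul]
          field_simp
  have hedgeV : ∀ n e, ∫ t in G.cableInterval (.inl e), v n ⟨.inl e, t⟩ = 2 * (G.weight e *
      ((b n (G.tgt e) - b n (G.src e)) - (a (G.tgt e) - a (G.src e))) ^ 2) := by
    intro n e
    have hl := G.edgeLength_pos e
    have hwt := G.weight_pos e
    rw [hedge, setIntegral_const]
    simp only [Measure.real, cableInterval, Sum.elim_inl, edgeInterval, Real.volume_Ioo, sub_zero,
      ENNReal.toReal_ofReal hl.le, smul_eq_mul]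
    field_simp
  have hnn : ∀ n i, 0 ≤ ∫ t in G.cableInterval i, v n ⟨i, t⟩ :=
    fun n i => integral_nonneg fun _ => sq_nonneg _
  have hsumE : ∀ n, Summable fun e => ∫ t in G.cableInterval (.inl e), v n ⟨.inl e, t⟩ := by
    intro n
    simp only [hedgeV]
    exact (hs n).mul_left 2
  have hsumV : ∀ n, Summable fun x => ∫ t in G.cableInterval (.inr x), v n ⟨.inr x, t⟩ := fun n =>
    (hc.summable.div_const ((n : ℝ) + 1)).of_nonneg_of_le (fun x => hnn n _) (hspurB n)
  have hvI : ∀ n, Integrable (v n) G.cableMeasure := by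
    intro n
    refine (integrable_cableMeasure_iff fun _ => sq_nonneg _).2 ⟨fun i => ?_,
      Summable.sum _ (hsumE n) (hsumV n)⟩
    rcases i with e | x
    · rw [hedge]
      exact integrableOn_const (by simp [cableInterval, edgeInterval])
    · exact hspurI n x
  have hbound : ∀ n : ℕ, ∫ p, v n p ∂G.cableMeasure ≤ 2 * (∑' e, G.weight e *
      ((b n (G.tgt e) - b n (G.src e)) - (a (G.tgt e) - a (G.src e))) ^ 2) + c / (n + 1) := by
    intro n
    have h1 := (hasSum_integral_cableMeasure (hvI n)).tsum_eq
    have h2 := Summable.tsum_sum (f := fun i => ∫ t in G.cableInterval i, v n ⟨i, t⟩) (hsumE n) (hsumV n)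
    rw [← h1, h2]
    simp only [hedgeV]
    rw [tsum_mul_left]
    gcongr
    rw [← (hc.div_const ((n : ℝ) + 1)).tsum_eq]
    exact (hsumV n).tsum_le_tsum (hspurB n) (hc.summable.div_const _)
  have hae : ∀ n, (fun p => (G.grad (u n) p - w p) ^ 2) =ᵐ[G.cableMeasure] v n := by
    intro n
    filter_upwards [grad_linExt (G := G) (a := b n) fun x => (hσpos n x).le] with p hp
    simp only [hv, hu, hp]
  -- The limit gradient is square integrable because it is at finite `L²` distance from that of `u
  -- 0`.
  have hwL : MemLp w 2 G.cableMeasure := by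
    have h1 := (huD 0).memLp_grad
    have h2 : MemLp (G.grad (u 0) - w) 2 G.cableMeasure := by
      rw [memLp_two_iff_integrable_sq
        ((measurable_grad G _).sub (measurable_linExtGrad _ _)).aestronglyMeasurable]
      exact (hvI 0).congr (hae 0).symm
    have := h1.sub h2
    rwa [sub_sub_cancel] at this
  refine isExtendedDirichlet_of_tendsto huD hwL ?_ ?_
  · refine squeeze_zero (fun n => integral_nonneg fun _ => sq_nonneg _)
      (fun n => (integral_congr_ae (hae n)).trans_le (hbound n)) ?_
    have : Tendsto (fun n : ℕ => c / ((n : ℝ) + 1)) atTop (𝓝 0) :=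
      tendsto_const_nhds.div_atTop (tendsto_atTop_add_const_right _ _ tendsto_natCast_atTop_atTop)
    simpa using (h0.const_mul 2).add this
  · intro z
    cases z with
    | vertex x => exact hlim x
    | onEdge e t => exact ((hlim _).add (((hlim _).sub (hlim _)).mul_const _))
    | onSpur x t =>
      refine (hlim x).mul ?_
      by_cases hx : G.killing x = 0
      · have : Tendsto (fun n : ℕ => ε x / ((n : ℝ) + 1)) atTop (𝓝 0) :=
          tendsto_const_nhds.div_atTop (tendsto_atTop_add_const_right _ _ tendsto_natCast_atTop_atTop)
        simp only [hσ, hx, if_true, mul_zero]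
        exact (tendsto_const_nhds (x := (0 : ℝ))).max
          (tendsto_const_nhds.sub (this.mul_const _))
      · simp only [hσ, hx, if_false]
        exact tendsto_const_nhds

end MassiveGraph

/-! ### Energies against piecewise linear functions and tents -/

namespace MassiveGraph

variable {V E : Type*} {G : MassiveGraph V E}

theorem integral_grad_edge [Countable V] [Countable E] {u : G.Cable → ℝ} (hu : G.IsDirichlet u)
    (e : E) : ∫ t in G.cableInterval (.inl e), G.grad u ⟨.inl e, t⟩ =
      u (.vertex (G.tgt e)) - u (.vertex (G.src e)) := by
  have hl := G.edgeLength_pos e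
  have h := hu.sub_eq_integral (i := .inl e) (s := 0) (t := 1 / (2 * G.weight e))
    ⟨le_rfl, hl.le⟩ ⟨hl.le, le_rfl⟩
  rw [intervalIntegral.integral_of_le hl.le, integral_Ioc_eq_integral_Ioo] at h
  change u (G.edgePoint e _) - u (G.edgePoint e 0) = _ at h
  rw [edgePoint_zero, edgePoint_length] at h
  exact h.symm

/-- A continuous function on the cable system exploding at the open ends of the killed cables. -/
noncomputable def spurDepth (G : MassiveGraph V E) : G.Cable → ℝ
  | .onSpur x t => 1 / (1 - 2 * G.killing x * t) - 1
  | _ => 0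

theorem spurDepth_spurPoint (x : V) {t : ℝ} (ht : t ∈ G.closedInterval (.inr x)) :
    G.spurDepth (G.cablePoint (.inr x) t) = 1 / (1 - 2 * G.killing x * t) - 1 := by
  have ht0 : 0 ≤ t := ht.1
  change G.spurDepth (G.spurPoint x t) = _
  rcases ht0.eq_or_lt with rfl | h0
  · rw [spurPoint_zero]
    simp [spurDepth]
  · rw [spurPoint_of_mem (show t ∈ G.spurInterval x from ⟨h0, ht.2⟩)]
    rfl

theorem continuous_spurDepth : Continuous G.spurDepth := by
  refine continuous_cable_iff.2 fun i => ?_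
  rcases i with e | x
  · refine ContinuousOn.congr (f := fun t : ℝ => 0) continuousOn_const fun t ht => ?_
    change G.spurDepth (G.edgePoint e t) = 0
    unfold edgePoint
    split_ifs <;> rfl
  · refine ContinuousOn.congr (f := fun t : ℝ => 1 / (1 - 2 * G.killing x * t) - 1) ?_
      fun t ht => spurDepth_spurPoint x ht
    refine ContinuousOn.sub (ContinuousOn.div continuousOn_const (by fun_prop) fun t ht => ?_)
      continuousOn_const
    have := ht.2
    exact ne_of_gt (by linarith)

/-- The open end of a killed cable is at infinity in the cable system, since `spurDepth` is
continuous and explodes there. Functions in the domain therefore vanish at that end, and the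
gradient integrates to minus the value at the vertex. -/
theorem integral_grad_spur [Countable V] [Countable E] {u : G.Cable → ℝ} (hu : G.IsDirichlet u)
    {x : V} (hx : G.killing x ≠ 0) :
    ∫ t in G.cableInterval (.inr x), G.grad u ⟨.inr x, t⟩ = -u (.vertex x) := by
  have hκ : 0 < G.killing x := lt_of_le_of_ne (G.killing_nonneg x) (Ne.symm hx)
  set B := 1 / (2 * G.killing x) with hB
  have hB0 : 0 < B := by positivity
  have hI : G.cableInterval (.inr x) = Set.Ioo 0 B := by
    ext t
    refine and_congr_right fun _ => ?_
    rw [hB, lt_div_iff₀ (by positivity), mul_comm]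
  have hJ : ∀ t, 0 ≤ t → t < B → t ∈ G.closedInterval (.inr x) := by
    intro t h0 h1
    refine ⟨h0, ?_⟩
    rw [hB, lt_div_iff₀ (by positivity)] at h1
    linarith
  have hint : IntervalIntegrable (fun t => G.grad u ⟨.inr x, t⟩) volume 0 B := by
    have h := MemLp_two_cable hu.memLp_grad (.inr x)
    rw [intervalIntegrable_iff_integrableOn_Ioo_of_le hB0.le]
    rw [hI] at h
    have : IsFiniteMeasure (volume.restrict (Set.Ioo 0 B)) := ⟨by simp⟩
    exact h.integrable one_le_two
  rw [hI, ← integral_Ioc_eq_integral_Ioo, ← intervalIntegral.integral_of_le hB0.le]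
  have hne : (𝓝[Set.Ioo 0 B] B).NeBot := by
    rw [nhdsWithin_Ioo_eq_nhdsLT hB0]
    infer_instance
  have h1 : Tendsto (fun t => ∫ r in (0 : ℝ)..t, G.grad u ⟨.inr x, r⟩) (𝓝[Set.Ioo 0 B] B)
      (𝓝 (∫ r in (0 : ℝ)..B, G.grad u ⟨.inr x, r⟩)) := by
    have := intervalIntegral.continuousOn_primitive_interval' (μ := volume) hint (a := 0) (by simp)
    have h2 := this B (by simp)
    rw [Set.uIcc_of_le hB0.le] at h2
    exact h2.mono_left (nhdsWithin_mono _ Set.Ioo_subset_Icc_self)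
  refine tendsto_nhds_unique h1 ?_
  have hr : Tendsto (fun t => G.spurDepth (G.cablePoint (.inr x) t)) (𝓝[Set.Ioo 0 B] B) atTop := by
    have h3 : Tendsto (fun t : ℝ => 1 / (1 - 2 * G.killing x * t) - 1) (𝓝[Set.Ioo 0 B] B) atTop := by
      refine tendsto_atTop_add_const_right _ _ ?_
      simp only [one_div]
      refine tendsto_inv_nhdsGT_zero.comp (tendsto_nhdsWithin_iff.2 ⟨?_, ?_⟩)
      · have hc : Continuous fun t : ℝ => 1 - 2 * G.killing x * t := by fun_prop
        have := hc.tendsto B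
        have e : 1 - 2 * G.killing x * B = 0 := by
          rw [hB]
          field_simp
          ring
        rw [e] at this
        exact this.mono_left nhdsWithin_le_nhds
      · filter_upwards [self_mem_nhdsWithin] with t ht
        have := (hJ t ht.1.le ht.2).2
        exact sub_pos.2 this
    refine h3.congr' ?_
    filter_upwards [self_mem_nhdsWithin] with t ht
    exact (spurDepth_spurPoint x (hJ t ht.1.le ht.2)).symm
  have h4 := (hu.tendsto_zero continuous_spurDepth hr).sub_const (u (.vertex x))
  rw [zero_sub] at h4
  refine h4.congr' ?_
  filter_upwards [self_mem_nhdsWithin] with t ht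
  rw [← hu.sub_eq_integral (hJ 0 le_rfl hB0) (hJ t ht.1.le ht.2)]
  congr 2
  exact (spurPoint_zero x).symm

/-- The gradient of the extension is constant on each cable, so its pairing with the gradient of `u`
only involves values of `u` at vertices: the energy reduces to the discrete Dirichlet form of the
massive graph. -/
theorem hasSum_energy_linExt [Countable V] [Countable E] {a : V → ℝ}
    (ha : G.IsExtendedDirichlet (G.linExt a fun x => 2 * G.killing x)) {u : G.Cable → ℝ}
    (hu : G.IsDirichlet u) :
    HasSum (Sum.elim
      (fun e => G.weight e * (a (G.tgt e) - a (G.src e)) *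
        (u (.vertex (G.tgt e)) - u (.vertex (G.src e))))
      fun x => G.killing x * a x * u (.vertex x))
      (G.energy (G.linExt a fun x => 2 * G.killing x) u) := by
  have hκ : ∀ x, 0 ≤ 2 * G.killing x := fun x => mul_nonneg zero_le_two (G.killing_nonneg x)
  rw [energy_eq_integral ha.memLp_grad hu.memLp_grad]
  have h := (hasSum_integral_cableMeasure (ha.memLp_grad.integrable_mul hu.memLp_grad)).mul_left (1 / 2)
  refine HasSum.congr_fun h fun i => ?_
  have hae := ae_cableMeasure_iff.1 (grad_linExt (G := G) (a := a) hκ) i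
  have e1 : ∫ t in G.cableInterval i, (G.grad (G.linExt a fun x => 2 * G.killing x) * G.grad u) ⟨i, t⟩ =
      ∫ t in G.cableInterval i, G.linExtGrad a (fun x => 2 * G.killing x) ⟨i, t⟩ * G.grad u ⟨i, t⟩ := by
    refine integral_congr_ae ?_
    filter_upwards [hae] with t ht
    rw [Pi.mul_apply, ht]
  rw [e1]
  rcases i with e | x
  · simp only [linExtGrad, Sum.elim_inl]
    rw [integral_const_mul, integral_grad_edge hu]
    ring
  · simp only [Sum.elim_inr]
    by_cases hx : G.killing x = 0
    · simp [linExtGrad, hx]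
    · have hpos : 0 < 2 * G.killing x := lt_of_le_of_ne (hκ x) (mul_ne_zero two_ne_zero hx).symm
      rw [setIntegral_congr_fun (g := fun t => -(a x * (2 * G.killing x)) * G.grad u ⟨.inr x, t⟩)
        (G.isOpen_cableInterval _).measurableSet, integral_const_mul, integral_grad_spur hu hx]
      · ring
      · intro t ht
        have : t < 1 / (2 * G.killing x) := by
          rw [lt_div_iff₀ hpos, mul_comm]
          exact ht.2
        simp only [linExtGrad]
        rw [Set.indicator_of_mem (show t ∈ Set.Iio (1 / (2 * G.killing x)) from this)]

/-- The piecewise linear function on the real line with slopes `±1`, supported in `[l, r]`. -/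
noncomputable def tent (l r : ℝ) (t : ℝ) : ℝ := max 0 ((r - l) / 2 - |t - (l + r) / 2|)

theorem tent_of_le {l r t : ℝ} (h : t ≤ l) : tent l r t = 0 := by
  refine max_eq_left ?_
  have := neg_le_abs (t - (l + r) / 2)
  linarith

theorem tent_of_ge {l r t : ℝ} (h : r ≤ t) : tent l r t = 0 := by
  refine max_eq_left ?_
  have := le_abs_self (t - (l + r) / 2)
  linarith

theorem tent_left {l r t : ℝ} (h1 : l ≤ t) (h2 : t ≤ (l + r) / 2) : tent l r t = t - l := by
  rw [tent, abs_of_nonpos (by linarith), max_eq_right (by linarith)]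
  ring

theorem tent_right {l r t : ℝ} (h1 : (l + r) / 2 ≤ t) (h2 : t ≤ r) : tent l r t = r - t := by
  rw [tent, abs_of_nonneg (by linarith), max_eq_right (by linarith)]
  ring

theorem lipschitzWith_tent (l r : ℝ) : LipschitzWith 1 (tent l r) := by
  refine LipschitzWith.of_dist_le_mul fun s t => ?_
  rw [Real.dist_eq, Real.dist_eq, NNReal.coe_one, one_mul, tent, tent, max_comm, max_comm 0]
  refine (abs_max_sub_max_le_abs _ _ _).trans ?_
  have := abs_abs_sub_abs_le_abs_sub (t - (l + r) / 2) (s - (l + r) / 2)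
  have e : (r - l) / 2 - |s - (l + r) / 2| - ((r - l) / 2 - |t - (l + r) / 2|) =
    |t - (l + r) / 2| - |s - (l + r) / 2| := by ring
  rw [e]
  refine this.trans_eq ?_
  rw [← abs_neg]
  congr 1
  ring

/-- A tent function on the cable of an edge represents the displacement of the midpoint. -/
theorem represents_tent [Countable V] [Countable E] {e : E} {l r : ℝ} (hl : 0 ≤ l) (hlr : l < r)
    (hr : r ≤ 1 / (2 * G.weight e)) :
    G.Represents (G.edgeBump e (tent l r)) (Finsupp.single (G.edgePoint e ((l + r) / 2)) 1 -
      ((1 / 2 : ℝ) • Finsupp.single (G.edgePoint e l) 1 +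
        (1 / 2 : ℝ) • Finsupp.single (G.edgePoint e r) 1)) := by
  have h0 : ∀ t ≤ 0, tent l r t = 0 := fun t ht => tent_of_le (ht.trans hl)
  have h1 : ∀ t, 1 / (2 * G.weight e) ≤ t → tent l r t = 0 :=
    fun t ht => tent_of_ge (hr.trans ht)
  refine ⟨(isDirichlet_edgeBump (lipschitzWith_tent l r) h0 h1).isExtendedDirichlet, fun u hu => ?_⟩
  rw [energy_edgeBump (lipschitzWith_tent l r) h0 h1 hu]
  simp only [map_sub, map_add, map_smul, Finsupp.linearCombination_single, one_smul]
  set m := (l + r) / 2 with hm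
  have hlm : l < m := by linarith
  have hmr : m < r := by linarith
  have hmem : ∀ t, l ≤ t → t ≤ r → t ∈ G.closedInterval (.inl e) :=
    fun t h1 h2 => ⟨hl.trans h1, h2.trans hr⟩
  have hL := hu.sub_eq_integral (hmem l le_rfl hlr.le) (hmem m hlm.le hmr.le)
  have hR := hu.sub_eq_integral (hmem m hlm.le hmr.le) (hmem r hlr.le le_rfl)
  have hi := MemLp_two_cable hu.memLp_grad (.inl e)
  have hii : IntegrableOn (fun t => G.grad u ⟨.inl e, t⟩) (G.edgeInterval e) := by
    have : IsFiniteMeasure (volume.restrict (G.cableInterval (.inl e))) :=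
      ⟨by simp [cableInterval, edgeInterval]⟩
    exact hi.integrable one_le_two
  have hne : ∀ᵐ t : ℝ, t ∉ ({l, m, r} : Set ℝ) := by
    have : ({l, m, r} : Set ℝ).Countable := (Set.toFinite _).countable
    exact this.ae_notMem _
  -- Off the three kinks the tent has slope 1 on the left half of `[l, r]`, slope -1 on the right
  -- half, and 0 outside, so the pairing is the difference of the two increments of `u`.
  have hae : (fun t => deriv (tent l r) t * G.grad u ⟨.inl e, t⟩) =ᵐ[volume]
      fun t => (Set.Ioo l m).indicator (fun t => G.grad u ⟨.inl e, t⟩) t -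
        (Set.Ioo m r).indicator (fun t => G.grad u ⟨.inl e, t⟩) t := by
    filter_upwards [hne] with t ht
    simp only [Set.mem_insert_iff, Set.mem_singleton_iff, not_or] at ht
    obtain ⟨n1, n2, n3⟩ := ht
    rcases lt_or_gt_of_ne n1 with h | hl'
    · have : tent l r =ᶠ[𝓝 t] fun _ => 0 := by
        filter_upwards [Iio_mem_nhds h] with s hs using tent_of_le (le_of_lt hs)
      rw [this.deriv_eq, Set.indicator_of_notMem fun h' => absurd h'.1 (not_lt.2 h.le),
        Set.indicator_of_notMem fun h' => absurd h'.1 (not_lt.2 (h.trans hlm).le)]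
      simp
    rcases lt_or_gt_of_ne n2 with h | hm'
    · have : tent l r =ᶠ[𝓝 t] fun s => s - l := by
        filter_upwards [Ioo_mem_nhds hl' h] with s hs using tent_left hs.1.le hs.2.le
      rw [this.deriv_eq, Set.indicator_of_mem (show t ∈ Set.Ioo l m from ⟨hl', h⟩),
        Set.indicator_of_notMem fun h' => absurd h'.1 (not_lt.2 h.le)]
      simp
    rcases lt_or_gt_of_ne n3 with h | hr'
    · have : tent l r =ᶠ[𝓝 t] fun s => r - s := by
        filter_upwards [Ioo_mem_nhds hm' h] with s hs using tent_right hs.1.le hs.2.le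
      rw [this.deriv_eq, Set.indicator_of_notMem fun h' => absurd h'.2 (not_lt.2 hm'.le),
        Set.indicator_of_mem (show t ∈ Set.Ioo m r from ⟨hm', h⟩)]
      simp
    · have : tent l r =ᶠ[𝓝 t] fun _ => 0 := by
        filter_upwards [Ioi_mem_nhds hr'] with s hs using tent_of_ge (le_of_lt hs)
      rw [this.deriv_eq, Set.indicator_of_notMem fun h' => absurd h'.2 (not_lt.2 hm'.le),
        Set.indicator_of_notMem fun h' => absurd h'.2 (not_lt.2 hr'.le)]
      simp
  have s1 : Set.Ioo l m ⊆ G.edgeInterval e := Set.Ioo_subset_Ioo hl (hmr.le.trans hr)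
  have s2 : Set.Ioo m r ⊆ G.edgeInterval e := Set.Ioo_subset_Ioo (hl.trans hlm.le) hr
  rw [integral_congr_ae (ae_restrict_of_ae hae), integral_sub
    (hii.indicator measurableSet_Ioo) (hii.indicator measurableSet_Ioo),
    setIntegral_indicator measurableSet_Ioo, setIntegral_indicator measurableSet_Ioo,
    Set.inter_eq_right.2 s1, Set.inter_eq_right.2 s2, ← integral_Ioc_eq_integral_Ioo,
    ← integral_Ioc_eq_integral_Ioo, ← intervalIntegral.integral_of_le hlm.le,
    ← intervalIntegral.integral_of_le hmr.le, ← hL, ← hR]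
  simp only [smul_eq_mul]
  change 1 / 2 * (u (G.edgePoint e m) - u (G.edgePoint e l) - (u (G.edgePoint e r) - u (G.edgePoint e m))) = _
  ring

end MassiveGraph

/-! ### Levels of a subtree as lists of fixed length -/

/-- The lists of a given length over a finite alphabet. -/
def listsOfLength (d : ℕ) : ℕ → Finset (List (Fin d))
  | 0 => {[]}
  | n + 1 => (Finset.univ ×ˢ listsOfLength d n).map
    ⟨fun q : Fin d × List (Fin d) => q.1 :: q.2, fun q q' h => by
      simpa [Prod.ext_iff] using h⟩

theorem mem_listsOfLength {d n : ℕ} {m : List (Fin d)} : m ∈ listsOfLength d n ↔ m.length = n := by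
  induction n generalizing m with
  | zero => simp [listsOfLength]
  | succ n ih =>
    cases m with
    | nil => simp [listsOfLength]
    | cons a m =>
      rw [listsOfLength, Finset.mem_map]
      constructor
      · rintro ⟨⟨b, k⟩, hk, h⟩
        obtain ⟨rfl, rfl⟩ := List.cons.inj h
        rw [List.length_cons, ih.1 (Finset.mem_product.1 hk).2]
      · intro h
        exact ⟨(a, m), Finset.mem_product.2 ⟨Finset.mem_univ _, ih.2 (by simpa using h)⟩, rfl⟩

theorem sum_listsOfLength_succ {d n : ℕ} (g : List (Fin d) → ℝ) :
    ∑ m ∈ listsOfLength d (n + 1), g m = ∑ m ∈ listsOfLength d n, ∑ a, g (a :: m) := by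
  rw [listsOfLength, Finset.sum_map, Finset.sum_product_right]
  rfl

theorem card_listsOfLength (d n : ℕ) : (listsOfLength d n).card = d ^ n := by
  induction n with
  | zero => simp [listsOfLength]
  | succ n ih => rw [listsOfLength, Finset.card_map, Finset.card_product, ih, pow_succ']; simp

/-- The lists of length less than `n` over a finite alphabet. -/
def listsBelow (d n : ℕ) : Finset (List (Fin d)) := (Finset.range n).biUnion (listsOfLength d)

theorem mem_listsBelow {d n : ℕ} {m : List (Fin d)} : m ∈ listsBelow d n ↔ m.length < n := by
  simp [listsBelow, mem_listsOfLength]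

theorem sum_listsBelow {d n : ℕ} (g : List (Fin d) → ℝ) :
    ∑ m ∈ listsBelow d n, g m = ∑ j ∈ Finset.range n, ∑ m ∈ listsOfLength d j, g m := by
  refine Finset.sum_biUnion fun i _ j _ hij => Finset.disjoint_left.2 fun m hi hj => hij ?_
  rw [← mem_listsOfLength.1 hi, ← mem_listsOfLength.1 hj]

theorem tendsto_listsBelow (d : ℕ) : Tendsto (listsBelow d) atTop atTop :=
  tendsto_atTop_finset_of_monotone
    (fun _ _ h _ hm => mem_listsBelow.2 ((mem_listsBelow.1 hm).trans_le h))
    fun m => ⟨m.length + 1, mem_listsBelow.2 (Nat.lt_succ_self _)⟩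

theorem summable_lists_of_sum_le {d : ℕ} {g : List (Fin d) → ℝ} (hg : ∀ m, 0 ≤ g m) {B : ℝ}
    (h : ∀ n, ∑ j ∈ Finset.range n, ∑ m ∈ listsOfLength d j, g m ≤ B) :
    Summable g ∧ ∑' m, g m ≤ B := by
  have hs : ∀ s : Finset (List (Fin d)), ∑ m ∈ s, g m ≤ B := by
    intro s
    obtain ⟨n, hn⟩ := ((tendsto_listsBelow d).eventually_ge_atTop s).exists
    refine (Finset.sum_le_sum_of_subset_of_nonneg hn fun m _ _ => hg m).trans ?_
    rw [sum_listsBelow]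
    exact h n
  exact ⟨summable_of_sum_le hg hs, Real.tsum_le_of_sum_le hg hs⟩

/-! ### Return probability and hitting functions of subtrees -/

/-- The probability that the walk on the tree started at a child ever visits the parent. -/
noncomputable def returnRatio (d : ℕ) (α : ℝ) : ℝ := (max 1 (d * α))⁻¹

section returnRatio

variable (d : ℕ) (α : ℝ)

theorem returnRatio_pos : 0 < returnRatio d α := by
  unfold returnRatio
  positivity

theorem returnRatio_le_one : returnRatio d α ≤ 1 := inv_le_one_of_one_le₀ (le_max_left _ _)

theorem mul_returnRatio_le_one : d * α * returnRatio d α ≤ 1 := by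
  have h : (0 : ℝ) < max 1 (d * α) := by positivity
  rw [returnRatio, ← div_eq_mul_inv, div_le_one h]
  exact le_max_right _ _

/-- Either `p = 1` (when `d α ≤ 1`) or `d α p = 1`. This single identity covers both regimes and
expresses that `p ^ depth` is harmonic: the flow through the edge to the parent equals the flow
through the `d` edges to the children. -/
theorem one_sub_returnRatio_mul :
    (1 - returnRatio d α) * (d * α * returnRatio d α) = 1 - returnRatio d α := by
  unfold returnRatio
  rcases le_total (d * α) 1 with h | h
  · rw [max_eq_left h]
    simp
  · rw [max_eq_right h, mul_inv_cancel₀ (by linarith), mul_one]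

theorem one_sub_returnRatio_mul_eq :
    (1 - returnRatio d α) * (d * α) = (returnRatio d α)⁻¹ - 1 := by
  have h := one_sub_returnRatio_mul d α
  have hp := (returnRatio_pos d α).ne'
  field_simp
  linarith

end returnRatio

/-- The hitting probabilities of the vertex `some y`, for walks started in its subtree. -/
noncomputable def subtreeFun (d : ℕ) (p : ℝ) (y : Fin (d + 1) × List (Fin d)) : TreeVertex d → ℝ
  | none => 0
  | some z => open Classical in
    if z.1 = y.1 ∧ y.2 <:+ z.2 then p ^ (z.2.length - y.2.length) else 0

theorem subtreeFun_append {d : ℕ} (p : ℝ) (i : Fin (d + 1)) (l m : List (Fin d)) :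
    subtreeFun d p (i, l) (some (i, m ++ l)) = p ^ m.length := by
  simp [subtreeFun]

theorem subtreeFun_parent {d : ℕ} (p : ℝ) (y : Fin (d + 1) × List (Fin d)) :
    subtreeFun d p y (treeParent y) = 0 := by
  rcases y with ⟨i, _ | ⟨a, l⟩⟩
  · rfl
  · simp only [treeParent, subtreeFun]
    rw [if_neg]
    rintro ⟨_, h⟩
    simpa using h.length_le

theorem subtreeFun_of_not_suffix {d : ℕ} (p : ℝ) {y z : Fin (d + 1) × List (Fin d)}
    (h : ¬(z.1 = y.1 ∧ y.2 <:+ z.2)) :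
    subtreeFun d p y (some z) = 0 ∧ subtreeFun d p y (treeParent z) = 0 := by
  refine ⟨by simp only [subtreeFun]; rw [if_neg h], ?_⟩
  rcases z with ⟨j, _ | ⟨a, k⟩⟩
  · rfl
  · simp only [treeParent, subtreeFun]
    rw [if_neg]
    rintro ⟨h1, h2⟩
    exact h ⟨h1, h2.trans (List.suffix_cons a k)⟩

/-- Functions of the edges vanishing outside the subtree of `some (i, l)` are sums over lists. -/
theorem appendEdge_injective {d : ℕ} (i : Fin (d + 1)) (l : List (Fin d)) :
    Function.Injective fun m : List (Fin d) => (i, m ++ l) := by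
  intro m m' h
  simpa using h

theorem notMem_range_appendEdge {d : ℕ} {i : Fin (d + 1)} {l : List (Fin d)}
    {e : Fin (d + 1) × List (Fin d)} (h : e ∉ Set.range fun m : List (Fin d) => (i, m ++ l)) :
    ¬(e.1 = (i, l).1 ∧ (i, l).2 <:+ e.2) := by
  rintro ⟨h1, m, h2⟩
  exact h ⟨m, Prod.ext h1.symm h2⟩

theorem finite_treeGeneration_le (d n : ℕ) : {z : TreeVertex d | treeGeneration z ≤ n}.Finite := by
  have h1 : {k : List (Fin d) | k.length ≤ n}.Finite := List.finite_length_le _ _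
  refine (((Set.finite_univ (α := Fin (d + 1))).prod h1).image some |>.insert none).subset ?_
  rintro (_ | ⟨i, k⟩) h
  · exact Or.inl rfl
  · refine Or.inr ⟨(i, k), ⟨Set.mem_univ _, ?_⟩, rfl⟩
    have : k.length + 1 ≤ n := h
    change k.length ≤ n
    omega

/-! ### The hitting functions belong to the extended Dirichlet space -/

section tree

variable {d : ℕ} {α : ℝ} (hα : 0 < α)

open MassiveGraph

/-- The generation extends to a continuous function, linear on edges and constant (slope 0) on the
cables of vertices. It is bounded on compact sets, so large generations are near infinity. -/
theorem weightedTree_tendsto_zero {u : (weightedTree d α hα).Cable → ℝ}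
    (hu : (weightedTree d α hα).IsDirichlet u) :
    Tendsto (fun z => u (.vertex z)) (comap treeGeneration atTop) (𝓝 0) := by
  refine hu.tendsto_zero (continuous_linExt (fun z => (treeGeneration z : ℝ)) 0) ?_
  exact tendsto_natCast_atTop_atTop.comp tendsto_comap

theorem killing_weightedTree_some (e : Fin (d + 1) × List (Fin d)) :
    (weightedTree d α hα).killing (some e) = 0 := by
  simp [weightedTree]

theorem killing_subtreeFun {p : ℝ} (y : Fin (d + 1) × List (Fin d)) (z : TreeVertex d) :
    (weightedTree d α hα).killing z * subtreeFun d p y z = 0 := by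
  cases z with
  | none => simp [subtreeFun]
  | some e => rw [killing_weightedTree_some, zero_mul]

/-- The function is cut off by a factor falling linearly from 1 to 0 over the generations `0, …, N +
1`. A level at relative depth `j + 1` contributes, up to a constant, `(d α p) ^ j * p ^ j` times a
squared increment, and `d α p ≤ 1`. If `p < 1`, the factor `p ^ j` makes the sum converge; if `p =
1`, only the increments of the ramp remain, and they telescope. In both cases the error is `O(1 /
N)`. -/
theorem isExtendedDirichlet_subtreeFun (hd : 0 < d) (y : Fin (d + 1) × List (Fin d)) :
    (weightedTree d α hα).IsExtendedDirichlet ((weightedTree d α hα).linExt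
      (subtreeFun d (returnRatio d α) y) fun x => 2 * (weightedTree d α hα).killing x) := by
  obtain ⟨i, l⟩ := y
  set p := returnRatio d α with hp
  have hp0 : 0 < p := returnRatio_pos d α
  have hp1 : p ≤ 1 := returnRatio_le_one d α
  set q : ℕ → ℕ → ℝ := fun N k => min 1 (k / (N + 1)) with hq
  set a := subtreeFun d p (i, l) with ha
  have ha0 : ∀ z, 0 ≤ a z := by
    rintro (_ | z)
    · exact le_rfl
    · simp only [ha, subtreeFun]
      split_ifs <;> positivity
  have ha1 : ∀ z, a z ≤ 1 := by
    rintro (_ | z)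
    · exact zero_le_one
    · simp only [ha, subtreeFun]
      split_ifs
      · exact pow_le_one₀ hp0.le hp1
      · exact zero_le_one
  have hq0 : ∀ N k, 0 ≤ q N k := fun N k => le_min zero_le_one (by positivity)
  have hq1 : ∀ N k, q N k ≤ 1 := fun N k => min_le_left _ _
  have hqle : ∀ N k, q N k ≤ k / (N + 1) := fun N k => min_le_right _ _
  have hqmono : ∀ N k, q N k ≤ q N (k + 1) := by
    intro N k
    refine min_le_min le_rfl ?_
    gcongr
    simp
  have hqdiff : ∀ N k, q N (k + 1) - q N k ≤ 1 / (N + 1) := by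
    intro N k
    have h0 : (0 : ℝ) < N + 1 := by positivity
    have h1 : q N (k + 1) ≤ (k + 1 : ℝ) / (N + 1) := by simpa using hqle N (k + 1)
    rcases le_total 1 ((k : ℝ) / (N + 1)) with h | h
    · have : q N k = 1 := min_eq_left h
      have := hq1 N (k + 1)
      have : (0 : ℝ) ≤ 1 / (N + 1) := by positivity
      linarith
    · have : q N k = k / (N + 1) := min_eq_right h
      rw [this]
      rw [add_div] at h1
      linarith
  -- the constant in the error bound
  obtain ⟨C, hC0, hC⟩ : ∃ C : ℝ, 0 ≤ C ∧ ∀ n, ∑ j ∈ Finset.range n,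
      (1 - p) ^ 2 * (p ^ j * (l.length + j + 2)) ≤ C := by
    rcases hp1.eq_or_lt with h | h
    · exact ⟨0, le_rfl, fun n => by simp [h]⟩
    · have hs : Summable fun j : ℕ => (1 - p) ^ 2 * (p ^ j * (l.length + j + 2)) := by
        refine Summable.mul_left _ ?_
        have h1 : Summable fun j : ℕ => (j : ℝ) ^ 1 * p ^ j :=
          summable_pow_mul_geometric_of_norm_lt_one 1 (by rwa [Real.norm_of_nonneg hp0.le])
        have h2 := (summable_geometric_of_lt_one hp0.le h).mul_right ((l.length : ℝ) + 2)
        exact (h1.add h2).congr fun j => by ring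
      exact ⟨_, tsum_nonneg fun j => by positivity, fun n =>
        hs.sum_le_tsum _ fun j _ => by positivity⟩
  set K := α ^ l.length * (l.length + 1) + α ^ (l.length + 1) * d * (2 + 2 * C) with hK
  set f : ℕ → Fin (d + 1) × List (Fin d) → ℝ := fun N e => (weightedTree d α hα).weight e *
    ((a (some e) * (1 - q N (treeGeneration (some e))) -
      a (treeParent e) * (1 - q N (treeGeneration (treeParent e)))) -
      (a (some e) - a (treeParent e))) ^ 2 with hf
  have hf0 : ∀ N e, e ∉ Set.range (fun m : List (Fin d) => (i, m ++ l)) → f N e = 0 := by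
    intro N e he
    obtain ⟨h1, h2⟩ := subtreeFun_of_not_suffix p (notMem_range_appendEdge he)
    simp only [hf, ha, h1, h2]
    ring
  have hnil : ∀ N, f N (i, [] ++ l) = α ^ l.length * q N (l.length + 1) ^ 2 := by
    intro N
    have h1 : a (some (i, [] ++ l)) = 1 := by simpa using subtreeFun_append p i l []
    have h2 : a (treeParent (i, l)) = 0 := subtreeFun_parent p (i, l)
    have h3 : treeGeneration (treeParent (i, l)) = l.length := by
      have h4 := treeGeneration_parent (i, l)
      have h5 : treeGeneration (some (i, l)) = l.length + 1 := rfl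
      omega
    have h5 : treeGeneration (some (i, l)) = l.length + 1 := rfl
    simp only [hf, h1]
    simp only [List.nil_append, h2, weightedTree, h3, h5]
    ring
  -- Discrete product rule: with `j = m.length`, the increment `p ^ (j + 1) * q' - p ^ j * q` equals
  -- `p ^ j * (p * (q' - q) - (1 - p) * q)`, a slope term and a decay term.
  have hcons : ∀ N b (m : List (Fin d)), f N (i, b :: m ++ l) = α ^ (l.length + 1) *
      (α ^ m.length * p ^ m.length * p ^ m.length) *
      (p * (q N (l.length + m.length + 2) - q N (l.length + m.length + 1)) -
        (1 - p) * q N (l.length + m.length + 1)) ^ 2 := by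
    intro N b m
    have h1 : a (some (i, b :: m ++ l)) = p ^ (m.length + 1) := by
      simpa using subtreeFun_append p i l (b :: m)
    have h2 : a (some (i, m ++ l)) = p ^ m.length := subtreeFun_append p i l m
    simp only [hf, h1]
    simp only [List.cons_append, treeParent, h2, weightedTree, treeGeneration, List.length_cons,
      List.length_append]
    rw [show m.length + l.length + 1 + 1 = l.length + m.length + 2 by ring,
      show m.length + l.length + 1 = l.length + m.length + 1 by ring]
    ring
  have hlevel : ∀ N j, ∑ m ∈ listsOfLength d (j + 1), f N (i, m ++ l) ≤ α ^ (l.length + 1) * d *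
      (2 / (N + 1) * (q N (l.length + (j + 1) + 1) - q N (l.length + j + 1)) +
        2 / (N + 1) * ((1 - p) ^ 2 * (p ^ j * (l.length + j + 2)))) := by
    intro N j
    rw [sum_listsOfLength_succ]
    set t := (p * (q N (l.length + j + 2) - q N (l.length + j + 1)) -
        (1 - p) * q N (l.length + j + 1)) ^ 2 with ht
    have e1 : ∑ m ∈ listsOfLength d j, ∑ b, f N (i, b :: m ++ l) =
        α ^ (l.length + 1) * d * ((d * α * p) ^ j * (p ^ j * t)) := by
      have : ∀ m ∈ listsOfLength d j, ∑ b, f N (i, b :: m ++ l) =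
          d * (α ^ (l.length + 1) * (α ^ j * p ^ j * p ^ j) * t) := by
        intro m hm
        simp only [hcons, mem_listsOfLength.1 hm, Finset.sum_const, Finset.card_univ,
          Fintype.card_fin, nsmul_eq_mul, ← ht]
      rw [Finset.sum_congr rfl this, Finset.sum_const, card_listsOfLength, nsmul_eq_mul]
      push_cast
      ring
    rw [e1]
    have hN : (0 : ℝ) < N + 1 := by positivity
    refine mul_le_mul_of_nonneg_left ?_ (by positivity)
    have h1 : (d * α * p) ^ j ≤ 1 := pow_le_one₀ (by positivity) (mul_returnRatio_le_one d α)
    have ht0 : 0 ≤ t := sq_nonneg _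
    have h2 : (d * α * p) ^ j * (p ^ j * t) ≤ p ^ j * t :=
      mul_le_of_le_one_left (by positivity) h1
    refine h2.trans ?_
    set D := q N (l.length + j + 2) - q N (l.length + j + 1) with hD
    have hD0 : 0 ≤ D := sub_nonneg.2 (hqmono N _)
    have hD1 : D ≤ 1 / (N + 1) := hqdiff N _
    have hDD : D ^ 2 ≤ 1 / (N + 1) * D := by rw [sq]; exact mul_le_mul_of_nonneg_right hD1 hD0
    set Q := q N (l.length + j + 1) with hQ
    have hQ2 : Q ^ 2 ≤ (l.length + j + 2) / (N + 1) := by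
      have h3 : Q ^ 2 ≤ Q := by
        rw [sq]; exact mul_le_of_le_one_left (hq0 N _) (hq1 N _)
      have h4 := hqle N (l.length + j + 1)
      push_cast at h4
      refine h3.trans (h4.trans ?_)
      gcongr
      norm_num
    have ht1 : t ≤ 2 * (p * D) ^ 2 + 2 * ((1 - p) * Q) ^ 2 := by
      rw [ht]
      nlinarith [sq_nonneg (p * D + (1 - p) * Q)]
    have hpj : p ^ j ≤ 1 := pow_le_one₀ hp0.le hp1
    have hpj0 : 0 < p ^ j := by positivity
    calc p ^ j * t ≤ p ^ j * (2 * (p * D) ^ 2 + 2 * ((1 - p) * Q) ^ 2) := by gcongr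
      _ = (p ^ j * p ^ 2) * (2 * D ^ 2) + 2 * ((1 - p) ^ 2 * p ^ j) * Q ^ 2 := by ring
      _ ≤ 1 * (2 * (1 / (N + 1) * D)) +
          2 * ((1 - p) ^ 2 * p ^ j) * ((l.length + j + 2) / (N + 1)) := by
          gcongr
          exact mul_le_one₀ hpj (by positivity) (pow_le_one₀ hp0.le hp1)
      _ = _ := by
          rw [hD, show l.length + (j + 1) + 1 = l.length + j + 2 by ring]
          ring
  have hpartial : ∀ N n, ∑ j ∈ Finset.range n, ∑ m ∈ listsOfLength d j, f N (i, m ++ l) ≤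
      K / (N + 1) := by
    intro N n
    have hN : (0 : ℝ) < N + 1 := by positivity
    have hK' : K / (N + 1) = α ^ l.length * ((l.length + 1) / (N + 1)) +
        α ^ (l.length + 1) * d * (2 / (N + 1) * 1 + 2 / (N + 1) * C) := by
      rw [hK]
      field_simp
    cases n with
    | zero =>
      rw [hK', Finset.sum_range_zero]
      positivity
    | succ n =>
      rw [Finset.sum_range_succ', hK', add_comm]
      refine add_le_add ?_ ?_
      · rw [listsOfLength, Finset.sum_singleton, hnil]
        refine mul_le_mul_of_nonneg_left ?_ (by positivity)
        have h3 : q N (l.length + 1) ^ 2 ≤ q N (l.length + 1) := by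
          rw [sq]; exact mul_le_of_le_one_left (hq0 N _) (hq1 N _)
        have h4 := hqle N (l.length + 1)
        push_cast at h4
        exact h3.trans h4
      · refine (Finset.sum_le_sum fun j _ => hlevel N j).trans ?_
        rw [← Finset.mul_sum, Finset.sum_add_distrib, ← Finset.mul_sum, ← Finset.mul_sum,
          Finset.sum_range_sub (fun j => q N (l.length + j + 1))]
        have h5 := hq1 N (l.length + n + 1)
        have h6 := hq0 N (l.length + 0 + 1)
        have h7 := hC n
        gcongr
        linarith
  have hfpos : ∀ N m, 0 ≤ f N (i, m ++ l) := fun N m =>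
    mul_nonneg ((weightedTree d α hα).weight_pos _).le (sq_nonneg _)
  have hsum := fun N => summable_lists_of_sum_le (hfpos N) (hpartial N)
  refine isExtendedDirichlet_linExt (b := fun N z => a z * (1 - q N (treeGeneration z))) ?_ ?_ ?_ ?_
    (fun N => ?_) ?_
  · intro N
    refine (finite_treeGeneration_le d (N + 1)).subset fun z hz => ?_
    by_contra h
    have h' : N + 1 < treeGeneration z := not_le.1 h
    refine hz ?_
    have : q N (treeGeneration z) = 1 := by
      refine min_eq_left ?_
      rw [le_div_iff₀ (by positivity), one_mul]
      exact_mod_cast h'.le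
    simp [this]
  · intro N z
    have h1 := hq0 N (treeGeneration z)
    have h2 := hq1 N (treeGeneration z)
    rw [abs_of_nonneg (mul_nonneg (ha0 z) (by linarith))]
    exact mul_le_one₀ (ha1 z) (by linarith) (by linarith)
  · intro N z hz
    have : a z = 0 := (mul_eq_zero.1 (killing_subtreeFun hα (i, l) z)).resolve_left hz
    simp [this]
  · intro z
    have : Tendsto (fun N : ℕ => q N (treeGeneration z)) atTop (𝓝 0) := by
      refine squeeze_zero (fun N => hq0 N _) (fun N => hqle N _) ?_
      exact tendsto_const_nhds.div_atTop
        (tendsto_atTop_add_const_right _ _ tendsto_natCast_atTop_atTop)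
    simpa using (this.const_sub 1).const_mul (a z)
  · exact ((appendEdge_injective i l).summable_iff (hf0 N)).1 (hsum N).1
  · have hlim : Tendsto (fun N : ℕ => K / ((N : ℝ) + 1)) atTop (𝓝 0) :=
      tendsto_const_nhds.div_atTop
        (tendsto_atTop_add_const_right _ _ tendsto_natCast_atTop_atTop)
    refine squeeze_zero (fun N => tsum_nonneg fun e => ?_) (fun N => ?_) hlim
    · exact mul_nonneg ((weightedTree d α hα).weight_pos _).le (sq_nonneg _)
    · refine le_trans (le_of_eq ?_) (hsum N).2
      refine ((appendEdge_injective i l).tsum_eq fun e he => ?_).symm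
      by_contra h
      exact he (hf0 N e h)

end tree

/-! ### Potentials of the innovations and existence of the Green function -/

section tree

variable {d : ℕ} {α : ℝ} (hα : 0 < α)

open MassiveGraph

theorem treeGeneration_treeParent {d : ℕ} (y : Fin (d + 1) × List (Fin d)) :
    treeGeneration (treeParent y) = y.2.length := by
  rcases y with ⟨i, _ | ⟨a, l⟩⟩ <;> rfl

/-- By harmonicity below the vertex, the energy against `u` telescopes over the levels of the
subtree. What remains is the contribution of the top vertex and its parent, and a boundary term `(α
p) ^ n` times the sum of `u` over a level of `d ^ n` vertices; the latter vanishes in the limit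
since `d α p ≤ 1` and `u` tends to 0 at infinity. -/
theorem represents_subtreeFun (hd : 0 < d) (y : Fin (d + 1) × List (Fin d)) :
    (weightedTree d α hα).Represents ((weightedTree d α hα).linExt
      (subtreeFun d (returnRatio d α) y) fun x => 2 * (weightedTree d α hα).killing x)
      ((α ^ y.2.length / returnRatio d α) • (Finsupp.single (.vertex (some y)) 1 -
        returnRatio d α • Finsupp.single (.vertex (treeParent y)) 1)) := by
  have hext := isExtendedDirichlet_subtreeFun hα hd y
  refine ⟨hext, fun u hu => ?_⟩
  have hsum := hasSum_energy_linExt hext hu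
  set S := (weightedTree d α hα).energy ((weightedTree d α hα).linExt
      (subtreeFun d (returnRatio d α) y) fun x => 2 * (weightedTree d α hα).killing x) u
  obtain ⟨i, l⟩ := y
  set p := returnRatio d α with hp
  have hp0 : 0 < p := returnRatio_pos d α
  have hp1 : p ≤ 1 := returnRatio_le_one d α
  set U : TreeVertex d → ℝ := fun z => u (.vertex z) with hU
  set g : Fin (d + 1) × List (Fin d) → ℝ := fun e => (weightedTree d α hα).weight e *
    (subtreeFun d p (i, l) (some e) - subtreeFun d p (i, l) (treeParent e)) *
      (U (some e) - U (treeParent e)) with hg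
  have hsum1 : HasSum g S := by
    have h := (Function.Injective.hasSum_iff (Sum.inl_injective (α := Fin (d + 1) × List (Fin d))
      (β := TreeVertex d)) ?_).2 hsum
    · exact h
    · rintro (e | z) hz
      · exact absurd ⟨e, rfl⟩ hz
      · exact mul_eq_zero_of_left (killing_subtreeFun hα (i, l) z) _
  have hsum2 : HasSum (fun m : List (Fin d) => g (i, m ++ l)) S := by
    refine ((appendEdge_injective i l).hasSum_iff fun e he => ?_).2 hsum1
    obtain ⟨h1, h2⟩ := subtreeFun_of_not_suffix p (notMem_range_appendEdge he)
    simp only [hg, h1, h2]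
    ring
  set T : ℕ → ℝ := fun j => ∑ m ∈ listsOfLength d j, U (some (i, m ++ l)) with hT
  have hT0 : T 0 = U (some (i, l)) := by simp [hT, listsOfLength]
  have hnil : g (i, [] ++ l) = α ^ l.length * (U (some (i, l)) - U (treeParent (i, l))) := by
    have h1 : subtreeFun d p (i, l) (some (i, [] ++ l)) = 1 := by
      simpa using subtreeFun_append p i l []
    have h2 : subtreeFun d p (i, l) (treeParent (i, l)) = 0 := subtreeFun_parent p (i, l)
    simp only [hg, h1]
    simp only [List.nil_append, h2, weightedTree, treeGeneration_treeParent]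
    ring
  have hcons : ∀ b (m : List (Fin d)), g (i, b :: m ++ l) = -(α ^ (l.length + 1) * (1 - p)) *
      (α * p) ^ m.length * (U (some (i, b :: m ++ l)) - U (some (i, m ++ l))) := by
    intro b m
    have h1 : subtreeFun d p (i, l) (some (i, b :: m ++ l)) = p ^ (m.length + 1) := by
      simpa using subtreeFun_append p i l (b :: m)
    have h2 : subtreeFun d p (i, l) (some (i, m ++ l)) = p ^ m.length := subtreeFun_append p i l m
    simp only [hg, h1]
    simp only [List.cons_append, treeParent, h2, weightedTree, treeGeneration, List.length_append]
    ring
  have hlevel : ∀ j, ∑ m ∈ listsOfLength d (j + 1), g (i, m ++ l) =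
      α ^ (l.length + 1) * (1 - p) * d * ((α * p) ^ j * T j - (α * p) ^ (j + 1) * T (j + 1)) := by
    intro j
    rw [sum_listsOfLength_succ]
    have hTs : T (j + 1) = ∑ m ∈ listsOfLength d j, ∑ b, U (some (i, b :: m ++ l)) :=
      sum_listsOfLength_succ _
    have e1 : ∑ m ∈ listsOfLength d j, ∑ b, g (i, b :: m ++ l) =
        -(α ^ (l.length + 1) * (1 - p)) * (α * p) ^ j * (T (j + 1) - d * T j) := by
      rw [hTs, hT, Finset.mul_sum, ← Finset.sum_sub_distrib, Finset.mul_sum]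
      refine Finset.sum_congr rfl fun m hm => ?_
      simp only [hcons, mem_listsOfLength.1 hm, ← Finset.mul_sum, Finset.sum_sub_distrib,
        Finset.sum_const, Finset.card_univ, Fintype.card_fin, nsmul_eq_mul]
    rw [e1]
    have h := one_sub_returnRatio_mul d α
    rw [← hp] at h
    have h3 : (1 - p) * (d * (α * p)) * T (j + 1) = (1 - p) * T (j + 1) := by
      rw [← mul_assoc (d : ℝ), h]
    rw [pow_succ (α * p)]
    linear_combination (α ^ (l.length + 1) * (α * p) ^ j) * h3
  have hTlim : Tendsto (fun n => (α * p) ^ n * T n) atTop (𝓝 0) := by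
    have h0 := weightedTree_tendsto_zero hα hu
    rw [Metric.tendsto_nhds] at h0
    rw [Metric.tendsto_atTop]
    intro ε hε
    obtain ⟨s, hs, hsε⟩ := mem_comap.1 (h0 (ε / 2) (half_pos hε))
    obtain ⟨N, hN⟩ := mem_atTop_sets.1 hs
    refine ⟨N, fun n hn => ?_⟩
    rw [dist_zero_right, norm_mul, Real.norm_of_nonneg (by positivity : (0 : ℝ) ≤ (α * p) ^ n)]
    have hb : ‖T n‖ ≤ d ^ n * (ε / 2) := by
      refine (norm_sum_le _ _).trans ?_
      have : ∀ m ∈ listsOfLength d n, ‖U (some (i, m ++ l))‖ ≤ ε / 2 := by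
        intro m hm
        have hmem : some (i, m ++ l) ∈ treeGeneration ⁻¹' s := by
          refine hN _ ?_
          change N ≤ (m ++ l).length + 1
          rw [List.length_append, mem_listsOfLength.1 hm]
          omega
        have := hsε hmem
        simp only [Set.mem_ofPred_eq, dist_zero_right] at this
        exact this.le
      refine (Finset.sum_le_card_nsmul _ _ _ this).trans_eq ?_
      rw [card_listsOfLength, nsmul_eq_mul]
      push_cast
      ring
    have h1 : (d * α * p) ^ n ≤ 1 := pow_le_one₀ (by positivity) (mul_returnRatio_le_one d α)
    calc (α * p) ^ n * ‖T n‖ ≤ (α * p) ^ n * (d ^ n * (ε / 2)) := by gcongr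
      _ = (d * α * p) ^ n * (ε / 2) := by ring
      _ ≤ 1 * (ε / 2) := by gcongr
      _ < ε := by linarith
  have hpart : ∀ n, ∑ m ∈ listsBelow d (n + 1), g (i, m ++ l) =
      α ^ l.length * (U (some (i, l)) - U (treeParent (i, l))) +
        α ^ (l.length + 1) * (1 - p) * d * (T 0 - (α * p) ^ n * T n) := by
    intro n
    rw [sum_listsBelow, Finset.sum_range_succ', add_comm]
    congr 1
    · simp only [listsOfLength, Finset.sum_singleton]
      exact hnil
    · simp only [hlevel]
      rw [← Finset.mul_sum, Finset.sum_range_sub' (fun j => (α * p) ^ j * T j)]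
      simp
  have hlim1 : Tendsto (fun n => ∑ m ∈ listsBelow d (n + 1), g (i, m ++ l)) atTop (𝓝 S) :=
    (hsum2.comp (tendsto_listsBelow d)).comp (tendsto_add_atTop_nat 1)
  have hlim2 := ((hTlim.const_sub (T 0)).const_mul (α ^ (l.length + 1) * (1 - p) * d)).const_add
    (α ^ l.length * (U (some (i, l)) - U (treeParent (i, l))))
  have hS := tendsto_nhds_unique hlim1 (hlim2.congr fun n => (hpart n).symm)
  rw [hS, hT0]
  simp only [map_smul, map_sub, Finsupp.linearCombination_single, smul_eq_mul, sub_zero, one_mul]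
  have h4 := one_sub_returnRatio_mul_eq d α
  rw [← hp] at h4
  have h5 : α ^ (l.length + 1) * (1 - p) * d = α ^ l.length * (p⁻¹ - 1) := by
    rw [← h4]
    ring
  rw [h5]
  change _ = α ^ l.length / p * (U (some (i, l)) - p * U (treeParent (i, l)))
  field_simp
  ring

/-- The killed Green function of the subtree of `some y` represents the innovation at `some y`. -/
theorem represents_innovation (hd : 0 < d) (y : Fin (d + 1) × List (Fin d)) :
    (weightedTree d α hα).Represents ((returnRatio d α / α ^ y.2.length) •
      (weightedTree d α hα).linExt (subtreeFun d (returnRatio d α) y)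
        fun x => 2 * (weightedTree d α hα).killing x)
      (Finsupp.single (.vertex (some y)) 1 -
        returnRatio d α • Finsupp.single (.vertex (treeParent y)) 1) := by
  have h := (represents_subtreeFun hα hd y).const_smul (returnRatio d α / α ^ y.2.length)
  have hp := (returnRatio_pos d α).ne'
  have e : returnRatio d α / α ^ y.2.length * (α ^ y.2.length / returnRatio d α) = 1 := by
    have : α ^ y.2.length ≠ 0 := by positivity
    field_simp
  rwa [smul_smul, e, one_smul] at h

/-- Only the `d + 1` root edges, all of weight 1, and the killed cable at the root carry energy,
which produces the discrete Laplacian at the root. -/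
theorem represents_rootHat : (weightedTree d α hα).Represents
    ((weightedTree d α hα).linExt (Pi.single none 1)
      fun x => 2 * (weightedTree d α hα).killing x)
    (((d + 1 : ℝ) + (weightedTree d α hα).killing none) • Finsupp.single (.vertex none) 1 -
      ∑ i : Fin (d + 1), Finsupp.single (.vertex (some (i, []))) 1) := by
  have hext : (weightedTree d α hα).IsExtendedDirichlet ((weightedTree d α hα).linExt
      (Pi.single none 1) fun x => 2 * (weightedTree d α hα).killing x) := by
    refine isExtendedDirichlet_linExt (b := fun _ => Pi.single none 1) (fun _ => ?_) (fun _ x => ?_)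
      (fun _ _ _ => rfl) (fun _ => tendsto_const_nhds) (fun _ => ?_) ?_
    · exact (Set.finite_singleton none).subset Pi.support_single_subset
    · cases x <;> simp
    · simp [summable_zero]
    · simp
  refine ⟨hext, fun u hu => ?_⟩
  have hsum := hasSum_energy_linExt hext hu
  have hval := hsum.tsum_eq
  rw [← hval]
  set f := Sum.elim (fun e => (weightedTree d α hα).weight e *
    ((Pi.single none 1 : TreeVertex d → ℝ) ((weightedTree d α hα).tgt e) -
      (Pi.single none 1 : TreeVertex d → ℝ) ((weightedTree d α hα).src e)) *
    (u (.vertex ((weightedTree d α hα).tgt e)) - u (.vertex ((weightedTree d α hα).src e))))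
    (fun x => (weightedTree d α hα).killing x * (Pi.single none 1 : TreeVertex d → ℝ) x *
      u (.vertex x)) with hf
  rw [tsum_eq_sum (s := insert (Sum.inr none) (Finset.univ.image
    fun i : Fin (d + 1) => Sum.inl (i, ([] : List (Fin d)))))]
  · rw [Finset.sum_insert (by simp), Finset.sum_image fun i _ j _ h => by simpa using h]
    simp only [hf, Sum.elim_inr, Sum.elim_inl, Pi.single_eq_same, map_sub, map_smul, map_sum,
      Finsupp.linearCombination_single, smul_eq_mul, one_mul, mul_one]
    have : ∀ i : Fin (d + 1), (weightedTree d α hα).weight (i, []) *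
      ((Pi.single none 1 : TreeVertex d → ℝ) ((weightedTree d α hα).tgt (i, [])) -
        (Pi.single none 1 : TreeVertex d → ℝ) ((weightedTree d α hα).src (i, []))) *
      (u (.vertex ((weightedTree d α hα).tgt (i, []))) -
        u (.vertex ((weightedTree d α hα).src (i, [])))) =
        u (.vertex none) - u (.vertex (some (i, []))) := by
      intro i
      simp [weightedTree, treeParent, treeGeneration]
    rw [Finset.sum_congr rfl fun i _ => this i, Finset.sum_sub_distrib]
    simp only [Finset.sum_const, Finset.card_univ, Fintype.card_fin, nsmul_eq_mul]
    push_cast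
    ring
  · rintro (⟨i, _ | ⟨a, k⟩⟩ | _ | z) h
    · simp at h
    · simp [hf, weightedTree, treeParent]
    · simp at h
    · simp [hf]

/-- At the root, adding the potentials of `δ_child - p δ_root` to that of the Laplacian cancels the
children and leaves `((d + 1) * (1 - p) + κ) δ_root`. The coefficient is positive because either `κ
= 1` or `p < 1`; this is transience. Further down, a point mass is an innovation plus `p` times the
point mass at the parent. -/
theorem exists_represents_vertex (hd : 0 < d) (z : TreeVertex d) :
    ∃ k, (weightedTree d α hα).Represents k (Finsupp.single (.vertex z) 1) := by
  have hroot : ∃ k, (weightedTree d α hα).Represents k (Finsupp.single (.vertex none) 1) := by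
    set p := returnRatio d α with hp
    set κ := (weightedTree d α hα).killing none with hκ
    have hp0 : 0 < p := returnRatio_pos d α
    have hp1 : p ≤ 1 := returnRatio_le_one d α
    have hκ0 : 0 ≤ κ := (weightedTree d α hα).killing_nonneg none
    have hc : 0 < (d + 1) * (1 - p) + κ := by
      have hd' : (0 : ℝ) < d := by exact_mod_cast hd
      by_cases h : α ≤ 1 / d
      · have : κ = 1 := by simp [hκ, weightedTree, -one_div, h]
        have : 0 ≤ (d + 1) * (1 - p) := mul_nonneg (by positivity) (by linarith)
        linarith
      · have h1 : 1 < d * α := by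
          rw [not_le, div_lt_iff₀ hd'] at h
          linarith
        have h2 : p < 1 := inv_lt_one_of_one_lt₀ (lt_max_of_lt_right h1)
        have : 0 < (d + 1) * (1 - p) := mul_pos (by positivity) (by linarith)
        linarith
    have h0 : (weightedTree d α hα).Represents 0 0 := by
      have := (represents_rootHat (d := d) hα).const_smul 0
      rwa [zero_smul, zero_smul] at this
    have h1 := Represents.sum Finset.univ h0 (fun i _ =>
      (represents_subtreeFun hα hd (i, [])).const_smul p)
    have h2 := ((represents_rootHat hα).add h1).const_smul ((d + 1) * (1 - p) + κ)⁻¹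
    suffices h : ∃ L : (weightedTree d α hα).Cable →₀ ℝ, L = Finsupp.single (.vertex none) 1 ∧
        ∃ k, (weightedTree d α hα).Represents k L by
      obtain ⟨L, rfl, h⟩ := h
      exact h
    refine ⟨_, ?_, _, h2⟩
    have e : ∀ i : Fin (d + 1), p • ((α ^ ([] : List (Fin d)).length / p) •
        ((Finsupp.single (.vertex (some (i, []))) 1 : (weightedTree d α hα).Cable →₀ ℝ) -
        p • Finsupp.single (.vertex (treeParent (i, []))) 1)) =
        Finsupp.single (.vertex (some (i, []))) 1 - p • Finsupp.single (.vertex none) 1 := by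
      intro i
      rw [smul_smul, List.length_nil, pow_zero, mul_one_div_cancel hp0.ne', one_smul]
      rfl
    rw [Finset.sum_congr rfl fun i _ => e i, Finset.sum_sub_distrib, Finset.sum_const,
      Finset.card_univ, Fintype.card_fin, sub_add_sub_cancel, ← Nat.cast_smul_eq_nsmul ℝ, smul_smul,
      ← sub_smul, smul_smul]
    have : ((d + 1) * (1 - p) + κ)⁻¹ * ((d : ℝ) + 1 + κ - ((d + 1 : ℕ) : ℝ) * p) = 1 := by
      push_cast
      rw [inv_mul_eq_one₀ hc.ne']
      ring
    rw [this, one_smul]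
  have hstep : ∀ y : Fin (d + 1) × List (Fin d),
      (∃ k, (weightedTree d α hα).Represents k (Finsupp.single (.vertex (treeParent y)) 1)) →
      ∃ k, (weightedTree d α hα).Represents k (Finsupp.single (.vertex (some y)) 1) := by
    rintro y ⟨k, hk⟩
    have h := (represents_innovation hα hd y).add (hk.const_smul (returnRatio d α))
    rw [sub_add_cancel] at h
    exact ⟨_, h⟩
  rcases z with _ | ⟨i, l⟩
  · exact hroot
  · induction l with
    | nil => exact hstep _ hroot
    | cons a l ih => exact hstep _ ih

end tree

/-! ### Dyadic points of a cable and midpoint displacements -/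

namespace MassiveGraph

/-- The points dividing the cable of an edge into `2 ^ n` pieces of equal length. -/
noncomputable def dyadicPoint {V E : Type*} (G : MassiveGraph V E) (e : E) (n k : ℕ) : G.Cable :=
  G.edgePoint e (1 / (2 * G.weight e) * (k / 2 ^ n))

variable {V E : Type*} {G : MassiveGraph V E}

theorem dyadicPoint_zero (e : E) (n : ℕ) : G.dyadicPoint e n 0 = .vertex (G.src e) := by
  simp [dyadicPoint, edgePoint_zero]

theorem dyadicPoint_of_ge (e : E) {n k : ℕ} (h : 2 ^ n ≤ k) :
    G.dyadicPoint e n k = .vertex (G.tgt e) := by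
  refine edgePoint_of_ge (le_mul_of_one_le_right (G.edgeLength_pos e).le ?_)
  rw [one_le_div (by positivity)]
  exact_mod_cast h

theorem dyadicPoint_succ_double (e : E) (n k : ℕ) :
    G.dyadicPoint e (n + 1) (2 * k) = G.dyadicPoint e n k := by
  unfold dyadicPoint
  congr 2
  push_cast
  rw [pow_succ]
  field_simp

/-- The functional measuring the displacement of the midpoint of a dyadic interval. -/
noncomputable def displacement (G : MassiveGraph V E) (e : E) (n k : ℕ) : G.Cable →₀ ℝ :=
  Finsupp.single (G.dyadicPoint e (n + 1) (2 * k + 1)) 1 -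
    ((1 / 2 : ℝ) • Finsupp.single (G.dyadicPoint e n k) 1 +
      (1 / 2 : ℝ) • Finsupp.single (G.dyadicPoint e n (k + 1)) 1)

/-- Beyond the range the clamped parametrization sends all three points to `tgt e`. The
displacements can thus be indexed by all of `ℕ × ℕ`, with variance zero for the superfluous indices.
-/
theorem displacement_of_ge (e : E) {n k : ℕ} (h : 2 ^ n ≤ k) : G.displacement e n k = 0 := by
  rw [displacement, dyadicPoint_of_ge e h, dyadicPoint_of_ge e (h.trans (Nat.le_succ k)),
    dyadicPoint_of_ge e (n := n + 1) (k := 2 * k + 1) (by rw [pow_succ]; omega), ← add_smul]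
  norm_num

theorem represents_displacement [Countable V] [Countable E] (e : E) {n k : ℕ} (h : k < 2 ^ n) :
    G.Represents (G.edgeBump e (tent (1 / (2 * G.weight e) * (k / 2 ^ n))
      (1 / (2 * G.weight e) * ((k + 1 : ℕ) / 2 ^ n)))) (G.displacement e n k) := by
  have hl := G.edgeLength_pos e
  have h' : ((k + 1 : ℕ) : ℝ) ≤ 2 ^ n := by exact_mod_cast h
  have := represents_tent (G := G) (e := e) (l := 1 / (2 * G.weight e) * (k / 2 ^ n))
    (r := 1 / (2 * G.weight e) * ((k + 1 : ℕ) / 2 ^ n)) (by positivity) ?_ ?_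
  · convert this using 1
    rw [displacement, dyadicPoint, dyadicPoint, dyadicPoint]
    congr 3
    push_cast
    rw [pow_succ]
    field_simp
    ring
  · gcongr
    simp
  · exact mul_le_of_le_one_right hl.le ((div_le_one (by positivity)).2 h')

/-- A midpoint is its displacement plus the average of two points of the previous level, so
potentials propagate from the vertices by induction on the level. -/
theorem exists_represents_dyadicPoint [Countable V] [Countable E]
    (hv : ∀ x : V, ∃ k, G.Represents k (Finsupp.single (.vertex x) 1)) (e : E) (n k : ℕ) :
    ∃ K, G.Represents K (Finsupp.single (G.dyadicPoint e n k) 1) := by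
  induction n generalizing k with
  | zero =>
    rcases Nat.eq_zero_or_pos k with rfl | hk
    · rw [dyadicPoint_zero]
      exact hv _
    · rw [dyadicPoint_of_ge e (by rw [pow_zero]; exact hk)]
      exact hv _
  | succ n ih =>
    rcases Nat.even_or_odd' k with ⟨j, rfl | rfl⟩
    · rw [dyadicPoint_succ_double]
      exact ih j
    · by_cases hj : j < 2 ^ n
      · obtain ⟨K1, h1⟩ := ih j
        obtain ⟨K2, h2⟩ := ih (j + 1)
        have h := (represents_displacement e hj).add
          ((h1.const_smul (1 / 2)).add (h2.const_smul (1 / 2)))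
        rw [displacement, sub_add_cancel] at h
        exact ⟨_, h⟩
      · rw [dyadicPoint_of_ge e (n := n + 1) (k := 2 * j + 1) (by rw [pow_succ]; omega)]
        exact hv _

end MassiveGraph

/-! ### Covariances of the field from potentials -/

namespace MassiveGraph

variable {V E : Type*} {G : MassiveGraph V E} {Ω : Type*} [MeasurableSpace Ω] {P : Measure Ω}
  {φ : G.Cable → Ω → ℝ}

/-- Existence rules out the default value 0 in `green`. Which potential is chosen does not matter,
as duality pins down the values that are used. -/
theorem represents_green {x : G.Cable} (h : ∃ k, G.Represents k (Finsupp.single x 1)) :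
    G.Represents (G.green x) (Finsupp.single x 1) := by
  have h' : ∃ k, G.IsGreenAt x k := by simpa only [isGreenAt_iff_represents] using h
  have : G.green x = h'.choose := by
    funext y
    rw [green, dif_pos h']
  rw [this, ← isGreenAt_iff_represents]
  exact h'.choose_spec

namespace IsGaussianFreeField

variable (hφ : G.IsGaussianFreeField P φ)
include hφ

theorem memLp_two (x : G.Cable) : MemLp (φ x) 2 P :=
  (hφ.isGaussianProcess.hasGaussianLaw_eval x).memLp_two

theorem integral_linearCombination (L : G.Cable →₀ ℝ) :
    ∫ ω, Finsupp.linearCombination ℝ (fun x => φ x ω) L ∂P = 0 := by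
  simp only [Finsupp.linearCombination_apply, Finsupp.sum]
  have := hφ.isGaussianProcess.isProbabilityMeasure
  have hi : ∀ x ∈ L.support, Integrable (fun ω => L x • φ x ω) P := fun x _ =>
    ((hφ.memLp_two x).integrable one_le_two).smul (L x)
  rw [integral_finsetSum _ hi]
  refine Finset.sum_eq_zero fun x _ => ?_
  rw [integral_smul, hφ.centered, smul_zero]

/-- By duality, the functional `M` applied to `green x` is `U x`. Covariances can therefore be read
off from an explicit potential of one functional, while the other only needs its point masses to be
representable. -/
theorem integral_linearCombination_mul [Countable V] [Countable E]
    {U : G.Cable → ℝ} {L M : G.Cable →₀ ℝ}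
    (hM : G.Represents U M)
    (hL : ∀ x ∈ L.support, ∃ k, G.Represents k (Finsupp.single x 1)) :
    ∫ ω, Finsupp.linearCombination ℝ (fun x => φ x ω) L *
      Finsupp.linearCombination ℝ (fun x => φ x ω) M ∂P = Finsupp.linearCombination ℝ U L := by
  have hint : ∀ x y, Integrable (fun ω => φ x ω * φ y ω) P := fun x y =>
    (hφ.memLp_two x).integrable_mul (hφ.memLp_two y)
  simp only [Finsupp.linearCombination_apply, Finsupp.sum, smul_eq_mul, Finset.sum_mul_sum]
  rw [integral_finsetSum]
  · refine Finset.sum_congr rfl fun x hx => ?_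
    rw [integral_finsetSum]
    · have hd := hM.duality (represents_green (hL x hx))
      simp only [Finsupp.linearCombination_apply, Finsupp.sum_single_index, zero_smul, one_smul] at hd
      rw [← hd, Finsupp.sum, Finset.mul_sum]
      refine Finset.sum_congr rfl fun y _ => ?_
      rw [smul_eq_mul, ← hφ.covariance, ← mul_assoc, ← integral_const_mul]
      refine integral_congr_ae (Eventually.of_forall fun ω => ?_)
      ring
    · intro y _
      refine ((hint x y).const_mul (L x * M y)).congr (Eventually.of_forall fun ω => ?_)
      ring
  · intro x _
    refine integrable_finsetSum _ fun y _ => ?_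
    refine ((hint x y).const_mul (L x * M y)).congr (Eventually.of_forall fun ω => ?_)
    ring

theorem isGaussianProcess_linearCombination {J : Type*} (F : J → G.Cable →₀ ℝ) :
    IsGaussianProcess (fun j ω => Finsupp.linearCombination ℝ (fun x => φ x ω) (F j)) P := by
  refine hφ.isGaussianProcess.of_isGaussianProcess fun j => ⟨(F j).support,
    ∑ x : (F j).support, (F j x) • ContinuousLinearMap.proj (R := ℝ) x, fun ω => ?_⟩
  rw [Finsupp.linearCombination_apply, Finsupp.sum, ← Finset.sum_attach]
  simp [Finset.restrict_def]

end IsGaussianFreeField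

end MassiveGraph

/-! ### Independent Gaussian families -/

/-- A family of independent centered Gaussian variables with variances `v`. -/
structure IsGaussianNoise {Ω J : Type*} [MeasurableSpace Ω] (P : Measure Ω) (Y : J → Ω → ℝ)
    (v : J → NNReal) : Prop where
  measurable : ∀ j, Measurable (Y j)
  isGaussianProcess : IsGaussianProcess Y P
  map_eq : ∀ j, P.map (Y j) = gaussianReal 0 (v j)
  covariance_eq_zero : ∀ i j, i ≠ j → cov[Y i, Y j; P] = 0

/-- The `σ`-algebra generated by the variables with index in `S`. -/
abbrev sigmaOf {Ω J : Type*} (Y : J → Ω → ℝ) (S : Set J) : MeasurableSpace Ω :=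
  MeasurableSpace.comap (fun ω (s : S) => Y s ω) inferInstance

namespace IsGaussianNoise

variable {Ω J : Type*} {Y : J → Ω → ℝ}

theorem measurable_sigmaOf {S : Set J} {j : J} (hj : j ∈ S) : Measurable[sigmaOf Y S] (Y j) :=
  (measurable_pi_apply (X := fun _ : S => ℝ) ⟨j, hj⟩).comp
    (comap_measurable fun ω (s : S) => Y s ω)

theorem sigmaOf_mono {S T : Set J} (h : S ⊆ T) : sigmaOf Y S ≤ sigmaOf Y T := by
  rw [sigmaOf, ← measurable_iff_comap_le]
  exact @measurable_pi_lambda _ _ _ (sigmaOf Y T) _ _ fun s => measurable_sigmaOf (h s.2)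

variable [MeasurableSpace Ω] {P : Measure Ω} {v : J → NNReal} (hY : IsGaussianNoise P Y v)
include hY

theorem sigmaOf_le (S : Set J) : sigmaOf Y S ≤ ‹MeasurableSpace Ω› := by
  rw [sigmaOf, ← measurable_iff_comap_le]
  exact measurable_pi_lambda _ fun s => hY.measurable s

theorem isProbabilityMeasure : IsProbabilityMeasure P := hY.isGaussianProcess.isProbabilityMeasure

/-- In a jointly Gaussian family vanishing covariances imply independence, also for blocks with
disjoint index sets. -/
theorem iIndep_sigmaOf {T : Type*} {S : T → Set J} (hS : Pairwise (Function.onFun Disjoint S)) :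
    iIndep (fun t => sigmaOf Y (S t)) P := by
  refine IsGaussianProcess.iIndepFun_of_covariance_eq_zero (S := fun t => S t)
    (X := fun t s => Y s) (hY.isGaussianProcess.comp_right fun q : (t : T) × S t => (q.2 : J))
    (fun t s => (hY.measurable s).aemeasurable) fun t t' htt s s' => ?_
  exact hY.covariance_eq_zero _ _ fun h => Set.disjoint_left.1 (hS htt) s.2 (h ▸ s'.2)

theorem indep_sigmaOf {A B : Set J} (h : Disjoint A B) : Indep (sigmaOf Y A) (sigmaOf Y B) P := by
  have := hY.iIndep_sigmaOf (S := fun b : Bool => if b then A else B) (by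
    intro b c hbc
    cases b <;> cases c <;> simp_all [Function.onFun, disjoint_comm])
  simpa using this.indep (i := true) (j := false) (by simp)

end IsGaussianNoise

/-- The covariances are the pairings of the functionals with the potentials. By symmetry of the
covariance it suffices that one of the two pairings of `i` and `j` vanishes. The field is only
almost everywhere measurable, hence the passage to measurable versions. -/
theorem MassiveGraph.IsGaussianFreeField.exists_isGaussianNoise {V E Ω J : Type*}
    [Countable V] [Countable E] [Countable J]
    {G : MassiveGraph V E} [MeasurableSpace Ω] {P : Measure Ω} {φ : G.Cable → Ω → ℝ}
    (hφ : G.IsGaussianFreeField P φ) (F : J → G.Cable →₀ ℝ) (U : J → G.Cable → ℝ)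
    (hU : ∀ j, G.Represents (U j) (F j))
    (hF : ∀ j, ∀ x ∈ (F j).support, ∃ k, G.Represents k (Finsupp.single x 1))
    (v : J → NNReal) (hv : ∀ j, Finsupp.linearCombination ℝ (U j) (F j) = v j)
    (ho : ∀ i j, i ≠ j → Finsupp.linearCombination ℝ (U i) (F j) = 0 ∨
      Finsupp.linearCombination ℝ (U j) (F i) = 0) :
    ∃ Y : J → Ω → ℝ, IsGaussianNoise P Y v ∧
      ∀ᵐ ω ∂P, ∀ j, Y j ω = Finsupp.linearCombination ℝ (fun x => φ x ω) (F j) := by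
  have hp := hφ.isGaussianProcess.isProbabilityMeasure
  have hg := hφ.isGaussianProcess_linearCombination F
  set X : J → Ω → ℝ := fun j ω => Finsupp.linearCombination ℝ (fun x => φ x ω) (F j) with hX
  have hm := fun j => hg.aemeasurable j
  have hL2 : ∀ j, MemLp (X j) 2 P := fun j => (hg.hasGaussianLaw_eval j).memLp_two
  have hae : ∀ j, X j =ᵐ[P] (hm j).mk := fun j => (hm j).ae_eq_mk
  have hmean : ∀ j, ∫ ω, X j ω ∂P = 0 := fun j => hφ.integral_linearCombination (F j)
  have hcov : ∀ i j, cov[X i, X j; P] = Finsupp.linearCombination ℝ (U j) (F i) := fun i j => by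
    rw [covariance_eq_sub (hL2 i) (hL2 j), hmean, hmean, zero_mul, sub_zero]
    exact hφ.integral_linearCombination_mul (hU j) (hF i)
  refine ⟨fun j => (hm j).mk, ⟨fun j => (hm j).measurable_mk, hg.congr hae, fun j => ?_,
    fun i j hij => ?_⟩, ae_all_iff.2 fun j => (hae j).symm⟩
  · rw [← Measure.map_congr (hae j), (hg.hasGaussianLaw_eval j).map_eq_gaussianReal, hmean,
      ← covariance_self (hm j), hcov, hv, Real.toNNReal_coe]
  · have hc : cov[(hm i).mk, (hm j).mk; P] = cov[X i, X j; P] := by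
      rw [ProbabilityTheory.covariance, ProbabilityTheory.covariance, ← integral_congr_ae (hae i), ← integral_congr_ae (hae j)]
      refine integral_congr_ae ?_
      filter_upwards [hae i, hae j] with ω h1 h2
      rw [h1, h2]
    rw [hc, hcov]
    rcases ho i j hij with h | h
    · rw [← hcov, covariance_comm, hcov, h]
    · rw [h]

/-! ### Orthogonality of the midpoint displacements -/

namespace MassiveGraph

variable {V E : Type*} {G : MassiveGraph V E}

/-- The tent is affine on each of the four pieces of the line, and affine functions have no midpoint
displacement. -/
theorem tent_midpoint {l r x y : ℝ} (hxy : x ≤ y)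
    (h : y ≤ l ∨ (l ≤ x ∧ y ≤ (l + r) / 2) ∨ ((l + r) / 2 ≤ x ∧ y ≤ r) ∨ r ≤ x) :
    tent l r ((x + y) / 2) - 1 / 2 * (tent l r x + tent l r y) = 0 := by
  rcases h with h | ⟨h1, h2⟩ | ⟨h1, h2⟩ | h
  · rw [tent_of_le h, tent_of_le (hxy.trans h), tent_of_le (by linarith)]
    ring
  · rw [tent_left h1 (hxy.trans h2), tent_left (h1.trans hxy) h2,
      tent_left (by linarith) (by linarith)]
    ring
  · rw [tent_right h1 (hxy.trans h2), tent_right (h1.trans hxy) h2,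
      tent_right (by linarith) (by linarith)]
    ring
  · rw [tent_of_ge h, tent_of_ge (h.trans hxy), tent_of_ge (by linarith)]
    ring

theorem linearCombination_displacement (f : G.Cable → ℝ) (e : E) (n k : ℕ) :
    Finsupp.linearCombination ℝ f (G.displacement e n k) = f (G.dyadicPoint e (n + 1) (2 * k + 1)) -
      1 / 2 * (f (G.dyadicPoint e n k) + f (G.dyadicPoint e n (k + 1))) := by
  simp only [displacement, map_sub, map_add, map_smul, Finsupp.linearCombination_single, smul_eq_mul]
  ring

theorem linearCombination_linExt_displacement (a σ : V → ℝ) (e : E) (n k : ℕ) :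
    Finsupp.linearCombination ℝ (G.linExt a σ) (G.displacement e n k) = 0 := by
  have hw := G.weight_pos e
  rcases le_or_gt (2 ^ n) k with h | h
  · rw [displacement_of_ge e h, map_zero]
  have key : ∀ m j : ℕ, j ≤ 2 ^ m → G.linExt a σ (G.dyadicPoint e m j) =
      a (G.src e) + (a (G.tgt e) - a (G.src e)) * (j / 2 ^ m) := by
    intro m j hj
    have hj' : (j : ℝ) ≤ 2 ^ m := by exact_mod_cast hj
    refine (linExt_edgePoint a σ (e := e) (t := 1 / (2 * G.weight e) * (j / 2 ^ m))
      ⟨by positivity, mul_le_of_le_one_right (by positivity) ?_⟩).trans ?_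
    · rwa [div_le_one (by positivity)]
    · field_simp
  rw [linearCombination_displacement, key _ _ (by rw [pow_succ]; omega), key _ _ h.le, key _ _ h,
    pow_succ]
  push_cast
  field_simp
  ring

theorem linearCombination_edgeBump_displacement_of_ne {e e' : E} (h : e' ≠ e) (g : ℝ → ℝ)
    (n k : ℕ) : Finsupp.linearCombination ℝ (G.edgeBump e g) (G.displacement e' n k) = 0 := by
  have key : ∀ m j : ℕ, G.edgeBump e g (G.dyadicPoint e' m j) = 0 := fun m j =>
    edgeBump_of_ne (i := .inl e') (fun h' => h (Sum.inl_injective h')) _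
  rw [linearCombination_displacement, key, key, key]
  ring

/-- The potential of `displacement e n k`. -/
noncomputable def displacementPotential (G : MassiveGraph V E) (e : E) (n k : ℕ) : G.Cable → ℝ :=
  G.edgeBump e (tent (1 / (2 * G.weight e) * (k / 2 ^ n))
      (1 / (2 * G.weight e) * ((k + 1 : ℕ) / 2 ^ n)))

theorem displacementPotential_dyadicPoint (e : E) {n k : ℕ} (h : k < 2 ^ n) (m j : ℕ) :
    G.displacementPotential e n k (G.dyadicPoint e m j) =
      tent (1 / (2 * G.weight e) * (k / 2 ^ n)) (1 / (2 * G.weight e) * ((k + 1 : ℕ) / 2 ^ n))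
        (1 / (2 * G.weight e) * (j / 2 ^ m)) := by
  have hl := G.edgeLength_pos e
  refine edgeBump_edgePoint (fun t ht => tent_of_le (ht.trans (by positivity)))
    (fun t ht => tent_of_ge (le_trans ?_ ht)) _
  refine mul_le_of_le_one_right hl.le ?_
  rw [div_le_one (by positivity)]
  exact_mod_cast h

theorem linearCombination_displacementPotential_self (e : E) {n k : ℕ} (h : k < 2 ^ n) :
    Finsupp.linearCombination ℝ (G.displacementPotential e n k) (G.displacement e n k) =
      1 / (2 * G.weight e) / 2 ^ (n + 1) := by
  have hl := G.edgeLength_pos e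
  set ℓ := 1 / (2 * G.weight e) with hℓ
  have h1 : ℓ * (k / 2 ^ n) ≤ ℓ * ((k + 1 : ℕ) / 2 ^ n) := by gcongr; exact_mod_cast Nat.le_succ k
  have h2 : ℓ * ((2 * k + 1 : ℕ) / 2 ^ (n + 1)) =
      (ℓ * (k / 2 ^ n) + ℓ * ((k + 1 : ℕ) / 2 ^ n)) / 2 := by
    push_cast
    rw [pow_succ]
    field_simp
    ring
  rw [linearCombination_displacement, displacementPotential_dyadicPoint e h,
    displacementPotential_dyadicPoint e h, displacementPotential_dyadicPoint e h, ← hℓ,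
    tent_of_le le_rfl, tent_of_ge le_rfl, h2, tent_left (by linarith) le_rfl]
  push_cast
  rw [pow_succ]
  field_simp
  ring

/-- A dyadic interval of the same or a finer level, other than the base of the tent, lies in a piece
on which the tent is affine. The opposite pairing, of a fine tent with a coarse displacement, is
never needed. -/
theorem linearCombination_displacementPotential_of_le (e : E) {n k n' k' : ℕ} (h : k < 2 ^ n)
    (hn : n ≤ n') (hne : (n, k) ≠ (n', k')) :
    Finsupp.linearCombination ℝ (G.displacementPotential e n k) (G.displacement e n' k') = 0 := by
  have hl := G.edgeLength_pos e
  rw [linearCombination_displacement, displacementPotential_dyadicPoint e h,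
    displacementPotential_dyadicPoint e h, displacementPotential_dyadicPoint e h]
  set ℓ := 1 / (2 * G.weight e) with hℓ
  have h2 : ∀ (q : ℕ) (i : ℕ), ℓ * ((2 * i + 1 : ℕ) / 2 ^ (q + 1)) =
      (ℓ * (i / 2 ^ q) + ℓ * ((i + 1 : ℕ) / 2 ^ q)) / 2 := by
    intro q i
    push_cast
    rw [pow_succ]
    field_simp
    ring
  have hcmp : ∀ q i q' i' : ℕ, i * 2 ^ q' ≤ i' * 2 ^ q →
      ℓ * ((i : ℝ) / 2 ^ q) ≤ ℓ * ((i' : ℝ) / 2 ^ q') := by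
    intro q i q' i' hi
    refine mul_le_mul_of_nonneg_left ?_ hl.le
    rw [div_le_div_iff₀ (by positivity) (by positivity)]
    exact_mod_cast hi
  rw [h2]
  refine tent_midpoint (hcmp _ _ _ _ (by gcongr; omega)) ?_
  rw [← h2]
  rcases hn.eq_or_lt with rfl | hlt
  · have hk : k ≠ k' := fun hk => hne (by rw [hk])
    rcases lt_or_gt_of_ne hk with h' | h'
    · exact Or.inr (Or.inr (Or.inr (hcmp _ _ _ _ (Nat.mul_le_mul_right _ h'))))
    · exact Or.inl (hcmp _ _ _ _ (Nat.mul_le_mul_right _ h'))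
  · obtain ⟨m, rfl⟩ := Nat.exists_eq_add_of_lt hlt
    -- The kinks of the tent are `2 k`, `2 k + 1` and `2 k + 2` in units of level `n + 1`, that is
    -- `j * 2 ^ m` in units of level `n' = n + m + 1`; the fine interval does not straddle any of
    -- them.
    have dich : ∀ j, (k' + 1 ≤ j * 2 ^ m) ∨ j * 2 ^ m ≤ k' := fun j => by omega
    have hp : (2 : ℕ) ^ (n + m + 1) = 2 ^ m * (2 ^ n * 2) := by ring
    rcases dich (2 * k) with a | a
    · left
      refine hcmp _ _ _ _ ?_
      rw [hp]
      nlinarith [Nat.mul_le_mul_right (2 ^ n) a]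
    rcases dich (2 * k + 1) with b | b
    · right; left
      refine ⟨hcmp _ _ _ _ ?_, hcmp _ _ _ _ ?_⟩
      · rw [hp]
        nlinarith [Nat.mul_le_mul_right (2 ^ n) a]
      · rw [hp, pow_succ]
        nlinarith [Nat.mul_le_mul_right (2 ^ n * 2) b]
    rcases dich (2 * k + 2) with c | c
    · right; right; left
      refine ⟨hcmp _ _ _ _ ?_, hcmp _ _ _ _ ?_⟩
      · rw [hp, pow_succ]
        nlinarith [Nat.mul_le_mul_right (2 ^ n * 2) b]
      · rw [hp]
        nlinarith [Nat.mul_le_mul_right (2 ^ n) c]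
    · right; right; right
      refine hcmp _ _ _ _ ?_
      rw [hp]
      nlinarith [Nat.mul_le_mul_right (2 ^ n) c]

end MassiveGraph

/-! ### Decomposition of the field on the tree into independent noise -/

variable {d : ℕ} {α : ℝ} {hα : 0 < α}

/-- The innovation at a vertex `y` other than the root: its value minus the prediction from its
parent. -/
noncomputable def innovation (hα : 0 < α) (y : Fin (d + 1) × List (Fin d)) :
    (weightedTree d α hα).Cable →₀ ℝ :=
  Finsupp.single (.vertex (some y)) 1 -
    returnRatio d α • Finsupp.single (.vertex (treeParent y)) 1

/-- The potential of `innovation y`. -/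
noncomputable def innovationPotential (hα : 0 < α) (y : Fin (d + 1) × List (Fin d)) :
    (weightedTree d α hα).Cable → ℝ :=
  (returnRatio d α / α ^ y.2.length) •
      (weightedTree d α hα).linExt (subtreeFun d (returnRatio d α) y)
        fun x => 2 * (weightedTree d α hα).killing x

theorem linearCombination_innovation (f : (weightedTree d α hα).Cable → ℝ)
    (y : Fin (d + 1) × List (Fin d)) :
    Finsupp.linearCombination ℝ f (innovation hα y) =
      f (.vertex (some y)) - returnRatio d α * f (.vertex (treeParent y)) := by
  simp [innovation]

theorem linearCombination_innovationPotential (y z : Fin (d + 1) × List (Fin d)) :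
    Finsupp.linearCombination ℝ (innovationPotential hα y) (innovation hα z) =
      returnRatio d α / α ^ y.2.length * (subtreeFun d (returnRatio d α) y (some z) -
        returnRatio d α * subtreeFun d (returnRatio d α) y (treeParent z)) := by
  rw [linearCombination_innovation]
  simp only [innovationPotential, Pi.smul_apply, smul_eq_mul, MassiveGraph.linExt]
  ring

theorem linearCombination_innovationPotential_self (y : Fin (d + 1) × List (Fin d)) :
    Finsupp.linearCombination ℝ (innovationPotential hα y) (innovation hα y) =
      returnRatio d α / α ^ y.2.length := by
  have := subtreeFun_append (returnRatio d α) y.1 y.2 []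
  rw [linearCombination_innovationPotential, subtreeFun_parent,
    show subtreeFun d (returnRatio d α) y (some y) = 1 from this]
  simp

/-- Below `y` the potential is multiplied by `p` at each step, so it carries no innovation; outside
the subtree of `y` it vanishes at `z` and at the parent of `z`. -/
theorem linearCombination_innovationPotential_of_ne {y z : Fin (d + 1) × List (Fin d)}
    (h : y ≠ z) :
    Finsupp.linearCombination ℝ (innovationPotential hα y) (innovation hα z) = 0 := by
  rw [linearCombination_innovationPotential]
  by_cases hz : z.1 = y.1 ∧ y.2 <:+ z.2
  · obtain ⟨i, l⟩ := y
    obtain ⟨j, k⟩ := z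
    obtain ⟨rfl, m, hm⟩ := hz
    dsimp only at hm
    subst hm
    rcases m with _ | ⟨a, m⟩
    · exact absurd rfl h
    · rw [subtreeFun_append, show treeParent (j, (a :: m) ++ l) = some (j, m ++ l) from rfl,
        subtreeFun_append, List.length_cons, pow_succ]
      ring
  · rw [(subtreeFun_of_not_suffix _ hz).1, (subtreeFun_of_not_suffix _ hz).2]
    simp

/-- The functionals of the field that form an independent family: the innovations at the vertices
and the displacements at the dyadic midpoints of the cables. -/
noncomputable def noiseFunctional (hα : 0 < α) :
    (Fin (d + 1) × List (Fin d)) × Option (ℕ × ℕ) → (weightedTree d α hα).Cable →₀ ℝ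
  | (e, none) => innovation hα e
  | (e, some (n, k)) => (weightedTree d α hα).displacement e n k

/-- The variances of the functionals `noiseFunctional`. -/
noncomputable def noiseVariance (d : ℕ) (α : ℝ) :
    (Fin (d + 1) × List (Fin d)) × Option (ℕ × ℕ) → NNReal
  | (e, none) => (returnRatio d α / α ^ e.2.length).toNNReal
  | (e, some (n, k)) => if k < 2 ^ n then (1 / (2 * α ^ e.2.length) / 2 ^ (n + 1)).toNNReal else 0

/-- The potentials of the functionals `noiseFunctional`. -/
noncomputable def noisePotential (hα : 0 < α) :
    (Fin (d + 1) × List (Fin d)) × Option (ℕ × ℕ) → (weightedTree d α hα).Cable → ℝ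
  | (e, none) => innovationPotential hα e
  | (e, some (n, k)) => if k < 2 ^ n then (weightedTree d α hα).displacementPotential e n k else 0

theorem weight_weightedTree (e : Fin (d + 1) × List (Fin d)) :
    (weightedTree d α hα).weight e = α ^ e.2.length := by
  rw [← treeGeneration_treeParent]
  rfl

theorem represents_noise (hd : 0 < d) (j : (Fin (d + 1) × List (Fin d)) × Option (ℕ × ℕ)) :
    (weightedTree d α hα).Represents (noisePotential hα j) (noiseFunctional hα j) := by
  rcases j with ⟨e, _ | ⟨n, k⟩⟩
  · exact represents_innovation hα hd e
  · simp only [noisePotential, noiseFunctional]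
    split_ifs with h
    · exact MassiveGraph.represents_displacement e h
    · rw [MassiveGraph.displacement_of_ge e (not_lt.1 h)]
      simpa using (represents_innovation hα hd e).const_smul 0

/-- Potentials of innovations are affine along edges and do not see displacements; tents on
different cables have disjoint supports; on one cable the coarser tent is used. -/
theorem noise_uncorrelated {i j : (Fin (d + 1) × List (Fin d)) × Option (ℕ × ℕ)} (hij : i ≠ j) :
    Finsupp.linearCombination ℝ (noisePotential hα i) (noiseFunctional hα j) = 0 ∨
      Finsupp.linearCombination ℝ (noisePotential hα j) (noiseFunctional hα i) = 0 := by
  have h0 : ∀ L : (weightedTree d α hα).Cable →₀ ℝ,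
      Finsupp.linearCombination ℝ (0 : (weightedTree d α hα).Cable → ℝ) L = 0 := fun L => by
    simp
  have hlin : ∀ y e n k, Finsupp.linearCombination ℝ (innovationPotential hα y)
      ((weightedTree d α hα).displacement e n k) = 0 := fun y e n k => by
    have := MassiveGraph.linearCombination_linExt_displacement (G := weightedTree d α hα)
      (subtreeFun d (returnRatio d α) y) (fun x => 2 * (weightedTree d α hα).killing x) e n k
    rw [MassiveGraph.linearCombination_displacement] at this ⊢
    simp only [innovationPotential, Pi.smul_apply, smul_eq_mul]
    linear_combination (returnRatio d α / α ^ y.2.length) * this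
  rcases i with ⟨e, _ | ⟨n, k⟩⟩ <;> rcases j with ⟨e', _ | ⟨n', k'⟩⟩
  · exact Or.inl (linearCombination_innovationPotential_of_ne fun h => hij (by rw [h]))
  · exact Or.inl (hlin _ _ _ _)
  · exact Or.inr (hlin _ _ _ _)
  · simp only [noisePotential, noiseFunctional]
    by_cases h : k < 2 ^ n
    swap
    · rw [if_neg h]
      exact Or.inl (h0 _)
    by_cases h' : k' < 2 ^ n'
    swap
    · rw [if_neg h']
      exact Or.inr (h0 _)
    rw [if_pos h, if_pos h']
    by_cases he : e' = e
    · subst he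
      have hne : (n, k) ≠ (n', k') := fun h => hij (by rw [h])
      rcases le_total n n' with hn | hn
      · exact Or.inl (MassiveGraph.linearCombination_displacementPotential_of_le e' h hn hne)
      · exact Or.inr (MassiveGraph.linearCombination_displacementPotential_of_le e' h' hn hne.symm)
    · exact Or.inl (MassiveGraph.linearCombination_edgeBump_displacement_of_ne he _ _ _)

theorem noise_variance (j : (Fin (d + 1) × List (Fin d)) × Option (ℕ × ℕ)) :
    Finsupp.linearCombination ℝ (noisePotential hα j) (noiseFunctional hα j) =
      noiseVariance d α j := by
  have hp := returnRatio_pos d α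
  rcases j with ⟨e, _ | ⟨n, k⟩⟩
  · exact (linearCombination_innovationPotential_self e).trans
      (Real.coe_toNNReal _ (by positivity)).symm
  · simp only [noisePotential, noiseFunctional, noiseVariance]
    split_ifs with h
    · rw [MassiveGraph.linearCombination_displacementPotential_self e h, weight_weightedTree,
        Real.coe_toNNReal _ (by positivity)]
    · simp

theorem exists_represents_noiseFunctional (hd : 0 < d)
    (j : (Fin (d + 1) × List (Fin d)) × Option (ℕ × ℕ)) :
    ∀ x ∈ (noiseFunctional hα j).support,
      ∃ k, (weightedTree d α hα).Represents k (Finsupp.single x 1) := by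
  classical
  intro x hx
  have hv := exists_represents_vertex hα hd
  rcases j with ⟨e, _ | ⟨n, k⟩⟩
  · have := Finsupp.support_sub hx
    rcases Finset.mem_union.1 this with h | h
    · rw [Finset.mem_singleton.1 (Finsupp.support_single_subset h)]
      exact hv _
    · rw [Finset.mem_singleton.1 (Finsupp.support_single_subset (Finsupp.support_smul h))]
      exact hv _
  · have hD := MassiveGraph.exists_represents_dyadicPoint hv e
    rcases Finset.mem_union.1 (Finsupp.support_sub hx) with h | h
    · rw [Finset.mem_singleton.1 (Finsupp.support_single_subset h)]
      exact hD _ _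
    · rcases Finset.mem_union.1 (Finsupp.support_add h) with h | h <;>
      · rw [Finset.mem_singleton.1 (Finsupp.support_single_subset (Finsupp.support_smul h))]
        exact hD _ _

/-- This is the spatial Markov property in the form used below: one recursion down the tree and one
along each cable, driven by independent noise. The value at the root is not part of the noise, and
nothing is claimed about their joint law. -/
theorem exists_treeNoise {Ω : Type*} [MeasurableSpace Ω] {P : Measure Ω} (hd : 0 < d)
    {φ : (weightedTree d α hα).Cable → Ω → ℝ} (hφ : (weightedTree d α hα).IsGaussianFreeField P φ) :
    ∃ Y : (Fin (d + 1) × List (Fin d)) × Option (ℕ × ℕ) → Ω → ℝ,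
      IsGaussianNoise P Y (noiseVariance d α) ∧ ∀ᵐ ω ∂P,
        (∀ e, φ (.vertex (some e)) ω =
          returnRatio d α * φ (.vertex (treeParent e)) ω + Y (e, none) ω) ∧
        ∀ e n k, φ ((weightedTree d α hα).dyadicPoint e (n + 1) (2 * k + 1)) ω =
          1 / 2 * (φ ((weightedTree d α hα).dyadicPoint e n k) ω +
            φ ((weightedTree d α hα).dyadicPoint e n (k + 1)) ω) + Y (e, some (n, k)) ω := by
  obtain ⟨Y, hY, h⟩ := hφ.exists_isGaussianNoise (noiseFunctional hα) (noisePotential hα)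
    (represents_noise hd) (exists_represents_noiseFunctional hd) (noiseVariance d α)
    noise_variance fun i j => noise_uncorrelated
  refine ⟨Y, hY, ?_⟩
  filter_upwards [h] with ω hω
  refine ⟨fun e => ?_, fun e n k => ?_⟩
  · rw [hω (e, none), noiseFunctional, linearCombination_innovation]
    ring
  · rw [hω (e, some (n, k)), noiseFunctional, MassiveGraph.linearCombination_displacement]
    ring

/-! ### Positivity of Brownian bridges -/

/-- The probability that a Brownian bridge on an interval of length `ℓ`, with variance `2` per unit
length, from `a` to `b` stays positive. -/
noncomputable def bridgePositivity (ℓ a b : ℝ) : ℝ := 1 - Real.exp (-(max a 0 * max b 0 / ℓ))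

theorem bridgePositivity_of_nonpos_left (ℓ b : ℝ) {a : ℝ} (h : a ≤ 0) :
    bridgePositivity ℓ a b = 0 := by
  simp [bridgePositivity, max_eq_right h]

theorem bridgePositivity_of_nonpos_right (ℓ a : ℝ) {b : ℝ} (h : b ≤ 0) :
    bridgePositivity ℓ a b = 0 := by
  simp [bridgePositivity, max_eq_right h]

theorem bridgePositivity_nonneg {ℓ : ℝ} (hℓ : 0 < ℓ) (a b : ℝ) : 0 ≤ bridgePositivity ℓ a b := by
  refine sub_nonneg.2 (Real.exp_le_one_iff.2 (neg_nonpos.2 ?_))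
  exact div_nonneg (mul_nonneg (le_max_right _ _) (le_max_right _ _)) hℓ.le

theorem bridgePositivity_le_one (ℓ a b : ℝ) : bridgePositivity ℓ a b ≤ 1 :=
  sub_le_self _ (Real.exp_nonneg _)

@[fun_prop]
theorem measurable_bridgePositivity {X : Type*} [MeasurableSpace X] (ℓ : ℝ) {f g : X → ℝ}
    (hf : Measurable f) (hg : Measurable g) :
    Measurable fun x => bridgePositivity ℓ (f x) (g x) := by
  unfold bridgePositivity
  fun_prop

/-- The reflection principle for densities: the product expands into four exponentials, and
completing the squares turns each into a Gaussian density at `M` or `-M`, centred at `(a + b) / 2`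
or `(b - a) / 2`. -/
theorem bridgePositivity_mul_gaussianPDFReal {L a b M : ℝ} (hL : 0 < L) (ha : 0 < a) (hb : 0 < b)
    (hM : 0 < M) :
    gaussianPDFReal ((a + b) / 2) (L / 2).toNNReal M *
        (bridgePositivity (L / 2) a M * bridgePositivity (L / 2) M b) =
      (gaussianPDFReal ((a + b) / 2) (L / 2).toNNReal M -
        Real.exp (-(a * b / L)) * gaussianPDFReal ((b - a) / 2) (L / 2).toNNReal M) +
      (gaussianPDFReal ((a + b) / 2) (L / 2).toNNReal (-M) -
        Real.exp (-(a * b / L)) * gaussianPDFReal ((b - a) / 2) (L / 2).toNNReal (-M)) := by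
  simp only [bridgePositivity, gaussianPDFReal, max_eq_left ha.le, max_eq_left hb.le,
    max_eq_left hM.le, Real.coe_toNNReal _ (half_pos hL).le]
  set c := (√(2 * Real.pi * (L / 2)))⁻¹
  have e1 : -(-M - (a + b) / 2) ^ 2 / (2 * (L / 2)) =
      -(M - (a + b) / 2) ^ 2 / (2 * (L / 2)) + -(a * M / (L / 2)) + -(M * b / (L / 2)) := by
    field_simp
    ring
  have e2 : -(a * b / L) + -(M - (b - a) / 2) ^ 2 / (2 * (L / 2)) =
      -(M - (a + b) / 2) ^ 2 / (2 * (L / 2)) + -(a * M / (L / 2)) := by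
    field_simp
    ring
  have e3 : -(a * b / L) + -(-M - (b - a) / 2) ^ 2 / (2 * (L / 2)) =
      -(M - (a + b) / 2) ^ 2 / (2 * (L / 2)) + -(M * b / (L / 2)) := by
    field_simp
    ring
  have f1 := congrArg Real.exp e1
  have f2 := congrArg Real.exp e2
  have f3 := congrArg Real.exp e3
  simp only [Real.exp_add] at f1 f2 f3
  linear_combination -c * f1 + c * f2 + c * f3

/-- The values at `M` and `-M` in the density identity fold the integral over the half-line into one
over the whole line, where two Gaussian masses give `1 - exp (-a b / L)`. -/
theorem integral_bridgePositivity {L : ℝ} (hL : 0 < L) (a b : ℝ) :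
    ∫ x, bridgePositivity (L / 2) a (1 / 2 * (a + b) + x) *
      bridgePositivity (L / 2) (1 / 2 * (a + b) + x) b ∂gaussianReal 0 (L / 2).toNNReal =
    bridgePositivity L a b := by
  rcases le_or_gt a 0 with ha | ha
  · simp [bridgePositivity_of_nonpos_left _ _ ha]
  rcases le_or_gt b 0 with hb | hb
  · simp [bridgePositivity_of_nonpos_right _ _ hb]
  have hv : (L / 2).toNNReal ≠ 0 := by simpa using hL
  set F : ℝ → ℝ := fun M => bridgePositivity (L / 2) a M * bridgePositivity (L / 2) M b with hF
  have hmap := gaussianReal_map_const_add (μ := 0) (v := (L / 2).toNNReal) (1 / 2 * (a + b))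
  rw [show (0 : ℝ) + 1 / 2 * (a + b) = (a + b) / 2 by ring] at hmap
  have hFm : Measurable F := by unfold F; fun_prop
  have h1 : ∫ x, F (1 / 2 * (a + b) + x) ∂gaussianReal 0 (L / 2).toNNReal =
      ∫ M, F M ∂gaussianReal ((a + b) / 2) (L / 2).toNNReal := by
    rw [← hmap, integral_map (by fun_prop) hFm.aestronglyMeasurable]
  refine h1.trans ?_
  rw [integral_gaussianReal_eq_integral_smul hv]
  set h : ℝ → ℝ := fun M => gaussianPDFReal ((a + b) / 2) (L / 2).toNNReal M -
        Real.exp (-(a * b / L)) * gaussianPDFReal ((b - a) / 2) (L / 2).toNNReal M with hh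
  have hi1 := integrable_gaussianPDFReal ((a + b) / 2) (L / 2).toNNReal
  have hi2 := (integrable_gaussianPDFReal ((b - a) / 2) (L / 2).toNNReal).const_mul
    (Real.exp (-(a * b / L)))
  have hint : Integrable h := hi1.sub hi2
  have h2 : ∫ M, h M = bridgePositivity L a b := by
    refine (integral_sub hi1 hi2).trans ?_
    rw [integral_const_mul, integral_gaussianPDFReal_eq_one _ hv,
      integral_gaussianPDFReal_eq_one _ hv, bridgePositivity, max_eq_left ha.le, max_eq_left hb.le,
      mul_one]
  rw [← h2, ← intervalIntegral.integral_Iic_add_Ioi (b := 0) hint.integrableOn hint.integrableOn]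
  have h3 : ∫ M in Set.Ioi 0, h (-M) = ∫ M in Set.Iic 0, h M := by
    simp [integral_comp_neg_Ioi 0 h]
  have h4 : ∫ M, gaussianPDFReal ((a + b) / 2) (L / 2).toNNReal M • F M =
      ∫ M in Set.Ioi 0, gaussianPDFReal ((a + b) / 2) (L / 2).toNNReal M • F M := by
    refine (setIntegral_eq_integral_of_forall_compl_eq_zero fun M hM => ?_).symm
    simp [hF, bridgePositivity_of_nonpos_right _ _ (not_lt.1 hM)]
  rw [← h3, h4, add_comm (∫ M in Set.Ioi 0, h (-M)), ← integral_add hint.integrableOn hint.comp_neg.integrableOn]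
  refine setIntegral_congr_fun measurableSet_Ioi fun M hM => ?_
  exact bridgePositivity_mul_gaussianPDFReal hL ha hb hM

/-- The value at level `n` of the dyadic construction of a path from `a` to `b`, with displacements
`x` at the midpoints. -/
noncomputable def bridgeValue (a b : ℝ) (x : ℕ × ℕ → ℝ) : ℕ → ℕ → ℝ
  | 0, k => if k = 0 then a else b
  | n + 1, k =>
    if k % 2 = 0 then bridgeValue a b x n (k / 2)
    else 1 / 2 * (bridgeValue a b x n (k / 2) + bridgeValue a b x n (k / 2 + 1)) + x (n, k / 2)

theorem bridgeValue_double (a b : ℝ) (x : ℕ × ℕ → ℝ) (n k : ℕ) :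
    bridgeValue a b x (n + 1) (2 * k) = bridgeValue a b x n k := by
  rw [bridgeValue, if_pos (by omega), Nat.mul_div_cancel_left _ two_pos]

theorem bridgeValue_double_add_one (a b : ℝ) (x : ℕ × ℕ → ℝ) (n k : ℕ) :
    bridgeValue a b x (n + 1) (2 * k + 1) =
      1 / 2 * (bridgeValue a b x n k + bridgeValue a b x n (k + 1)) + x (n, k) := by
  rw [bridgeValue, if_neg (by omega), show (2 * k + 1) / 2 = k by omega]

theorem prod_range_two_mul (f : ℕ → ℝ) (N : ℕ) :
    ∏ k ∈ Finset.range (2 * N), f k = ∏ k ∈ Finset.range N, f (2 * k) * f (2 * k + 1) := by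
  induction N with
  | zero => simp
  | succ N ih =>
    rw [show 2 * (N + 1) = 2 * N + 1 + 1 by ring, Finset.prod_range_succ, Finset.prod_range_succ,
      Finset.prod_range_succ, ih, mul_assoc]

namespace IsGaussianNoise

theorem iIndepFun {Ω J : Type*} {Y : J → Ω → ℝ} [MeasurableSpace Ω] {P : Measure Ω}
    {v : J → NNReal} (hY : IsGaussianNoise P Y v) : ProbabilityTheory.iIndepFun Y P := by
  have h := hY.iIndep_sigmaOf (S := fun j : J => {j}) fun _ _ hij => by
    simpa [Function.onFun] using hij
  exact iIndepFun.comp (f := fun (j : J) ω (s : ({j} : Set J)) => Y s ω) h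
    (fun j x => x ⟨j, rfl⟩) fun j => measurable_pi_apply _

theorem comp {Ω J K : Type*} {Y : J → Ω → ℝ} [MeasurableSpace Ω] {P : Measure Ω}
    {v : J → NNReal} (hY : IsGaussianNoise P Y v) {f : K → J} (hf : Function.Injective f) :
    IsGaussianNoise P (Y ∘ f) (v ∘ f) where
  measurable k := hY.measurable (f k)
  isGaussianProcess := hY.isGaussianProcess.comp_right f
  map_eq k := hY.map_eq (f k)
  covariance_eq_zero _ _ hij := hY.covariance_eq_zero _ _ (hf.ne hij)

variable {Ω : Type*} {Y : ℕ × ℕ → Ω → ℝ}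

theorem measurable_bridgeValue (a b : ℝ) (n k : ℕ) :
    Measurable[sigmaOf Y {q | q.1 < n}] fun ω => bridgeValue a b (fun q => Y q ω) n k := by
  induction n generalizing k with
  | zero => exact measurable_const
  | succ n ih =>
    have ih' : ∀ k, Measurable[sigmaOf Y {q | q.1 < n + 1}]
        fun ω => bridgeValue a b (fun q => Y q ω) n k := fun k =>
      (ih k).mono (sigmaOf_mono fun q (hq : q.1 < n) => Nat.lt_succ_of_lt hq) le_rfl
    simp only [bridgeValue]
    split_ifs
    · exact ih' _
    · exact (((ih' _).add (ih' _)).const_mul _).add (measurable_sigmaOf (Nat.lt_succ_self n))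

variable [MeasurableSpace Ω] {P : Measure Ω} {v : ℕ × ℕ → NNReal} (hY : IsGaussianNoise P Y v)
include hY

/-- The displacements of level `n` are independent of all earlier levels. Integrating them out
first, interval by interval, merges the two halves of each dyadic interval. -/
theorem integral_prod_bridgePositivity_succ {ℓ : ℝ} (hℓ : 0 < ℓ)
    (hv : ∀ n k, k < 2 ^ n → v (n, k) = (ℓ / 2 ^ (n + 1)).toNNReal) (a b : ℝ) (n : ℕ) :
    ∫ ω, ∏ k ∈ Finset.range (2 ^ (n + 1)), bridgePositivity (ℓ / 2 ^ (n + 1))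
        (bridgeValue a b (fun q => Y q ω) (n + 1) k)
        (bridgeValue a b (fun q => Y q ω) (n + 1) (k + 1)) ∂P =
      ∫ ω, ∏ k ∈ Finset.range (2 ^ n), bridgePositivity (ℓ / 2 ^ n)
        (bridgeValue a b (fun q => Y q ω) n k)
        (bridgeValue a b (fun q => Y q ω) n (k + 1)) ∂P := by
  have hprob := hY.isProbabilityMeasure
  set A : Ω → ℕ → ℝ := fun ω k => bridgeValue a b (fun q => Y q ω) n k with hA
  set X : Ω → Fin (2 ^ n) → ℝ := fun ω k => Y (n, k) ω with hX
  have hAm' : Measurable[sigmaOf Y {q | q.1 < n}] A :=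
    @measurable_pi_lambda _ _ _ (sigmaOf Y {q | q.1 < n}) _ _ fun k => measurable_bridgeValue a b n k
  have hXm' : Measurable[sigmaOf Y {q | q.1 = n}] X :=
    @measurable_pi_lambda _ _ _ (sigmaOf Y {q | q.1 = n}) _ _ fun k => measurable_sigmaOf rfl
  have hAm : Measurable A := hAm'.mono (hY.sigmaOf_le _) le_rfl
  have hXm : Measurable X := hXm'.mono (hY.sigmaOf_le _) le_rfl
  have hind : IndepFun A X P := by
    refine indep_of_indep_of_le_left (indep_of_indep_of_le_right (hY.indep_sigmaOf
      (A := {q | q.1 < n}) (B := {q | q.1 = n}) ?_) hXm'.comap_le) hAm'.comap_le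
    exact Set.disjoint_left.2 fun q (h : q.1 < n) h' => absurd (h' : q.1 = n) h.ne
  have hlawX : P.map X = Measure.pi fun _ : Fin (2 ^ n) =>
      gaussianReal 0 (ℓ / 2 ^ n / 2).toNNReal := by
    have h := (iIndepFun_iff_map_fun_eq_pi_map
      (fun k : Fin (2 ^ n) => (hY.measurable (n, (k : ℕ))).aemeasurable)).1
      (hY.iIndepFun.precomp (g := fun k : Fin (2 ^ n) => (n, (k : ℕ)))
        fun i j hij => Fin.ext (Prod.mk.inj hij).2)
    refine h.trans ?_
    congr 1
    funext k
    rw [hY.map_eq, hv n k k.2, pow_succ, div_mul_eq_div_div]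
  have hjoint := (indepFun_iff_map_prod_eq_prod_map_map hAm.aemeasurable hXm.aemeasurable).1 hind
  set H : (ℕ → ℝ) × (Fin (2 ^ n) → ℝ) → ℝ := fun q => ∏ k : Fin (2 ^ n),
    bridgePositivity (ℓ / 2 ^ n / 2) (q.1 k) (1 / 2 * (q.1 k + q.1 (k + 1)) + q.2 k) *
    bridgePositivity (ℓ / 2 ^ n / 2) (1 / 2 * (q.1 k + q.1 (k + 1)) + q.2 k) (q.1 (k + 1)) with hH
  have hHm : Measurable H := by
    unfold H
    refine Finset.measurable_fun_prod _ fun k _ => ?_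
    fun_prop
  have hH1 : ∀ q, ‖H q‖ ≤ 1 := by
    intro q
    have hp : 0 < ℓ / 2 ^ n / 2 := by positivity
    rw [Real.norm_eq_abs, hH, Finset.abs_prod]
    refine Finset.prod_le_one (fun _ _ => abs_nonneg _) fun k _ => ?_
    rw [abs_of_nonneg (mul_nonneg (bridgePositivity_nonneg hp _ _)
      (bridgePositivity_nonneg hp _ _))]
    exact mul_le_one₀ (bridgePositivity_le_one _ _ _) (bridgePositivity_nonneg hp _ _)
      (bridgePositivity_le_one _ _ _)
  have e1 : ∀ ω, ∏ k ∈ Finset.range (2 ^ (n + 1)), bridgePositivity (ℓ / 2 ^ (n + 1))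
        (bridgeValue a b (fun q => Y q ω) (n + 1) k)
        (bridgeValue a b (fun q => Y q ω) (n + 1) (k + 1)) = H (A ω, X ω) := by
    intro ω
    rw [pow_succ', prod_range_two_mul, hH, ← Fin.prod_univ_eq_prod_range
      fun k => bridgePositivity (ℓ / 2 ^ (n + 1))
        (bridgeValue a b (fun q => Y q ω) (n + 1) (2 * k))
        (bridgeValue a b (fun q => Y q ω) (n + 1) (2 * k + 1)) *
        bridgePositivity (ℓ / 2 ^ (n + 1))
        (bridgeValue a b (fun q => Y q ω) (n + 1) (2 * k + 1))
        (bridgeValue a b (fun q => Y q ω) (n + 1) (2 * k + 1 + 1))]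
    refine Finset.prod_congr rfl fun k _ => ?_
    rw [show 2 * (k : ℕ) + 1 + 1 = 2 * (k + 1) by ring, bridgeValue_double, bridgeValue_double,
      bridgeValue_double_add_one, pow_succ, ← div_div]
  have hinner : ∀ u : ℕ → ℝ, ∫ x, H (u, x) ∂(Measure.pi fun _ : Fin (2 ^ n) =>
      gaussianReal 0 (ℓ / 2 ^ n / 2).toNNReal) =
      ∏ k ∈ Finset.range (2 ^ n), bridgePositivity (ℓ / 2 ^ n) (u k) (u (k + 1)) := by
    intro u
    rw [← Fin.prod_univ_eq_prod_range fun k => bridgePositivity (ℓ / 2 ^ n) (u k) (u (k + 1))]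
    refine (integral_fintype_prod_eq_prod (fun (k : Fin (2 ^ n)) x =>
      bridgePositivity (ℓ / 2 ^ n / 2) (u k) (1 / 2 * (u k + u (k + 1)) + x) *
      bridgePositivity (ℓ / 2 ^ n / 2) (1 / 2 * (u k + u (k + 1)) + x) (u (k + 1)))).trans ?_
    exact Finset.prod_congr rfl fun k _ => integral_bridgePositivity (by positivity) _ _
  have hmapA : IsProbabilityMeasure (P.map A) := Measure.isProbabilityMeasure_map hAm.aemeasurable
  calc _ = ∫ ω, H (A ω, X ω) ∂P := integral_congr_ae (Eventually.of_forall e1)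
    _ = ∫ q, H q ∂(P.map fun ω => (A ω, X ω)) :=
      (integral_map (hAm.prodMk hXm).aemeasurable hHm.aestronglyMeasurable).symm
    _ = ∫ u, ∫ x, H (u, x) ∂(Measure.pi fun _ : Fin (2 ^ n) =>
          gaussianReal 0 (ℓ / 2 ^ n / 2).toNNReal) ∂(P.map A) := by
      rw [hjoint, hlawX]
      exact integral_prod _ (Integrable.of_bound hHm.aestronglyMeasurable 1
        (Eventually.of_forall hH1))
    _ = _ := by
      simp only [hinner]
      rw [integral_map hAm.aemeasurable]
      refine Measurable.aestronglyMeasurable ?_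
      refine Finset.measurable_fun_prod _ fun k _ => ?_
      fun_prop

theorem integral_prod_bridgePositivity {ℓ : ℝ} (hℓ : 0 < ℓ)
    (hv : ∀ n k, k < 2 ^ n → v (n, k) = (ℓ / 2 ^ (n + 1)).toNNReal) (a b : ℝ) (n : ℕ) :
    ∫ ω, ∏ k ∈ Finset.range (2 ^ n), bridgePositivity (ℓ / 2 ^ n)
        (bridgeValue a b (fun q => Y q ω) n k)
        (bridgeValue a b (fun q => Y q ω) n (k + 1)) ∂P = bridgePositivity ℓ a b := by
  have hprob := hY.isProbabilityMeasure
  induction n with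
  | zero => simp [bridgeValue]
  | succ n ih => rw [hY.integral_prod_bridgePositivity_succ hℓ hv, ih]

/-- The product of the positivity probabilities over level `n` is at most the indicator that all
values of that level are positive, since a nonpositive value kills a factor. Its expectation does
not depend on `n`. Only this inequality is needed, so continuity of the bridge plays no role. -/
theorem le_measure_bridgeValue_pos {ℓ : ℝ} (hℓ : 0 < ℓ)
    (hv : ∀ n k, k < 2 ^ n → v (n, k) = (ℓ / 2 ^ (n + 1)).toNNReal) (a b : ℝ) :
    bridgePositivity ℓ a b ≤
      P.real {ω | ∀ n, ∀ k ≤ 2 ^ n, 0 < bridgeValue a b (fun q => Y q ω) n k} := by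
  have hprob := hY.isProbabilityMeasure
  have hm : ∀ n k, Measurable fun ω => bridgeValue a b (fun q => Y q ω) n k := fun n k =>
    (measurable_bridgeValue a b n k).mono (hY.sigmaOf_le _) le_rfl
  set S : ℕ → Set Ω := fun n => {ω | ∀ k ≤ 2 ^ n, 0 < bridgeValue a b (fun q => Y q ω) n k} with hS
  have hSm : ∀ n, MeasurableSet (S n) := fun n => by
    simp only [hS, Set.ofPred_forall]
    exact MeasurableSet.iInter fun k => MeasurableSet.iInter fun _ =>
      measurableSet_lt measurable_const (hm n k)
  have hanti : Antitone S := antitone_nat_of_succ_le fun n ω hω k hk => by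
    rw [← bridgeValue_double]
    exact hω _ (by rw [pow_succ]; omega)
  have hlow : ∀ n, bridgePositivity ℓ a b ≤ P.real (S n) := by
    intro n
    have hℓn : 0 < ℓ / 2 ^ n := by positivity
    rw [← hY.integral_prod_bridgePositivity hℓ hv a b n, ← integral_indicator_one (hSm n)]
    refine integral_mono_of_nonneg (Eventually.of_forall fun ω => Finset.prod_nonneg fun k _ =>
      bridgePositivity_nonneg hℓn _ _) ((integrable_const 1).indicator (hSm n))
      (Eventually.of_forall fun ω => ?_)
    dsimp only
    by_cases hω : ω ∈ S n
    · rw [Set.indicator_of_mem hω]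
      exact Finset.prod_le_one (fun k _ => bridgePositivity_nonneg hℓn _ _)
        fun k _ => bridgePositivity_le_one _ _ _
    · rw [Set.indicator_of_notMem hω]
      simp only [hS, Set.mem_ofPred_eq, not_forall, not_lt] at hω
      obtain ⟨k, hk, h0⟩ := hω
      -- The point `k` is the right end of interval `k - 1`; for `k = 0` truncated subtraction gives
      -- interval 0, of which it is the left end.
      refine (Finset.prod_eq_zero (i := k - 1) (Finset.mem_range.2 ?_) ?_).le
      · have : 0 < 2 ^ n := by positivity
        omega
      · rcases Nat.eq_zero_or_pos k with rfl | hk0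
        · exact bridgePositivity_of_nonpos_left _ _ h0
        · rw [Nat.sub_add_cancel hk0]
          exact bridgePositivity_of_nonpos_right _ _ h0
  have hlim := tendsto_measure_iInter_atTop (μ := P) (fun n => (hSm n).nullMeasurableSet) hanti
    ⟨0, measure_ne_top _ _⟩
  have hlim' := (ENNReal.tendsto_toReal (measure_ne_top P _)).comp hlim
  have : {ω | ∀ n, ∀ k ≤ 2 ^ n, 0 < bridgeValue a b (fun q => Y q ω) n k} = ⋂ n, S n := by
    ext ω
    simp [hS]
  rw [this]
  exact ge_of_tendsto' hlim' hlow

end IsGaussianNoise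

/-! ### Gaussian tails and independence of events -/

/-- By symmetry; it is an inequality because the variance may be zero. -/
theorem half_le_gaussianReal_Ici (v : NNReal) : 1 / 2 ≤ (gaussianReal 0 v).real (Set.Ici 0) := by
  have h : (gaussianReal 0 v).real (Set.Iic 0) = (gaussianReal 0 v).real (Set.Ici 0) := by
    have hm := gaussianReal_map_neg (μ := 0) (v := v)
    rw [neg_zero] at hm
    nth_rewrite 1 [← hm]
    rw [map_measureReal_apply (by fun_prop) measurableSet_Iic]
    congr 1
    ext x
    simp
  have h2 := measureReal_union_le (μ := gaussianReal 0 v) (Set.Iic 0) (Set.Ici 0)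
  rw [Set.Iic_union_Ici, probReal_univ] at h2
  linarith

theorem gaussianReal_Ici_pos (c : ℝ) : 0 < (gaussianReal 0 1).real (Set.Ici c) := by
  refine ENNReal.toReal_pos (fun h => ?_) (measure_ne_top _ _)
  have := gaussianReal_absolutelyContinuous' 0 one_ne_zero h
  simp at this

theorem gaussianReal_sq_Ici {s : ℝ} (hs : 0 < s) (c : ℝ) :
    (gaussianReal 0 (s ^ 2).toNNReal).real (Set.Ici (c * s)) =
      (gaussianReal 0 1).real (Set.Ici c) := by
  have hm := gaussianReal_map_const_mul (μ := 0) (v := 1) s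
  have hv : NNReal.mk (s ^ 2) (sq_nonneg s) * 1 = (s ^ 2).toNNReal := by
    rw [mul_one]
    ext
    rw [Real.coe_toNNReal _ (sq_nonneg s)]
    rfl
  rw [mul_zero, hv] at hm
  rw [← hm, map_measureReal_apply (by fun_prop) measurableSet_Ici]
  congr 1
  ext x
  simp only [Set.mem_preimage, Set.mem_Ici]
  rw [mul_comm c, mul_le_mul_iff_right₀ hs]

theorem sigmaOf_comp_le {Ω J K : Type*} {Y : J → Ω → ℝ} {f : K → J} {S : Set K} {T : Set J}
    (h : ∀ s ∈ S, f s ∈ T) : sigmaOf (Y ∘ f) S ≤ sigmaOf Y T := by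
  rw [sigmaOf, ← measurable_iff_comap_le]
  exact @measurable_pi_lambda _ _ _ (sigmaOf Y T) _ _
    fun s => IsGaussianNoise.measurable_sigmaOf (h s s.2)

theorem IsGaussianNoise.measureReal_inter {Ω J : Type*} [MeasurableSpace Ω] {P : Measure Ω}
    {Y : J → Ω → ℝ} {v : J → NNReal} (hY : IsGaussianNoise P Y v) {S T : Set J}
    (hST : Disjoint S T) {A B : Set Ω} (hA : MeasurableSet[sigmaOf Y S] A)
    (hB : MeasurableSet[sigmaOf Y T] B) : P.real (A ∩ B) = P.real A * P.real B := by
  rw [Measure.real, (Indep_iff _ _ _).1 (hY.indep_sigmaOf hST) A B hA hB, ENNReal.toReal_mul]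
  rfl

/-! ### Good edges -/

section percolation

variable {d : ℕ} {α : ℝ}

/-- The value that the field is required to exceed at the vertices of generation `n`. -/
noncomputable def threshold (d : ℕ) (α : ℝ) (n : ℕ) : ℝ := √(returnRatio d α) * √α / √α ^ n

theorem threshold_pos (hα : 0 < α) (n : ℕ) : 0 < threshold d α n := by
  have := Real.sqrt_pos.2 (returnRatio_pos d α)
  have := Real.sqrt_pos.2 hα
  unfold threshold
  positivity

theorem threshold_succ (hα : 0 < α) (n : ℕ) :
    threshold d α (n + 1) = √(returnRatio d α) / √α ^ n := by
  have := Real.sqrt_pos.2 hα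
  rw [threshold, pow_succ]
  field_simp

/-- The threshold is the standard deviation of the innovation in the same generation, so the chance
of exceeding a fixed multiple of it is the same everywhere. -/
theorem threshold_succ_sq (hα : 0 < α) (n : ℕ) :
    threshold d α (n + 1) ^ 2 = returnRatio d α / α ^ n := by
  rw [threshold_succ hα, div_pow, Real.sq_sqrt (returnRatio_pos d α).le, ← pow_mul, mul_comm n,
    pow_mul, Real.sq_sqrt hα.le]

/-- Divided by the cable length `1 / (2 α ^ n)`, this product is independent of `n`: the bridge
estimate is scale invariant. -/
theorem threshold_mul_threshold_succ (hα : 0 < α) (n : ℕ) :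
    threshold d α n * threshold d α (n + 1) = returnRatio d α * √α / α ^ n := by
  have h : threshold d α n = √α * threshold d α (n + 1) := by
    rw [threshold_succ hα, threshold]
    ring
  rw [h, mul_assoc, ← sq, threshold_succ_sq hα]
  ring

theorem threshold_mono (hα : 0 < α) (hα1 : α < 1) : Monotone (threshold d α) := by
  have h := Real.sqrt_pos.2 hα
  have h1 : √α ≤ 1 := Real.sqrt_le_one.2 hα1.le
  intro m n hmn
  unfold threshold
  exact div_le_div_of_nonneg_left (by positivity) (by positivity)
    (pow_le_pow_of_le_one h.le h1 hmn)

theorem tendsto_threshold (hα : 0 < α) (hα1 : α < 1) : Tendsto (threshold d α) atTop atTop := by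
  have h := Real.sqrt_pos.2 hα
  have hp := Real.sqrt_pos.2 (returnRatio_pos d α)
  have h1 : √α < 1 := by rwa [Real.sqrt_lt' one_pos, one_pow]
  have : Tendsto (fun n => √(returnRatio d α) * √α * (√α ^ n)⁻¹) atTop atTop := by
    refine Tendsto.const_mul_atTop (by positivity) ?_
    exact (tendsto_pow_atTop_nhdsWithin_zero_of_lt_one h h1).inv_tendsto_nhdsGT_zero
  exact this

variable {Ω : Type*} (Y : (Fin (d + 1) × List (Fin d)) × Option (ℕ × ℕ) → Ω → ℝ)

/-- The event that the innovation at `e` exceeds the threshold, and that the bridge on the cable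
that leads to `e` stays above minus half of the interpolation of the thresholds. -/
def goodEdge (α : ℝ) (e : Fin (d + 1) × List (Fin d)) : Set Ω :=
  {ω | threshold d α (e.2.length + 1) ≤ Y (e, none) ω} ∩
    {ω | ∀ n, ∀ k ≤ 2 ^ n, 0 < bridgeValue (threshold d α e.2.length / 2)
      (threshold d α (e.2.length + 1) / 2) (fun q => Y (e, some q) ω) n k}

theorem measurableSet_innovation (c : ℝ) (e : Fin (d + 1) × List (Fin d)) :
    MeasurableSet[sigmaOf Y {(e, none)}] {ω | c ≤ Y (e, none) ω} :=
  IsGaussianNoise.measurable_sigmaOf (Set.mem_singleton _) measurableSet_Ici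

theorem measurableSet_bridge (a b : ℝ) (e : Fin (d + 1) × List (Fin d)) :
    MeasurableSet[sigmaOf Y (Set.range fun q => (e, some q))]
      {ω | ∀ n, ∀ k ≤ 2 ^ n, 0 < bridgeValue a b (fun q => Y (e, some q) ω) n k} := by
  simp only [Set.ofPred_forall]
  refine MeasurableSet.iInter fun n => MeasurableSet.iInter fun k => MeasurableSet.iInter fun _ => ?_
  have hm : Measurable[sigmaOf Y (Set.range fun q => (e, some q))]
      fun ω => bridgeValue a b (fun q => Y (e, some q) ω) n k :=
    (IsGaussianNoise.measurable_bridgeValue (Y := Y ∘ fun q => (e, some q)) a b n k).mono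
      (sigmaOf_comp_le fun q _ => Set.mem_range_self q) le_rfl
  exact hm measurableSet_Ioi

theorem measurableSet_goodEdge (e : Fin (d + 1) × List (Fin d)) :
    MeasurableSet[sigmaOf Y {j | j.1 = e}] (goodEdge Y α e) := by
  refine MeasurableSet.inter ?_ ?_
  · refine IsGaussianNoise.sigmaOf_mono ?_ _ (measurableSet_innovation Y _ e)
    rintro _ rfl
    rfl
  · refine IsGaussianNoise.sigmaOf_mono ?_ _ (measurableSet_bridge Y _ _ e)
    rintro _ ⟨q, rfl⟩
    rfl

/-- The event that some descendant of `e`, `n` generations below `e`, is joined to `e` by good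
edges. -/
def survives (α : ℝ) : ℕ → Fin (d + 1) × List (Fin d) → Set Ω
  | 0, _ => Set.univ
  | n + 1, e => ⋃ a, goodEdge Y α (e.1, a :: e.2) ∩ survives α n (e.1, a :: e.2)

/-- The indices that belong to proper descendants of `e`. -/
def descendants (e : Fin (d + 1) × List (Fin d)) :
    Set ((Fin (d + 1) × List (Fin d)) × Option (ℕ × ℕ)) :=
  {j | j.1.1 = e.1 ∧ e.2 <:+ j.1.2 ∧ e.2 ≠ j.1.2}

/-- The indices that belong to `e` or its descendants. -/
def subtreeIndices (e : Fin (d + 1) × List (Fin d)) :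
    Set ((Fin (d + 1) × List (Fin d)) × Option (ℕ × ℕ)) :=
  {j | j.1.1 = e.1 ∧ e.2 <:+ j.1.2}

theorem descendants_subset_subtreeIndices (e : Fin (d + 1) × List (Fin d)) :
    descendants e ⊆ subtreeIndices e := fun _ h => ⟨h.1, h.2.1⟩

theorem subtreeIndices_child_subset (e : Fin (d + 1) × List (Fin d)) (a : Fin d) :
    subtreeIndices (e.1, a :: e.2) ⊆ descendants e := by
  rintro j ⟨h1, h2⟩
  refine ⟨h1, (List.suffix_cons a e.2).trans h2, fun h => ?_⟩
  have := h2.length_le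
  rw [← h] at this
  simp at this

theorem measurableSet_survives (n : ℕ) (e : Fin (d + 1) × List (Fin d)) :
    MeasurableSet[sigmaOf Y (descendants e)] (survives Y α n e) := by
  induction n generalizing e with
  | zero => exact MeasurableSet.univ
  | succ n ih =>
    refine MeasurableSet.iUnion fun a => MeasurableSet.inter ?_ ?_
    · refine IsGaussianNoise.sigmaOf_mono ?_ _ (measurableSet_goodEdge Y _)
      refine Set.Subset.trans ?_ (subtreeIndices_child_subset e a)
      rintro j (hj : j.1 = _)
      exact ⟨by rw [hj], by rw [hj]⟩
    · exact IsGaussianNoise.sigmaOf_mono ((descendants_subset_subtreeIndices _).trans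
        (subtreeIndices_child_subset e a)) _ (ih _)

theorem disjoint_subtreeIndices (e : Fin (d + 1) × List (Fin d)) :
    Pairwise (Function.onFun Disjoint fun a : Fin d => subtreeIndices (e.1, a :: e.2)) := by
  intro a b hab
  refine Set.disjoint_left.2 fun j h h' => hab ?_
  have := (List.suffix_of_suffix_length_le h.2 h'.2 (by simp)).eq_of_length (by simp)
  exact (List.cons.inj this).1

variable {Y} [MeasurableSpace Ω] {P : Measure Ω} (hY : IsGaussianNoise P Y (noiseVariance d α))
include hY

theorem measureReal_innovation (hα : 0 < α) (c : ℝ) (e : Fin (d + 1) × List (Fin d)) :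
    P.real {ω | c * threshold d α (e.2.length + 1) ≤ Y (e, none) ω} =
      (gaussianReal 0 1).real (Set.Ici c) := by
  rw [← gaussianReal_sq_Ici (threshold_pos (d := d) hα (e.2.length + 1)) c, threshold_succ_sq hα]
  have := hY.map_eq (e, none)
  rw [noiseVariance] at this
  rw [← this, map_measureReal_apply (hY.measurable _) measurableSet_Ici]
  rfl

/-- Starting from halved thresholds, the exponent is `p √α / 2`. With `x = exp (-(p √α / 2)) ≤ 1`
one has `1 - x ≥ (1 - x ^ 2) / 2`, which accounts for the factor `1 / 2`, and `p ≥ 1 / (d α + 1)`.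
-/
theorem le_measureReal_bridge (hα : 0 < α) (e : Fin (d + 1) × List (Fin d)) :
    1 / 2 * (1 - Real.exp (-(√α / (d * α + 1)))) ≤
      P.real {ω | ∀ n, ∀ k ≤ 2 ^ n, 0 < bridgeValue (threshold d α e.2.length / 2)
        (threshold d α (e.2.length + 1) / 2) (fun q => Y (e, some q) ω) n k} := by
  have hs := Real.sqrt_pos.2 hα
  have hn : IsGaussianNoise P (Y ∘ fun q => (e, some q)) (noiseVariance d α ∘ fun q => (e, some q)) :=
    hY.comp fun q q' h => Option.some_injective _ (Prod.mk.inj h).2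
  have hℓ : 0 < 1 / (2 * α ^ e.2.length) := by positivity
  refine le_trans ?_ (hn.le_measure_bridgeValue_pos hℓ (fun n k hk => by
    simp only [Function.comp, noiseVariance, if_pos hk]) _ _)
  have ht := threshold_pos (d := d) hα e.2.length
  have ht' := threshold_pos (d := d) hα (e.2.length + 1)
  have hval : max (threshold d α e.2.length / 2) 0 * max (threshold d α (e.2.length + 1) / 2) 0 /
      (1 / (2 * α ^ e.2.length)) = returnRatio d α * √α / 2 := by
    rw [max_eq_left (by positivity), max_eq_left (by positivity)]
    have h := threshold_mul_threshold_succ (d := d) hα e.2.length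
    have h2 : threshold d α e.2.length * threshold d α (e.2.length + 1) * α ^ e.2.length =
      returnRatio d α * √α := by
      rw [h, div_mul_cancel₀ _ (by positivity)]
    rw [← h2]
    field_simp
  rw [bridgePositivity, hval]
  have hr : √α / (d * α + 1) ≤ returnRatio d α * √α := by
    have h0 : (0 : ℝ) ≤ d * α := by positivity
    rw [returnRatio, div_eq_inv_mul]
    gcongr
    exact max_le (by linarith) (by linarith)
  have h1 : Real.exp (-(returnRatio d α * √α)) ≤ Real.exp (-(√α / (d * α + 1))) :=
    Real.exp_le_exp.2 (neg_le_neg hr)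
  have h2 : Real.exp (-(returnRatio d α * √α)) = Real.exp (-(returnRatio d α * √α / 2)) ^ 2 := by
    rw [← Real.exp_nat_mul]
    congr 1
    push_cast
    ring
  have h3 : Real.exp (-(returnRatio d α * √α / 2)) ≤ 1 := by
    refine Real.exp_le_one_iff.2 (neg_nonpos.2 ?_)
    have := returnRatio_pos d α
    positivity
  nlinarith

end percolation

/-! ### Survival of good paths and independent attempts along a ray -/

section survival

variable {d : ℕ} {α : ℝ} {Ω : Type*} (Y : (Fin (d + 1) × List (Fin d)) × Option (ℕ × ℕ) → Ω → ℝ)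

theorem survives_antitone (e : Fin (d + 1) × List (Fin d)) :
    Antitone fun n => survives Y α n e := by
  refine antitone_nat_of_succ_le fun n => ?_
  induction n generalizing e with
  | zero => exact Set.subset_univ _
  | succ n ih => exact Set.iUnion_mono fun a => Set.inter_subset_inter_right _ (ih _)

/-- The event that `e` is joined by good edges to descendants in arbitrarily high generations. -/
def survivesForever (α : ℝ) (e : Fin (d + 1) × List (Fin d)) : Set Ω := ⋂ n, survives Y α n e

theorem measurableSet_survivesForever (e : Fin (d + 1) × List (Fin d)) :
    MeasurableSet[sigmaOf Y (descendants e)] (survivesForever Y α e) :=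
  MeasurableSet.iInter fun n => measurableSet_survives Y n e

/-- The descendant of the vertex `(0, [u, …, u])` in generation `i + 1` which is reached by `j`
steps in direction `v`. -/
def spine (u v : Fin d) (i j : ℕ) : Fin (d + 1) × List (Fin d) :=
  (0, List.replicate j v ++ List.replicate i u)

theorem length_spine (u v : Fin d) (i j : ℕ) : (spine u v i j).2.length = j + i := by
  simp [spine]

/-- The contribution to the value of the field at `spine u v i j` of the innovations along the path
to it from `spine u v i 0`. -/
noncomputable def spineSum (α : ℝ) (u v : Fin d) (i : ℕ) : ℕ → Ω → ℝ
  | 0, _ => 0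
  | j + 1, ω => returnRatio d α * spineSum α u v i j ω + Y (spine u v i (j + 1), none) ω

/-- The indices of the variables that enter `spineSum`. -/
def spineIndices (u v : Fin d) (i j : ℕ) :
    Set ((Fin (d + 1) × List (Fin d)) × Option (ℕ × ℕ)) :=
  {q | ∃ k < j, q = (spine u v i (k + 1), none)}

theorem measurable_spineSum (u v : Fin d) (i j : ℕ) :
    Measurable[sigmaOf Y (spineIndices u v i j)] (spineSum Y α u v i j) := by
  induction j with
  | zero => exact measurable_const
  | succ j ih =>
    have hsub : spineIndices u v i j ⊆ spineIndices u v i (j + 1) :=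
      fun q ⟨k, hk, hq⟩ => ⟨k, Nat.lt_succ_of_lt hk, hq⟩
    exact ((ih.mono (IsGaussianNoise.sigmaOf_mono hsub) le_rfl).const_mul _).add
      (IsGaussianNoise.measurable_sigmaOf ⟨j, Nat.lt_succ_self j, rfl⟩)

theorem spine_mem_subtree (u v : Fin d) (i j : ℕ) :
    v :: List.replicate i u <:+ (spine u v i (j + 1)).2 := by
  refine ⟨List.replicate j v, ?_⟩
  simp [spine, List.replicate_succ']

/-- The event that the innovations along the spine lift the field at `spine u v i (j + 1)` well above
the threshold, and that this vertex survives forever. -/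
def startEvent (α : ℝ) (u v : Fin d) (i j : ℕ) : Set Ω :=
  {ω | 0 ≤ spineSum Y α u v i j ω} ∩
    ({ω | 2 * threshold d α ((spine u v i (j + 1)).2.length + 1) ≤ Y (spine u v i (j + 1), none) ω} ∩
      survivesForever Y α (spine u v i (j + 1)))

theorem measurableSet_startEvent (u v : Fin d) (i j : ℕ) :
    MeasurableSet[sigmaOf Y (subtreeIndices ((0 : Fin (d + 1)), v :: List.replicate i u))]
      (startEvent Y α u v i j) := by
  refine MeasurableSet.inter ?_ (MeasurableSet.inter ?_ ?_)
  · refine IsGaussianNoise.sigmaOf_mono ?_ _ (measurable_spineSum Y u v i j measurableSet_Ici)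
    rintro _ ⟨k, _, rfl⟩
    exact ⟨rfl, spine_mem_subtree u v i k⟩
  · refine IsGaussianNoise.sigmaOf_mono ?_ _ (measurableSet_innovation Y _ _)
    rintro _ rfl
    exact ⟨rfl, spine_mem_subtree u v i j⟩
  · refine IsGaussianNoise.sigmaOf_mono ?_ _ (measurableSet_survivesForever Y _)
    rintro q ⟨h1, h2, _⟩
    exact ⟨h1, (spine_mem_subtree u v i j).trans h2⟩

/-- If two of these subtrees met, one defining list would be a suffix of the other, which would
place `v` among the letters `u`. -/
theorem disjoint_spine_subtreeIndices {u v : Fin d} (huv : u ≠ v) :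
    Pairwise (Function.onFun Disjoint
      fun i => subtreeIndices ((0 : Fin (d + 1)), v :: List.replicate i u)) := by
  have key : ∀ i j, i < j →
      Disjoint (subtreeIndices ((0 : Fin (d + 1)), v :: List.replicate i u))
        (subtreeIndices ((0 : Fin (d + 1)), v :: List.replicate j u)) := by
    intro i j hij
    refine Set.disjoint_left.2 fun q h h' => ?_
    have h1 := List.suffix_of_suffix_length_le h.2 h'.2 (by simpa using hij.le)
    rcases List.suffix_cons_iff.1 h1 with h2 | h2
    · have := congrArg List.length h2
      simp at this
      omega
    · have : v ∈ List.replicate j u := h2.subset (by simp)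
      exact huv (List.eq_of_mem_replicate this).symm
  intro i j hij
  rcases lt_or_gt_of_ne hij with h | h
  · exact key i j h
  · exact (key j i h).symm

variable {Y} [MeasurableSpace Ω] {P : Measure Ω} (hY : IsGaussianNoise P Y (noiseVariance d α))
include hY

theorem le_measureReal_goodEdge (hα : 0 < α) (e : Fin (d + 1) × List (Fin d)) :
    (gaussianReal 0 1).real (Set.Ici 1) * (1 / 2 * (1 - Real.exp (-(√α / (d * α + 1))))) ≤
      P.real (goodEdge Y α e) := by
  rw [goodEdge, hY.measureReal_inter (S := {(e, none)}) (T := Set.range fun q => (e, some q))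
    (by simp) (measurableSet_innovation Y _ e) (measurableSet_bridge Y _ _ e)]
  have h := measureReal_innovation hY hα 1 e
  rw [one_mul] at h
  rw [h]
  exact mul_le_mul_of_nonneg_left (le_measureReal_bridge hY hα e) measureReal_nonneg

/-- The bound `1 / 2` reproduces itself: the `d` children succeed independently with probability at
least `q / 2` each, so all fail with probability at most `exp (-d q / 2) ≤ exp (-1) < 1 / 2`. -/
theorem half_le_measureReal_survives (hα : 0 < α)
    (hq : 2 ≤ d * ((gaussianReal 0 1).real (Set.Ici 1) *
      (1 / 2 * (1 - Real.exp (-(√α / (d * α + 1))))))) (n : ℕ) (e : Fin (d + 1) × List (Fin d)) :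
    1 / 2 ≤ P.real (survives Y α n e) := by
  have hprob := hY.isProbabilityMeasure
  induction n generalizing e with
  | zero =>
    rw [survives, probReal_univ]
    norm_num
  | succ n ih =>
    set q := (gaussianReal 0 1).real (Set.Ici 1) *
      (1 / 2 * (1 - Real.exp (-(√α / (d * α + 1))))) with hqdef
    set B : Fin d → Set Ω := fun a => goodEdge Y α (e.1, a :: e.2) ∩ survives Y α n (e.1, a :: e.2)
    have hBm : ∀ a, MeasurableSet[sigmaOf Y (subtreeIndices (e.1, a :: e.2))] (B a) := fun a => by
      refine MeasurableSet.inter ?_ ?_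
      · refine IsGaussianNoise.sigmaOf_mono ?_ _ (measurableSet_goodEdge Y _)
        rintro j (hj : j.1 = _)
        exact ⟨by rw [hj], by rw [hj]⟩
      · exact IsGaussianNoise.sigmaOf_mono (descendants_subset_subtreeIndices _) _
          (measurableSet_survives Y n _)
    have hB : ∀ a, q / 2 ≤ P.real (B a) := fun a => by
      rw [hY.measureReal_inter (S := {j | j.1 = (e.1, a :: e.2)})
        (T := descendants (e.1, a :: e.2)) ?_ (measurableSet_goodEdge Y _)
        (measurableSet_survives Y n _)]
      · have h1 := le_measureReal_goodEdge hY hα (e.1, a :: e.2)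
        have h2 := ih (e.1, a :: e.2)
        have h3 : 0 ≤ P.real (goodEdge Y α (e.1, a :: e.2)) := measureReal_nonneg
        rw [← hqdef] at h1
        nlinarith
      · refine Set.disjoint_left.2 fun j (h : j.1 = _) h' => h'.2.2 (by rw [h])
    have hBm' : ∀ a, MeasurableSet (B a) := fun a => hY.sigmaOf_le _ _ (hBm a)
    have hprod : P.real (survives Y α (n + 1) e)ᶜ = ∏ a, (1 - P.real (B a)) := by
      have h := (hY.iIndep_sigmaOf (disjoint_subtreeIndices e)).meas_iInter
        (s := fun a => (B a)ᶜ) fun a => (hBm a).compl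
      rw [survives, Set.compl_iUnion, Measure.real, h, ENNReal.toReal_prod]
      exact Finset.prod_congr rfl fun a _ => probReal_compl_eq_one_sub (hBm' a)
    have hle : ∏ a, (1 - P.real (B a)) ≤ Real.exp (-1) := by
      calc ∏ a, (1 - P.real (B a)) ≤ ∏ _a : Fin d, Real.exp (-(q / 2)) := by
            refine Finset.prod_le_prod (fun a _ => sub_nonneg.2 measureReal_le_one) fun a _ => ?_
            have := Real.add_one_le_exp (-(q / 2))
            have := hB a
            linarith
        _ = Real.exp (-(d * q / 2)) := by
            rw [Finset.prod_const, Finset.card_univ, Fintype.card_fin, ← Real.exp_nat_mul]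
            congr 1
            ring
        _ ≤ Real.exp (-1) := Real.exp_le_exp.2 (by linarith)
    have hsm : MeasurableSet (survives Y α (n + 1) e) :=
      hY.sigmaOf_le _ _ (measurableSet_survives Y _ e)
    rw [probReal_compl_eq_one_sub hsm] at hprod
    have he : Real.exp (-1) ≤ 1 / 2 := by
      have := Real.exp_neg_one_lt_half
      linarith
    linarith

theorem half_le_measureReal_survivesForever (hα : 0 < α)
    (hq : 2 ≤ d * ((gaussianReal 0 1).real (Set.Ici 1) *
      (1 / 2 * (1 - Real.exp (-(√α / (d * α + 1))))))) (e : Fin (d + 1) × List (Fin d)) :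
    1 / 2 ≤ P.real (survivesForever Y α e) := by
  have hprob := hY.isProbabilityMeasure
  have hlim := tendsto_measure_iInter_atTop (μ := P)
    (fun n => (hY.sigmaOf_le _ _ (measurableSet_survives Y n e)).nullMeasurableSet)
    (survives_antitone (α := α) Y e) ⟨0, measure_ne_top _ _⟩
  exact ge_of_tendsto' ((ENNReal.tendsto_toReal (measure_ne_top P _)).comp hlim)
    fun n => half_le_measureReal_survives hY hα hq n e

/-- Only the symmetry of the law is used later, so its variance is left unspecified. -/
theorem exists_map_spineSum (u v : Fin d) (i j : ℕ) :
    ∃ w, P.map (spineSum Y α u v i j) = gaussianReal 0 w := by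
  have hprob := hY.isProbabilityMeasure
  induction j with
  | zero =>
    refine ⟨0, ?_⟩
    rw [gaussianReal_zero_var, show spineSum Y α u v i 0 = fun _ => 0 from rfl, Measure.map_const]
    simp
  | succ j ih =>
    obtain ⟨w, hw⟩ := ih
    have hm : Measurable (spineSum Y α u v i j) :=
      (measurable_spineSum Y u v i j).mono (hY.sigmaOf_le _) le_rfl
    have h1 : P.map (fun ω => returnRatio d α * spineSum Y α u v i j ω) =
        gaussianReal (returnRatio d α * 0) (.mk (returnRatio d α ^ 2) (sq_nonneg _) * w) := by
      rw [← gaussianReal_map_const_mul, ← hw, Measure.map_map (by fun_prop) hm]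
      rfl
    have hdisj : Disjoint (spineIndices u v i j) {(spine u v i (j + 1), none)} := by
      refine Set.disjoint_left.2 fun q ⟨k, hk, hq⟩ (hq' : q = _) => ?_
      have h := congrArg (fun q => q.1.2.length) (hq.symm.trans hq')
      simp only [length_spine] at h
      omega
    have hind : IndepFun (fun ω => returnRatio d α * spineSum Y α u v i j ω)
        (Y (spine u v i (j + 1), none)) P :=
      indep_of_indep_of_le_left (indep_of_indep_of_le_right (hY.indep_sigmaOf hdisj)
        (IsGaussianNoise.measurable_sigmaOf (Set.mem_singleton _)).comap_le)
        ((measurable_spineSum Y u v i j).const_mul _).comap_le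
    have h2 := gaussianReal_add_gaussianReal_of_indepFun hind h1 (hY.map_eq _)
    rw [mul_zero, add_zero] at h2
    exact ⟨_, h2⟩

/-- The three requirements involve disjoint sets of indices: the spine strictly above the vertex,
its own innovation, and its proper descendants. The resulting bound depends neither on `i` nor on
`j`. -/
theorem le_measureReal_startEvent (hα : 0 < α)
    (hq : 2 ≤ d * ((gaussianReal 0 1).real (Set.Ici 1) *
      (1 / 2 * (1 - Real.exp (-(√α / (d * α + 1))))))) (u v : Fin d) (i j : ℕ) :
    1 / 2 * ((gaussianReal 0 1).real (Set.Ici 2) * (1 / 2)) ≤ P.real (startEvent Y α u v i j) := by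
  have hprob := hY.isProbabilityMeasure
  have hm : Measurable (spineSum Y α u v i j) :=
    (measurable_spineSum Y u v i j).mono (hY.sigmaOf_le _) le_rfl
  have h1 : 1 / 2 ≤ P.real {ω | 0 ≤ spineSum Y α u v i j ω} := by
    obtain ⟨w, hw⟩ := exists_map_spineSum hY u v i j
    have := half_le_gaussianReal_Ici w
    rwa [← hw, map_measureReal_apply hm measurableSet_Ici] at this
  set e := spine u v i (j + 1) with he
  have hd2 : Disjoint ({(e, none)} : Set ((Fin (d + 1) × List (Fin d)) × Option (ℕ × ℕ)))
      (descendants e) := Set.disjoint_left.2 fun q (hq : q = _) h => h.2.2 (by rw [hq])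
  have hd1 : Disjoint (spineIndices u v i j) (subtreeIndices e) := by
    refine Set.disjoint_left.2 fun q ⟨k, hk, hq⟩ h => ?_
    have := h.2.length_le
    rw [hq, he] at this
    simp only [length_spine] at this
    omega
  have hs1 : ({(e, none)} : Set ((Fin (d + 1) × List (Fin d)) × Option (ℕ × ℕ))) ⊆
      subtreeIndices e := by
    rintro _ rfl
    exact ⟨rfl, List.suffix_rfl⟩
  have e1 := hY.measureReal_inter hd1 (measurable_spineSum (α := α) Y u v i j
    (measurableSet_Ici (a := 0)))
    ((IsGaussianNoise.sigmaOf_mono hs1 _ (measurableSet_innovation Y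
      (2 * threshold d α (e.2.length + 1)) e)).inter
      (IsGaussianNoise.sigmaOf_mono (descendants_subset_subtreeIndices e) _
        (measurableSet_survivesForever (α := α) Y e)))
  rw [hY.measureReal_inter hd2 (measurableSet_innovation Y _ e) (measurableSet_survivesForever Y e),
    measureReal_innovation hY hα 2 e] at e1
  refine le_trans ?_ e1.ge
  have h2 := half_le_measureReal_survivesForever hY hα hq e
  have h3 : 0 ≤ (gaussianReal 0 1).real (Set.Ici 2) := measureReal_nonneg
  exact mul_le_mul h1 (mul_le_mul_of_nonneg_left h2 h3) (by positivity) measureReal_nonneg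

/-- Second Borel–Cantelli lemma: the events live on disjoint subtrees, whatever the deterministic
lengths `m i`. -/
theorem ae_frequently_startEvent (hα : 0 < α)
    (hq : 2 ≤ d * ((gaussianReal 0 1).real (Set.Ici 1) *
      (1 / 2 * (1 - Real.exp (-(√α / (d * α + 1))))))) {u v : Fin d} (huv : u ≠ v) (m : ℕ → ℕ) :
    ∀ᵐ ω ∂P, ∃ᶠ i in atTop, ω ∈ startEvent Y α u v i (m i) := by
  have hprob := hY.isProbabilityMeasure
  have hm : ∀ i, MeasurableSet (startEvent Y α u v i (m i)) := fun i =>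
    hY.sigmaOf_le _ _ (measurableSet_startEvent Y u v i (m i))
  have hind : iIndepSet (fun i => startEvent Y α u v i (m i)) P := by
    refine (iIndepSet_iff_meas_biInter hm).2 fun s => ?_
    exact (hY.iIndep_sigmaOf (disjoint_spine_subtreeIndices huv)).meas_biInter fun i _ =>
      measurableSet_startEvent Y u v i (m i)
  set c := 1 / 2 * ((gaussianReal 0 1).real (Set.Ici 2) * (1 / 2)) with hc
  have hc0 : 0 < c := by
    have := gaussianReal_Ici_pos 2
    positivity
  have hsum : ∑' i, P (startEvent Y α u v i (m i)) = ⊤ := by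
    refine top_unique ((ENNReal.tsum_const_eq_top_of_ne_zero (α := ℕ) (c := ENNReal.ofReal c)
      (by simpa using hc0)).symm.le.trans (ENNReal.tsum_le_tsum fun i => ?_))
    exact ENNReal.ofReal_le_of_le_toReal (le_measureReal_startEvent hY hα hq u v i (m i))
  have h1 := measure_limsup_eq_one hm hind hsum
  rw [← prob_compl_eq_zero_iff (MeasurableSet.measurableSet_limsup hm)] at h1
  filter_upwards [compl_mem_ae_iff.2 h1] with ω hω
  rw [compl_compl] at hω
  exact mem_limsup_iff_frequently_mem.1 hω

end survival

/-! ### From the noise to connected components of level sets -/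

/-- The dyadic construction is monotone in its endpoints and commutes with adding a constant, for
fixed displacements. -/
theorem bridgeValue_add_le {a b a' b' m : ℝ} (ha : a' + m ≤ a) (hb : b' + m ≤ b) (x : ℕ × ℕ → ℝ)
    (n k : ℕ) : bridgeValue a' b' x n k + m ≤ bridgeValue a b x n k := by
  induction n generalizing k with
  | zero =>
    simp only [bridgeValue]
    split_ifs <;> assumption
  | succ n ih =>
    simp only [bridgeValue]
    split_ifs
    · exact ih _
    · have h1 := ih (k / 2)
      have h2 := ih (k / 2 + 1)
      linarith

namespace MassiveGraph

variable {V E : Type*} {G : MassiveGraph V E} {f : G.Cable → ℝ}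

theorem dyadicPoint_eq_bridgeValue {e : E} {x : ℕ × ℕ → ℝ}
    (hf : ∀ n k, f (G.dyadicPoint e (n + 1) (2 * k + 1)) =
      1 / 2 * (f (G.dyadicPoint e n k) + f (G.dyadicPoint e n (k + 1))) + x (n, k)) (n k : ℕ) :
    f (G.dyadicPoint e n k) =
      bridgeValue (f (.vertex (G.src e))) (f (.vertex (G.tgt e))) x n k := by
  induction n generalizing k with
  | zero =>
    rw [bridgeValue]
    split_ifs with h
    · rw [h, dyadicPoint_zero]
    · rw [dyadicPoint_of_ge e (by rw [pow_zero]; omega)]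
  | succ n ih =>
    rcases Nat.even_or_odd' k with ⟨j, rfl | rfl⟩
    · rw [bridgeValue_double, dyadicPoint_succ_double, ih]
    · rw [bridgeValue_double_add_one, hf, ih, ih]

theorem le_on_cable_of_le_dyadicPoint (hf : Continuous f) {e : E} {h : ℝ}
    (hd : ∀ n, ∀ k ≤ 2 ^ n, h ≤ f (G.dyadicPoint e n k)) (t : G.closedInterval (.inl e)) :
    h ≤ f (G.cablePoint (.inl e) t) := by
  obtain ⟨t, ht0, ht1⟩ := t
  have hℓ := G.edgeLength_pos e
  have hc := hf.comp (continuous_cablePoint (G := G) (.inl e))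
  set ℓ := 1 / (2 * G.weight e) with hℓdef
  have hr0 : 0 ≤ t / ℓ := div_nonneg ht0 hℓ.le
  have hr1 : t / ℓ ≤ 1 := (div_le_one hℓ).2 ht1
  have hk : ∀ n : ℕ, ⌊t / ℓ * 2 ^ n⌋₊ ≤ 2 ^ n := fun n => by
    refine Nat.floor_le_of_le ?_
    push_cast
    exact mul_le_of_le_one_left (by positivity) hr1
  set u : ℕ → G.closedInterval (.inl e) := fun n => ⟨ℓ * (⌊t / ℓ * 2 ^ n⌋₊ / 2 ^ n), by positivity,
    mul_le_of_le_one_right hℓ.le (by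
      rw [div_le_one (by positivity)]
      exact_mod_cast hk n)⟩ with hu
  have hlim : Tendsto u atTop (𝓝 ⟨t, ht0, ht1⟩) := by
    refine tendsto_subtype_rng.2 ?_
    have h1 := (tendsto_nat_floor_mul_div_atTop hr0).comp
      (tendsto_pow_atTop_atTop_of_one_lt (one_lt_two (α := ℝ)))
    have h2 := h1.const_mul ℓ
    rwa [mul_div_cancel₀ _ hℓ.ne'] at h2
  exact ge_of_tendsto' ((hc.tendsto _).comp hlim) fun n => hd n _ (hk n)

theorem tgt_mem_connectedComponentIn (hf : Continuous f) {e : E} {h : ℝ}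
    (hd : ∀ n, ∀ k ≤ 2 ^ n, h ≤ f (G.dyadicPoint e n k)) :
    (.vertex (G.tgt e) : G.Cable) ∈ connectedComponentIn (levelSet f h) (.vertex (G.src e)) := by
  have hℓ := G.edgeLength_pos e
  have : PreconnectedSpace (G.closedInterval (.inl e)) :=
    Subtype.preconnectedSpace isPreconnected_Icc
  have hpre := isPreconnected_range (continuous_cablePoint (G := G) (.inl e))
  refine hpre.subset_connectedComponentIn ?_ ?_ ?_
  · exact ⟨⟨0, le_rfl, hℓ.le⟩, edgePoint_zero e⟩
  · rintro _ ⟨t, rfl⟩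
    exact le_on_cable_of_le_dyadicPoint hf hd t
  · exact ⟨⟨1 / (2 * G.weight e), hℓ.le, le_rfl⟩, edgePoint_of_ge le_rfl⟩

end MassiveGraph

open MassiveGraph

section tree

variable {d : ℕ} {α : ℝ} {hα : 0 < α} {Ω : Type*}
  {Y : (Fin (d + 1) × List (Fin d)) × Option (ℕ × ℕ) → Ω → ℝ} {ω : Ω}
  {f : (weightedTree d α hα).Cable → ℝ}

/-- `f` is a continuous function with innovations and displacements `Y · ω`. -/
structure IsRealization (Y : (Fin (d + 1) × List (Fin d)) × Option (ℕ × ℕ) → Ω → ℝ) (ω : Ω)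
    (f : (weightedTree d α hα).Cable → ℝ) : Prop where
  continuous : Continuous f
  vertex : ∀ e, f (.vertex (some e)) = returnRatio d α * f (.vertex (treeParent e)) + Y (e, none) ω
  dyadic : ∀ e n k, f ((weightedTree d α hα).dyadicPoint e (n + 1) (2 * k + 1)) =
    1 / 2 * (f ((weightedTree d α hα).dyadicPoint e n k) +
      f ((weightedTree d α hα).dyadicPoint e n (k + 1))) + Y (e, some (n, k)) ω

namespace IsRealization

variable (hf : IsRealization Y ω f)
include hf

/-- The parent's value is nonnegative, so the innovation alone lifts the child above its threshold.
Both end values exceed the halved thresholds by at least half of the threshold of the parent, so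
positivity of the bridge between halved thresholds keeps the whole cable above that half. -/
theorem child_of_goodEdge (hα1 : α < 1) {e : Fin (d + 1) × List (Fin d)} {a : Fin d} {h : ℝ}
    (he : threshold d α (e.2.length + 1) ≤ f (.vertex (some e)))
    (hh : h ≤ threshold d α (e.2.length + 1) / 2) (hg : ω ∈ goodEdge Y α (e.1, a :: e.2)) :
    threshold d α ((a :: e.2).length + 1) ≤ f (.vertex (some (e.1, a :: e.2))) ∧
      (.vertex (some (e.1, a :: e.2)) : (weightedTree d α hα).Cable) ∈
        connectedComponentIn (levelSet f h) (.vertex (some e)) := by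
  have hp := returnRatio_pos d α
  have hpos := threshold_pos (d := d) hα (e.2.length + 1)
  have hmono := threshold_mono (d := d) hα hα1 (Nat.le_succ (e.2.length + 1))
  have hchild : threshold d α ((a :: e.2).length + 1) ≤ f (.vertex (some (e.1, a :: e.2))) := by
    rw [hf.vertex]
    refine hg.1.trans (le_add_of_nonneg_left (mul_nonneg hp.le ?_))
    exact hpos.le.trans he
  refine ⟨hchild, ?_⟩
  refine tgt_mem_connectedComponentIn (G := weightedTree d α hα) (e := (e.1, a :: e.2))
    hf.continuous fun n k hk => ?_
  rw [dyadicPoint_eq_bridgeValue (x := fun q => Y ((e.1, a :: e.2), some q) ω) (hf.dyadic _)]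
  have hb := hg.2 n k hk
  refine le_trans ?_ (bridgeValue_add_le
    (a' := threshold d α (e.2.length + 1) / 2) (b' := threshold d α (e.2.length + 1 + 1) / 2)
    (m := threshold d α (e.2.length + 1) / 2) ?_ ?_ _ n k)
  · exact hh.trans (le_add_of_nonneg_left hb.le)
  · refine le_trans (le_of_eq ?_) he
    ring
  · refine le_trans ?_ hchild
    simp only [List.length_cons]
    linarith

theorem exists_mem_connectedComponentIn (hα1 : α < 1) {h : ℝ} (n : ℕ)
    {e : Fin (d + 1) × List (Fin d)}
    (he : threshold d α (e.2.length + 1) ≤ f (.vertex (some e)))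
    (hh : h ≤ threshold d α (e.2.length + 1) / 2) (hs : ω ∈ survives Y α n e) :
    ∃ z, treeGeneration z = e.2.length + 1 + n ∧
      (.vertex z : (weightedTree d α hα).Cable) ∈
        connectedComponentIn (levelSet f h) (.vertex (some e)) := by
  induction n generalizing e with
  | zero =>
    refine ⟨some e, rfl, mem_connectedComponentIn (hh.trans (le_trans ?_ he))⟩
    linarith [threshold_pos (d := d) hα (e.2.length + 1)]
  | succ n ih =>
    obtain ⟨a, hg, hs'⟩ := Set.mem_iUnion.1 hs
    obtain ⟨h1, h2⟩ := hf.child_of_goodEdge hα1 he hh hg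
    have hmono := threshold_mono (d := d) hα hα1 (Nat.le_succ (e.2.length + 1))
    obtain ⟨z, hz, hz'⟩ := ih (e := (e.1, a :: e.2)) h1 (hh.trans (by
      simp only [List.length_cons, Nat.succ_eq_add_one] at hmono ⊢
      linarith)) hs'
    refine ⟨z, ?_, ?_⟩
    · rw [hz, List.length_cons]
      ring
    · rwa [connectedComponentIn_eq h2]

theorem hasUnboundedComponent (hα1 : α < 1) {h : ℝ} {e : Fin (d + 1) × List (Fin d)}
    (he : threshold d α (e.2.length + 1) ≤ f (.vertex (some e)))
    (hh : h ≤ threshold d α (e.2.length + 1) / 2) (hs : ω ∈ survivesForever Y α e) :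
    HasUnboundedComponent (levelSet f h) := by
  refine ⟨.vertex (some e), hh.trans (le_trans ?_ he), fun hfin => ?_⟩
  · linarith [threshold_pos (d := d) hα (e.2.length + 1)]
  · obtain ⟨N, hN⟩ := (hfin.image treeGeneration).bddAbove
    obtain ⟨z, hz, hz'⟩ := hf.exists_mem_connectedComponentIn hα1 (N + 1) he hh
      (Set.mem_iInter.1 hs (N + 1))
    have := hN ⟨z, hz', rfl⟩
    omega

theorem spine_eq (u v : Fin d) (i j : ℕ) :
    f (.vertex (some (spine u v i j))) =
      returnRatio d α ^ j * f (.vertex (some (spine u v i 0))) + spineSum Y α u v i j ω := by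
  induction j with
  | zero => simp [spineSum]
  | succ j ih =>
    rw [hf.vertex, show treeParent (spine u v i (j + 1)) = some (spine u v i j) from rfl, ih,
      spineSum]
    ring

/-- The initial deficit, at most `threshold d α j`, is damped by `p ^ (j + 1) ≤ 1`. The spine sum is
nonnegative, and the last innovation of twice the threshold at the end vertex absorbs the deficit,
because thresholds increase with the generation. -/
theorem hasUnboundedComponent_of_startEvent (hα1 : α < 1) {h : ℝ} {u v : Fin d} {i j : ℕ}
    (h0 : -threshold d α j ≤ f (.vertex (some (spine u v i 0))))
    (hh : h ≤ threshold d α i / 2) (hs : ω ∈ startEvent Y α u v i j) :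
    HasUnboundedComponent (levelSet f h) := by
  obtain ⟨h1, h2, h3⟩ := hs
  have hp := returnRatio_pos d α
  have hp1 := returnRatio_le_one d α
  have hmono := threshold_mono (d := d) hα hα1
  have hlen := length_spine u v i (j + 1)
  have hj : threshold d α j ≤ threshold d α ((spine u v i (j + 1)).2.length + 1) :=
    hmono (by omega)
  refine hf.hasUnboundedComponent hα1 (e := spine u v i (j + 1)) ?_ ?_ h3
  · rw [hf.spine_eq, spineSum]
    have h1' : 0 ≤ spineSum Y α u v i j ω := h1
    have h2' : 2 * threshold d α ((spine u v i (j + 1)).2.length + 1) ≤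
      Y (spine u v i (j + 1), none) ω := h2
    have h4 : -threshold d α j ≤
        returnRatio d α ^ (j + 1) * f (.vertex (some (spine u v i 0))) := by
      have hq1 := pow_le_one₀ (n := j + 1) hp.le hp1
      have hq0 := pow_pos hp (j + 1)
      have := threshold_pos (d := d) hα j
      nlinarith
    have h5 := mul_nonneg hp.le h1'
    linarith
  · have := hmono (show i ≤ (spine u v i (j + 1)).2.length + 1 by omega)
    linarith

end IsRealization

end tree

/-! ### Borel–Cantelli argument and conclusion -/

theorem ae_hasUnboundedComponent {d : ℕ} {α : ℝ} {hα : 0 < α} (hα1 : α < 1) (hd : 2 ≤ d)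
    (hq : 2 ≤ d * ((gaussianReal 0 1).real (Set.Ici 1) *
      (1 / 2 * (1 - Real.exp (-(√α / (d * α + 1)))))))
    {Ω : Type*} [MeasurableSpace Ω] {P : Measure Ω} [IsProbabilityMeasure P]
    {φ : (weightedTree d α hα).Cable → Ω → ℝ} (hφ : (weightedTree d α hα).IsGaussianFreeField P φ) :
    ∀ᵐ ω ∂P, ∀ h : ℝ, HasUnboundedComponent (levelSet (fun x => φ x ω) h) := by
  obtain ⟨Y, hY, hYφ⟩ := exists_treeNoise (by omega) hφ
  set u : Fin d := ⟨0, by omega⟩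
  set v : Fin d := ⟨1, by omega⟩
  have huv : u ≠ v := by simp [u, v]
  -- The thresholds tend to infinity, so `m` can be taken large enough that a deficit below
  -- `-threshold d α m` at the `i`-th vertex of the ray has summable probability. No information on
  -- the law of the field there is needed.
  have hex : ∀ i, ∃ m, P {ω | φ (.vertex (some (spine u v i 0))) ω < -threshold d α m} ≤
      ENNReal.ofReal ((1 / 2) ^ i) := by
    intro i
    have hanti : Antitone fun m => {ω | φ (.vertex (some (spine u v i 0))) ω < -threshold d α m} :=
      fun m n hmn ω (hω : _ < _) => hω.trans_le (neg_le_neg (threshold_mono hα hα1 hmn))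
    have hlim := tendsto_measure_iInter_atTop (μ := P) (fun m =>
      nullMeasurableSet_lt (hφ.isGaussianProcess.aemeasurable (.vertex (some (spine u v i 0))))
        (aemeasurable_const (b := -threshold d α m))) hanti ⟨0, measure_ne_top _ _⟩
    have hempty : ⋂ m, {ω | φ (.vertex (some (spine u v i 0))) ω < -threshold d α m} = ∅ := by
      refine Set.eq_empty_of_forall_notMem fun ω hω => ?_
      obtain ⟨m, hm⟩ := ((tendsto_threshold (d := d) hα hα1).eventually_ge_atTop
        (-φ (.vertex (some (spine u v i 0))) ω)).exists
      have : φ (.vertex (some (spine u v i 0))) ω < -threshold d α m := Set.mem_iInter.1 hω m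
      linarith
    rw [hempty, measure_empty] at hlim
    exact (hlim.eventually_le_const (ENNReal.ofReal_pos.2 (by positivity))).exists
  choose m hm using hex
  have hBC : ∀ᵐ ω ∂P, ∀ᶠ i in atTop,
      ω ∉ {ω | φ (.vertex (some (spine u v i 0))) ω < -threshold d α (m i)} := by
    refine ae_eventually_notMem (ne_top_of_le_ne_top ?_ (ENNReal.tsum_le_tsum hm))
    exact (summable_geometric_of_lt_one (by norm_num) (by norm_num)).tsum_ofReal_ne_top
  filter_upwards [hYφ, hφ.continuous, hBC, ae_frequently_startEvent hY hα hq huv m] with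
    ω h1 h2 h3 h4 h
  have hev : ∀ᶠ i in atTop, h ≤ threshold d α i / 2 := by
    filter_upwards [(tendsto_threshold (d := d) hα hα1).eventually_ge_atTop (2 * h)] with i hi
    linarith
  -- A successful attempt occurs infinitely often, while the controlled deficit and `h ≤ threshold d
  -- α i / 2` hold for all large `i`. The null sets were discarded before `h` was fixed.
  obtain ⟨i, hi, hi2, hi3⟩ := (h4.and_eventually (h3.and hev)).exists
  exact IsRealization.hasUnboundedComponent_of_startEvent ⟨h2, h1.1, h1.2⟩ hα1 (not_lt.1 hi2) hi3 hi

theorem proposition7p1 :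
    ∃ C : ℝ, ∀ (d : ℕ) (α : ℝ) (hα : 0 < α), 2 ≤ d → α < 1 →
      C < d * (1 - Real.exp (-(Real.sqrt α / (d * α + 1)))) →
      ∀ {Ω : Type*} [MeasurableSpace Ω] (P : Measure Ω) [IsProbabilityMeasure P]
        (φ : (weightedTree d α hα).Cable → Ω → ℝ),
        (weightedTree d α hα).IsGaussianFreeField P φ →
          (∀ᵐ ω ∂P, ∀ h : ℝ,
            MassiveGraph.HasUnboundedComponent
              (MassiveGraph.levelSet (fun x => φ x ω) h)) ∧
          MassiveGraph.criticalParameter P φ = ⊤ := by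
  have hc := gaussianReal_Ici_pos 1
  set c := (gaussianReal 0 1).real (Set.Ici 1) with hcdef
  -- The constant `4 / c` is what `d q ≥ 2` requires for the good-edge bound `q = c / 2 * (1 - exp
  -- …)`.
  refine ⟨4 / c, fun d α hα hd hα1 hC Ω _ P _ φ hφ => ?_⟩
  have hq : 2 ≤ d * (c * (1 / 2 * (1 - Real.exp (-(√α / (d * α + 1)))))) := by
    rw [div_lt_iff₀ hc] at hC
    linarith
  have hae := ae_hasUnboundedComponent hα1 hd hq hφ
  refine ⟨hae, ?_⟩
  -- At every level the event has full measure, so no level qualifies, and the infimum of the empty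
  -- set in `EReal` is `⊤`.
  have hempty : {h : ℝ | P {ω | HasUnboundedComponent (levelSet (fun x => φ x ω) h)} = 0} = ∅ := by
    refine Set.eq_empty_of_forall_notMem fun h (hh : P _ = 0) => ?_
    have h1 : P Set.univ = 0 := by
      refine measure_mono_null_ae ?_ hh
      filter_upwards [hae] with ω hω _ using hω h
    simp at h1
  rw [criticalParameter, hempty, Set.image_empty, sInf_empty]
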